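/- Consider the two-user MIMO Gaussian interference channel with fixed real channel matrices $H_{ij}$, $$Y_1=H_{11}X_1+H_{12}X_2+Z_1,\qquad Y_2=H_{21}X_1+H_{22}X_2+Z_2,$$ where user $i$ has $t_i$ transmit and $r_i$ receive antennas, and $Z_i\sim\mathcal N(0,I)$ is i.i.d. in time. The average power constraint is $\frac1n\sum_{k=1}^n\mathbb E[X_{ik}X_{ik}^\top]\in\mathcal Q_i$, where $\mathcal Q_i=\{Q\succeq 0:\ \operatorname{tr}Q\le P_i\}$ and the expectation is over the uniformly distributed message. Rates are measured in nats per channel use. A rate pair $(R_1,R_2)$ is achievable if there are block codes of length $n$ with $\lceil e^{nR_i}\rceil$ messages for user $i$, one for each $n$, that satisfy the power constraints and whose average probabilities of decoding error at both receivers tend to $0$ as $n\to\infty$. The capacity region is the closure of the set of achievable rate pairs, and the sum capacity $\mathcal C_{\rm sum}$ is the supremum of $R_1+R_2$ over the capacity region. For positive semidefinite $Q_1,Q_2$ let $$R_{\rm TIN}(Q_1,Q_2)=I(X_{1G};Y_{1G})+I(X_{2G};Y_{2G})$$ be the sum rate of Gaussian inputs with interference treated as noise (TIN), where $Y_{iG}$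 is the channel output $Y_i$ for independent inputs $X_{1G}\sim\mathcal N(0,Q_1)$, $X_{2G}\sim\mathcal N(0,Q_2)$. **Theorem.** Suppose that $(Q_1^*,Q_2^*)\in\mathcal Q_1\times\mathcal Q_2$ is a local maximizer of $R_{\rm TIN}$ over $\mathcal Q_1\times\mathcal Q_2$, that $Q_1^*$ and $Q_2^*$ have full rank, and that there are real matrices $A_1\in\mathbb R^{r_1\times r_2}$, $A_2\in\mathbb R^{r_2\times r_1}$ and symmetric positive definite matrices $\Sigma_1\in\mathbb R^{r_2\times r_2}$, $\Sigma_2\in\mathbb R^{r_1\times r_1}$ with $$\Sigma_1\preceq I-A_2\Sigma_2^{-1}A_2^\top,\qquad \Sigma_2\preceq I-A_1\Sigma_1^{-1}A_1^\top,$$ $$\bigl(A_1^\top(H_{12}Q_2^*H_{12}^\top+I)^{-1}H_{11}-H_{21}\bigr)Q_1^*=0,\qquad \bigl(A_2^\top(H_{21}Q_1^*H_{21}^\top+I)^{-1}H_{22}-H_{12}\bigr)Q_2^*=0.$$ Then Gaussian inputs with interference treated as noise achieve the sum capacity: for $X_{iG}\sim\mathcal N(0,Q_i^*)$ the rate pair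 $\bigl(I(X_{1G};Y_{1G}),I(X_{2G};Y_{2G})\bigr)$ lies in the capacity region, and $$\mathcal C_{\rm sum}=R_{\rm TIN}(Q_1^*,Q_2^*).$$ -/

import Mathlib

open Filter Topology MeasureTheory
open scoped NNReal ENNReal

noncomputable section

namespace MIMO

/-- Real column vectors of length `k`. -/
abbrev RVec (k : ℕ) : Type := EuclideanSpace ℝ (Fin k)

/-- The two-user MIMO Gaussian interference channel
`Y₁ = H₁₁ X₁ + H₁₂ X₂ + Z₁`, `Y₂ = H₂₁ X₁ + H₂₂ X₂ + Z₂`, with `Zᵢ ∼ N(0, I)` i.i.d. in time and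
power budgets `P₁`, `P₂`; user `i` has `tᵢ` transmit and `rᵢ` receive antennas. -/
structure InterferenceChannel (t₁ t₂ r₁ r₂ : ℕ) where
  H₁₁ : Matrix (Fin r₁) (Fin t₁) ℝ
  H₁₂ : Matrix (Fin r₁) (Fin t₂) ℝ
  H₂₁ : Matrix (Fin r₂) (Fin t₁) ℝ
  H₂₂ : Matrix (Fin r₂) (Fin t₂) ℝ
  P₁ : ℝ
  P₂ : ℝ

/-- The set `{Q : Q ⪰ 0, tr Q ≤ P}` of covariance matrices obeying the trace power constraint. -/
def powerSet (t : ℕ) (P : ℝ) : Set (Matrix (Fin t) (Fin t) ℝ) :=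
  {Q | Q.PosSemidef ∧ Q.trace ≤ P}

/-! ### Block codes and sum capacity -/

/-- A codebook of block length `n` with `M` codewords for a transmitter with `t` antennas. -/
abbrev Codebook (M n t : ℕ) : Type := Fin M → Fin n → RVec t

/-- `(1/n) ∑ₖ 𝔼[Xₖ Xₖᵀ]`, where `X` is the codeword of a uniformly distributed message. -/
def avgCov {M n t : ℕ} (c : Codebook M n t) : Matrix (Fin t) (Fin t) ℝ :=
  (n : ℝ)⁻¹ • ∑ k, (M : ℝ)⁻¹ • ∑ m, Matrix.vecMulVec (c m k).ofLp (c m k).ofLp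

/-- The law of the noise over `n` channel uses: i.i.d. `N(0, I)` vectors. -/
def noiseLaw (n r : ℕ) : Measure (Fin n → RVec r) :=
  Measure.pi fun _ => ProbabilityTheory.stdGaussian (RVec r)

/-- Average probability of decoding error at a receiver with direct channel `H`, cross channel `G`
and decoder `d`, when its transmitter uses the codebook `c`, the interferer uses the codebook `c'`,
and the two messages are independent and uniformly distributed. -/
def errorProb {M M' n t t' r : ℕ} (H : Matrix (Fin r) (Fin t) ℝ) (G : Matrix (Fin r) (Fin t') ℝ)
    (c : Codebook M n t) (c' : Codebook M' n t') (d : (Fin n → RVec r) → Fin M) : ℝ :=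
  ((M : ℝ) * M')⁻¹ * ∑ m, ∑ m',
    (noiseLaw n r).real {z | d (fun k => H.toEuclideanLin (c m k) + G.toEuclideanLin (c' m' k) + z k) ≠ m}

/-- Number of messages `⌈exp (n R)⌉` of a code of block length `n` and rate `R` (in nats). -/
def numMsg (n : ℕ) (R : ℝ≥0) : ℕ := ⌈Real.exp (n * R)⌉₊

/-- A block code of length `n` and rates `R₁, R₂` (nats per channel use). -/
structure Code (t₁ t₂ r₁ r₂ n : ℕ) (R₁ R₂ : ℝ≥0) where
  enc₁ : Codebook (numMsg n R₁) n t₁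
  enc₂ : Codebook (numMsg n R₂) n t₂
  dec₁ : (Fin n → RVec r₁) → Fin (numMsg n R₁)
  dec₂ : (Fin n → RVec r₂) → Fin (numMsg n R₂)
  measurable_dec₁ : Measurable dec₁
  measurable_dec₂ : Measurable dec₂

namespace InterferenceChannel

variable {t₁ t₂ r₁ r₂ : ℕ} (ch : InterferenceChannel t₁ t₂ r₁ r₂)

/-- `(R₁, R₂)` is achievable: there are codes of these rates, one for each block length, that meet
the average power constraints and whose error probabilities at both receivers tend to `0`. -/
def Achievable (R₁ R₂ : ℝ≥0) : Prop :=
  ∃ C : ∀ n : ℕ, Code t₁ t₂ r₁ r₂ n R₁ R₂,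
    (∀ n, avgCov (C n).enc₁ ∈ powerSet t₁ ch.P₁ ∧ avgCov (C n).enc₂ ∈ powerSet t₂ ch.P₂) ∧
    Tendsto (fun n => errorProb ch.H₁₁ ch.H₁₂ (C n).enc₁ (C n).enc₂ (C n).dec₁) atTop (𝓝 0) ∧
    Tendsto (fun n => errorProb ch.H₂₂ ch.H₂₁ (C n).enc₂ (C n).enc₁ (C n).dec₂) atTop (𝓝 0)

/-- The capacity region: the closure of the set of achievable rate pairs. -/
def capacityRegion : Set (ℝ≥0 × ℝ≥0) :=
  closure {R | ch.Achievable R.1 R.2}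

/-- The sum capacity (in nats per channel use). -/
def sumCapacity : ℝ≥0∞ :=
  ⨆ R ∈ ch.capacityRegion, ((R.1 : ℝ≥0∞) + (R.2 : ℝ≥0∞))

end InterferenceChannel

/-! ### Gaussian inputs, treating interference as noise -/

/-- Mutual information (in nats) between the two components of a random pair with law `ρ`. -/
def mutualInfo {α β : Type*} [MeasurableSpace α] [MeasurableSpace β] (ρ : Measure (α × β)) :
    ℝ≥0∞ :=
  InformationTheory.klDiv ρ (ρ.fst.prod ρ.snd)

/-- The joint law of `(X, H X + G X' + Z)` for independent `X ∼ N(0, Q)`, `X' ∼ N(0, Q')`,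
`Z ∼ N(0, I)`. -/
def gaussianInOut {t t' r : ℕ} (H : Matrix (Fin r) (Fin t) ℝ) (G : Matrix (Fin r) (Fin t') ℝ)
    (Q : Matrix (Fin t) (Fin t) ℝ) (Q' : Matrix (Fin t') (Fin t') ℝ) :
    Measure (RVec t × RVec r) :=
  ((ProbabilityTheory.multivariateGaussian 0 Q).prod
    ((ProbabilityTheory.multivariateGaussian 0 Q').prod
      (ProbabilityTheory.stdGaussian (RVec r)))).map
    fun w : RVec t × RVec t' × RVec r =>
      (w.1, H.toEuclideanLin w.1 + G.toEuclideanLin w.2.1 + w.2.2)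

/-- The rate `I(X_G; Y_G)` at a receiver with direct channel `H` and cross channel `G` that treats
interference as noise, under Gaussian inputs with covariances `Q` (own) and `Q'` (interferer). -/
def tinRate {t t' r : ℕ} (H : Matrix (Fin r) (Fin t) ℝ) (G : Matrix (Fin r) (Fin t') ℝ)
    (Q : Matrix (Fin t) (Fin t) ℝ) (Q' : Matrix (Fin t') (Fin t') ℝ) : ℝ≥0∞ :=
  mutualInfo (gaussianInOut H G Q Q')

namespace InterferenceChannel

variable {t₁ t₂ r₁ r₂ : ℕ} (ch : InterferenceChannel t₁ t₂ r₁ r₂)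

/-- The sum rate of Gaussian inputs with interference treated as noise,
`I(X₁G; Y₁G) + I(X₂G; Y₂G)`. -/
def tinSumRate (Q₁ : Matrix (Fin t₁) (Fin t₁) ℝ) (Q₂ : Matrix (Fin t₂) (Fin t₂) ℝ) : ℝ≥0∞ :=
  tinRate ch.H₁₁ ch.H₁₂ Q₁ Q₂ + tinRate ch.H₂₂ ch.H₂₁ Q₂ Q₁

end InterferenceChannel

end MIMO

end

/-!
The capacity region contains the pair of treating-interference-as-noise rates by random coding, and
a genie-aided outer bound shows that no sum rate exceeds them. All information measures are
handled through explicit Gaussian log-densities, so that each information inequality becomes an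
instance of Gibbs' inequality `1 + ∫ φ ≤ ∫ exp φ`.

*Outer bound.* Write `Nᵢ` for the covariance of interference plus noise at receiver `i` under the
inputs `N(0, Qᵢ)`, and `Vᵢ = Nᵢ - Aᵢ Sᵢ⁻¹ Aᵢᵀ` for its conditional covariance given the genie noise.
The genie hands receiver `1` the signal `H₂₁ X₁ + W₁`, where `W₁` has covariance `S₁` and
cross-covariance `A₁` with the noise `Z₁`. For full-rank `Q₁` the smartness condition says that
`A₁ᵀ N₁⁻¹ H₁₁ = H₂₁`, so under Gaussian inputs the genie signal is `A₁ᵀ N₁⁻¹ Y₁` plus noise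
independent of everything else: it carries no information on `X₁` beyond `Y₁`
(`smart_covariance`, `logGauss_add_logGauss_schur`). For an arbitrary code, `genie_fano` bounds the
rate of user `1` by the TIN expression of its output, evaluated at the Gaussian reference laws, plus
the divergence from `N(0, V₁)` of `U₁`, the codewords of user `2` seen through `H₁₂` plus a
noise of covariance `1 - A₁ S₁⁻¹ A₁ᵀ`, minus the divergence of the genie signal of user `1` from its
Gaussian reference law. By usefulness `S₂ ≼ 1 - A₁ S₁⁻¹ A₁ᵀ`, so `U₁` is the genie signal of user
`2` with more noise, and data processing (`integral_mixLLR_add_noise_le`) cancels the divergences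
of the two users against each other. What is left is the sum of the tangent planes
`tangentRate` of the two Gaussian rates at `(Q₁, Q₂)`, evaluated at the covariances of the code
(`sum_rate_le_tangentRate_of_centred`); codes are first centred, which only lowers their power. The
feasible set is convex, so at a local maximizer the tangent plane stays below the maximum
(`tangentRate_le_of_isLocalMaxOn`).

*Achievability.* Both codebooks are drawn i.i.d. from `N(0, (1 - ε) Qᵢ)` and each receiver compares
the information density of every codeword with a threshold. Averaged over the interfering codebook,
interference plus noise is exactly Gaussian, so the law of large numbers and Markov's inequality
bound the average error (`lintegral_errorProb_thresholdDec_le`). Each codebook meets its power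
constraint with probability at least `ε`, which leaves a good pair of codebooks at every block
length (`achievable_of_lt_gaussRate`); then `ε` tends to `0` (`gaussRate_mem_capacityRegion`).
-/

noncomputable section

namespace MIMO

open ProbabilityTheory Matrix

/-! ### Gaussian densities and moments -/

variable {r : ℕ}

/-- The quadratic form `xᵀ M x`. -/
def quad (M : Matrix (Fin r) (Fin r) ℝ) (x : RVec r) : ℝ := x.ofLp ⬝ᵥ M *ᵥ x.ofLp

/-- The log-density of `N(0, S)` with respect to Lebesgue measure, for positive definite `S`. -/
def logGauss (S : Matrix (Fin r) (Fin r) ℝ) (x : RVec r) : ℝ :=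
  -(r * Real.log (2 * Real.pi) + Real.log S.det + quad S⁻¹ x) / 2

@[fun_prop]
lemma continuous_quad (M : Matrix (Fin r) (Fin r) ℝ) : Continuous (quad M) := by
  unfold quad
  simp only [dotProduct, mulVec]
  fun_prop

@[fun_prop]
lemma continuous_logGauss (S : Matrix (Fin r) (Fin r) ℝ) : Continuous (logGauss S) := by
  unfold logGauss
  fun_prop

lemma quad_one (x : RVec r) : quad 1 x = ‖x‖ ^ 2 := by
  simp [quad, EuclideanSpace.real_norm_sq_eq, dotProduct, ← pow_two]

lemma stdGaussian_eq_withDensity :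
    stdGaussian (RVec r) = volume.withDensity fun x => ENNReal.ofReal (Real.exp (logGauss 1 x)) := by
  have hexp : ∀ x : RVec r, Real.exp (logGauss 1 x) =
      Real.exp (-(r * Real.log (2 * Real.pi)) / 2) * Real.exp (-(1 / 2) * ‖x‖ ^ 2) := by
    intro x
    rw [← Real.exp_add]
    congr 1
    simp [logGauss, quad_one]
    ring
  have hint : Integrable (fun x : RVec r => Real.exp (logGauss 1 x)) := by
    simp_rw [hexp]
    refine Integrable.const_mul ?_ _
    have := GaussianFourier.integrable_cexp_neg_mul_sq_norm_add (V := RVec r)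
      (b := (1 / 2 : ℂ)) (by norm_num) 0 0
    have h2 := this.norm
    refine h2.congr (Eventually.of_forall fun x => ?_)
    simp only [Complex.norm_exp]
    congr 1
    simp [← Complex.ofReal_pow]
  have : IsFiniteMeasure (volume.withDensity fun x : RVec r =>
      ENNReal.ofReal (Real.exp (logGauss 1 x))) :=
    isFiniteMeasure_withDensity_ofReal hint.hasFiniteIntegral
  refine Measure.ext_of_charFun ?_
  ext t
  rw [charFun_stdGaussian, charFun_apply,
    integral_withDensity_eq_integral_toReal_smul (by fun_prop) (by simp)]
  have h := GaussianFourier.integral_cexp_neg_mul_sq_norm_add (V := RVec r)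
      (b := (1 / 2 : ℂ)) (by norm_num) Complex.I t
  have h1 : ∀ x : RVec r, (ENNReal.ofReal (Real.exp (logGauss 1 x))).toReal •
      Complex.exp (inner ℝ x t * Complex.I) =
      (Real.exp (-(r * Real.log (2 * Real.pi)) / 2) : ℂ) *
        Complex.exp (-(1 / 2) * ‖x‖ ^ 2 + Complex.I * inner ℝ t x) := by
    intro x
    rw [ENNReal.toReal_ofReal (Real.exp_pos _).le, hexp, Complex.exp_add, real_inner_comm]
    simp
    ring_nf
  simp_rw [h1]
  rw [integral_const_mul, h]
  have h2 : ((Real.pi : ℂ) / (1 / 2)) ^ ((Module.finrank ℝ (RVec r) : ℂ) / 2) =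
      (Real.exp (r * Real.log (2 * Real.pi) / 2) : ℂ) := by
    rw [show ((Real.pi : ℂ) / (1 / 2)) = ((2 * Real.pi : ℝ) : ℂ) by push_cast; ring]
    rw [Complex.cpow_def_of_ne_zero (by exact_mod_cast (by positivity : (2 * Real.pi : ℝ) ≠ 0)),
      ← Complex.ofReal_log (by positivity)]
    simp
    ring_nf
  rw [h2, ← mul_assoc, ← Complex.ofReal_mul, ← Real.exp_add]
  simp
  rw [← Complex.exp_add]
  ring_nf

lemma inner_toEuclideanLin {r s : ℕ} (M : Matrix (Fin r) (Fin s) ℝ) (x : RVec s) (t : RVec r) :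
    inner ℝ (M.toEuclideanLin x) t = inner ℝ x (Mᵀ.toEuclideanLin t) := by
  simp [EuclideanSpace.inner_eq_star_dotProduct, Matrix.toLpLin_apply, dotProduct_mulVec,
    mulVec_transpose]

@[fun_prop]
lemma continuous_toEuclideanLin {r s : ℕ} (M : Matrix (Fin r) (Fin s) ℝ) :
    Continuous fun x => M.toEuclideanLin x := LinearMap.continuous_of_finiteDimensional _

lemma map_multivariateGaussian {r s : ℕ} (M : Matrix (Fin r) (Fin s) ℝ)
    {S : Matrix (Fin s) (Fin s) ℝ} (hS : S.PosSemidef) :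
    (multivariateGaussian 0 S).map (fun x => M.toEuclideanLin x) =
      multivariateGaussian 0 (M * S * Mᵀ) := by
  have hS' : (M * S * Mᵀ).PosSemidef := by
    simpa using hS.mul_mul_conjTranspose_same M
  have : IsProbabilityMeasure ((multivariateGaussian 0 S).map (fun x => M.toEuclideanLin x)) :=
    Measure.isProbabilityMeasure_map (by fun_prop)
  refine Measure.ext_of_charFun ?_
  ext t
  rw [charFun_multivariateGaussian hS', charFun_apply, integral_map (by fun_prop) (by fun_prop)]
  simp_rw [inner_toEuclideanLin]
  rw [← charFun_apply, charFun_multivariateGaussian hS]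
  have h : (Mᵀ *ᵥ t.ofLp) ⬝ᵥ S *ᵥ (Mᵀ *ᵥ t.ofLp) = t.ofLp ⬝ᵥ (M * S * Mᵀ) *ᵥ t.ofLp := by
    rw [mulVec_transpose, ← dotProduct_mulVec, ← mulVec_transpose, mulVec_mulVec, mulVec_mulVec,
      Matrix.mul_assoc]
  simp [Matrix.toLpLin_apply, -mulVec_mulVec, h]

lemma conv_multivariateGaussian {S T : Matrix (Fin r) (Fin r) ℝ} (hS : S.PosSemidef)
    (hT : T.PosSemidef) :
    ((multivariateGaussian 0 S).prod (multivariateGaussian 0 T)).map (fun p => p.1 + p.2) =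
      multivariateGaussian 0 (S + T) := by
  change (multivariateGaussian 0 S) ∗ (multivariateGaussian 0 T) = _
  refine Measure.ext_of_charFun ?_
  ext t
  rw [charFun_conv, charFun_multivariateGaussian hS, charFun_multivariateGaussian hT,
    charFun_multivariateGaussian (hS.add hT), ← Complex.exp_add]
  simp [add_mulVec]
  ring_nf

lemma map_prod_multivariateGaussian {s₁ s₂ : ℕ} (A : Matrix (Fin r) (Fin s₁) ℝ)
    (B : Matrix (Fin r) (Fin s₂) ℝ)
    {S : Matrix (Fin s₁) (Fin s₁) ℝ} {T : Matrix (Fin s₂) (Fin s₂) ℝ} (hS : S.PosSemidef)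
    (hT : T.PosSemidef) :
    ((multivariateGaussian 0 S).prod (multivariateGaussian 0 T)).map
      (fun p => A.toEuclideanLin p.1 + B.toEuclideanLin p.2) =
      multivariateGaussian 0 (A * S * Aᵀ + B * T * Bᵀ) := by
  rw [← conv_multivariateGaussian (by simpa using hS.mul_mul_conjTranspose_same A)
    (by simpa using hT.mul_mul_conjTranspose_same B), ← map_multivariateGaussian A hS,
    ← map_multivariateGaussian B hT, Measure.map_prod_map _ _ (by fun_prop) (by fun_prop),
    Measure.map_map (by fun_prop) (by fun_prop)]
  rfl

open scoped MatrixOrder in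
lemma multivariateGaussian_eq_withDensity {S : Matrix (Fin r) (Fin r) ℝ} (hS : S.PosDef) :
    multivariateGaussian 0 S =
      volume.withDensity fun x => ENNReal.ofReal (Real.exp (logGauss S x)) := by
  set R := CFC.sqrt S with hR
  have hRR : R * R = S := CFC.sqrt_mul_sqrt_self _ hS.posSemidef.nonneg
  have hRpsd : R.PosSemidef := Matrix.nonneg_iff_posSemidef.1 (CFC.sqrt_nonneg S)
  have hdet : R.det * R.det = S.det := by rw [← det_mul, hRR]
  have hSdet := hS.det_pos
  have hRdet0 : R.det ≠ 0 := by
    intro h; rw [h] at hdet; simp at hdet; exact hSdet.ne hdet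
  have hRdet : 0 < R.det := lt_of_le_of_ne hRpsd.det_nonneg hRdet0.symm
  have hRT : Rᵀ = R := by simpa using hRpsd.isHermitian.eq
  have hRinvT : (R⁻¹)ᵀ = R⁻¹ := by rw [transpose_nonsing_inv, hRT]
  have hU : IsUnit R.det := hRdet0.isUnit
  have hquad : ∀ x : RVec r, quad S⁻¹ (R.toEuclideanLin x) = quad 1 x := by
    intro x
    have h1 : R * S⁻¹ * R = 1 := by
      rw [← hRR, Matrix.mul_inv_rev]
      simp [← Matrix.mul_assoc, Matrix.mul_nonsing_inv _ hU, Matrix.nonsing_inv_mul _ hU]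
    simp only [quad, Matrix.toLpLin_apply]
    rw [mulVec_mulVec, ← vecMul_transpose, ← dotProduct_mulVec, mulVec_mulVec, hRT,
      ← Matrix.mul_assoc, h1]
  have hlog : ∀ x : RVec r, logGauss 1 x =
      logGauss S (R.toEuclideanLin x) + Real.log R.det := by
    intro x
    simp only [logGauss, hquad, ← hdet, Real.log_mul hRdet0 hRdet0]
    simp
    ring
  have hlin : ∀ x : RVec r, (toEuclideanCLM (𝕜 := ℝ) R) x = R.toEuclideanLin x := fun x => rfl
  have hmap : (volume : Measure (RVec r)).map R.toEuclideanLin =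
      ENNReal.ofReal |(LinearMap.det R.toEuclideanLin)⁻¹| • volume :=
    Measure.map_linearMap_addHaar_eq_smul_addHaar _ (by simpa using hRdet0)
  refine Measure.ext_of_lintegral _ fun f hf => ?_
  rw [multivariateGaussian, lintegral_map hf (by fun_prop), stdGaussian_eq_withDensity,
    lintegral_withDensity_eq_lintegral_mul _ (by fun_prop) (by fun_prop),
    lintegral_withDensity_eq_lintegral_mul _ (by fun_prop) hf]
  simp only [zero_add, Pi.mul_apply, ← hR, hlin]
  have : ∀ x : RVec r, ENNReal.ofReal (Real.exp (logGauss 1 x)) * f (R.toEuclideanLin x) =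
      ENNReal.ofReal R.det * (fun y => ENNReal.ofReal (Real.exp (logGauss S y)) * f y)
        (R.toEuclideanLin x) := by
    intro x
    rw [hlog, Real.exp_add, Real.exp_log hRdet, mul_comm (Real.exp _), ENNReal.ofReal_mul hRdet.le]
    ring
  simp_rw [this]
  rw [lintegral_const_mul _ (by fun_prop), ← lintegral_map
    (f := fun y => ENNReal.ofReal (Real.exp (logGauss S y)) * f y)
    (g := fun x => R.toEuclideanLin x) (by fun_prop) (by fun_prop)]
  rw [hmap, lintegral_smul_measure, smul_eq_mul, ← mul_assoc, ← ENNReal.ofReal_mul hRdet.le]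
  have : R.det * |(LinearMap.det R.toEuclideanLin)⁻¹| = 1 := by
    rw [show LinearMap.det R.toEuclideanLin = R.det by simp, abs_of_pos (by positivity)]
    field_simp
  rw [this]; simp

lemma memLp_eval_multivariateGaussian {S : Matrix (Fin r) (Fin r) ℝ} (i : Fin r) :
    MemLp (fun x : RVec r => x.ofLp i) 2 (multivariateGaussian 0 S) := by
  have h : MemLp (fun x : RVec r => x) 2 (multivariateGaussian 0 S) := IsGaussian.memLp_two_id
  exact h.continuousLinearMap_comp (EuclideanSpace.proj i : RVec r →L[ℝ] ℝ)

lemma integral_eval_multivariateGaussian {S : Matrix (Fin r) (Fin r) ℝ} (i : Fin r) :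
    ∫ x, x.ofLp i ∂(multivariateGaussian (0 : RVec r) S) = 0 := by
  have h := (EuclideanSpace.proj i : RVec r →L[ℝ] ℝ).integral_comp_comm
    (μ := multivariateGaussian (0 : RVec r) S) (φ := fun x => x) IsGaussian.integrable_id
  simpa using h

lemma integral_mul_multivariateGaussian {S : Matrix (Fin r) (Fin r) ℝ} (hS : S.PosSemidef)
    (i j : Fin r) :
    ∫ x, x.ofLp i * x.ofLp j ∂(multivariateGaussian (0 : RVec r) S) = S i j := by
  have h := covariance_eval_multivariateGaussian (μ := (0 : RVec r)) hS i j
  rw [covariance_eq_sub (memLp_eval_multivariateGaussian i)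
    (memLp_eval_multivariateGaussian j)] at h
  simpa [integral_eval_multivariateGaussian] using h

lemma quad_add_eq_sum (M : Matrix (Fin r) (Fin r) ℝ) (c x : RVec r) :
    quad M (c + x) =
      ∑ i, ∑ j, M i j * ((c i * c j + c i * x.ofLp j) + (c j * x.ofLp i + x.ofLp i * x.ofLp j)) := by
  simp only [quad, dotProduct, mulVec, Finset.mul_sum]
  refine Finset.sum_congr rfl fun i _ => Finset.sum_congr rfl fun j _ => ?_
  simp
  ring

lemma integrable_quad_add {S : Matrix (Fin r) (Fin r) ℝ}
    (M : Matrix (Fin r) (Fin r) ℝ) (c : RVec r) :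
    Integrable (fun x => quad M (c + x)) (multivariateGaussian 0 S) := by
  have h1 : ∀ i, Integrable (fun x : RVec r => x.ofLp i) (multivariateGaussian 0 S) := fun i =>
    (memLp_eval_multivariateGaussian i).integrable (by norm_num)
  have h2 : ∀ i j, Integrable (fun x : RVec r => x.ofLp i * x.ofLp j)
      (multivariateGaussian 0 S) := fun i j =>
    (memLp_eval_multivariateGaussian i).integrable_mul (memLp_eval_multivariateGaussian j)
  simp_rw [quad_add_eq_sum]
  refine integrable_finsetSum _ fun i _ => integrable_finsetSum _ fun j _ =>
    Integrable.const_mul ?_ _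
  exact ((integrable_const _).add ((h1 j).const_mul _)).add (((h1 i).const_mul _).add (h2 i j))

lemma integral_quad_add {S : Matrix (Fin r) (Fin r) ℝ} (hS : S.PosSemidef)
    (M : Matrix (Fin r) (Fin r) ℝ) (c : RVec r) :
    ∫ x, quad M (c + x) ∂(multivariateGaussian 0 S) = quad M c + (M * S).trace := by
  have h1 : ∀ i, Integrable (fun x : RVec r => x.ofLp i) (multivariateGaussian 0 S) := fun i =>
    (memLp_eval_multivariateGaussian i).integrable (by norm_num)
  have h2 : ∀ i j, Integrable (fun x : RVec r => x.ofLp i * x.ofLp j)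
      (multivariateGaussian 0 S) := fun i j =>
    (memLp_eval_multivariateGaussian i).integrable_mul (memLp_eval_multivariateGaussian j)
  have h3 : ∀ i j, Integrable (fun x : RVec r => (c i * c j + c i * x.ofLp j) +
      (c j * x.ofLp i + x.ofLp i * x.ofLp j)) (multivariateGaussian 0 S) := fun i j =>
    ((integrable_const _).add ((h1 j).const_mul _)).add (((h1 i).const_mul _).add (h2 i j))
  simp_rw [quad_add_eq_sum]
  refine (integral_finsetSum Finset.univ fun i _ =>
    integrable_finsetSum _ fun j _ => (h3 i j).const_mul _).trans ?_
  have h4 : ∀ i j, ∫ x : RVec r, M i j * ((c i * c j + c i * x.ofLp j) +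
      (c j * x.ofLp i + x.ofLp i * x.ofLp j)) ∂(multivariateGaussian 0 S) =
      M i j * (c i * c j) + M i j * S j i := by
    intro i j
    have hA : Integrable (fun x : RVec r => c i * x.ofLp j) (multivariateGaussian 0 S) :=
      (h1 j).const_mul _
    have hB : Integrable (fun x : RVec r => c i * c j + c i * x.ofLp j)
      (multivariateGaussian 0 S) := (integrable_const _).add hA
    have hC : Integrable (fun x : RVec r => c j * x.ofLp i) (multivariateGaussian 0 S) :=
      (h1 i).const_mul _
    have hD : Integrable (fun x : RVec r => c j * x.ofLp i + x.ofLp i * x.ofLp j)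
      (multivariateGaussian 0 S) := hC.add (h2 i j)
    have eA : ∫ x : RVec r, c i * x.ofLp j ∂(multivariateGaussian 0 S) = 0 := by
      rw [integral_const_mul, integral_eval_multivariateGaussian, mul_zero]
    have eC : ∫ x : RVec r, c j * x.ofLp i ∂(multivariateGaussian 0 S) = 0 := by
      rw [integral_const_mul, integral_eval_multivariateGaussian, mul_zero]
    rw [integral_const_mul, integral_add hB hD, integral_add (integrable_const _) hA,
      integral_add hC (h2 i j), eA, eC, integral_mul_multivariateGaussian hS,
      ← hS.isHermitian.apply i j]
    simp
    ring
  have h5 : ∀ i, ∫ x : RVec r, ∑ j, M i j * ((c i * c j + c i * x.ofLp j) +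
      (c j * x.ofLp i + x.ofLp i * x.ofLp j)) ∂(multivariateGaussian 0 S) =
      ∑ j, (M i j * (c i * c j) + M i j * S j i) := by
    intro i
    rw [integral_finsetSum _ fun j _ => (h3 i j).const_mul _]
    simp_rw [h4]
  simp_rw [h5, Finset.sum_add_distrib]
  congr 1
  simp only [quad, dotProduct, mulVec, Finset.mul_sum]
  refine Finset.sum_congr rfl fun i _ => Finset.sum_congr rfl fun j _ => ?_
  ring

lemma integrable_logGauss_add {S : Matrix (Fin r) (Fin r) ℝ}
    (M : Matrix (Fin r) (Fin r) ℝ) (c : RVec r) :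
    Integrable (fun x => logGauss M (c + x)) (multivariateGaussian 0 S) := by
  unfold logGauss
  exact (((integrable_const _).add (integrable_quad_add _ _)).neg).div_const _

lemma integral_logGauss_add {S : Matrix (Fin r) (Fin r) ℝ} (hS : S.PosSemidef)
    (M : Matrix (Fin r) (Fin r) ℝ) (c : RVec r) :
    ∫ x, logGauss M (c + x) ∂(multivariateGaussian 0 S) =
      -(r * Real.log (2 * Real.pi) + Real.log M.det + quad M⁻¹ c + (M⁻¹ * S).trace) / 2 := by
  unfold logGauss
  rw [integral_div, integral_neg, integral_add (integrable_const _) (integrable_quad_add _ _),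
    integral_quad_add hS]
  simp
  ring

/-! ### Product measures -/

lemma lintegral_fin_prod {E : Type*} [MeasurableSpace E] {n : ℕ} (μ : Fin n → Measure E)
    [∀ i, SigmaFinite (μ i)] (f : Fin n → E → ℝ≥0∞) (hf : ∀ i, Measurable (f i)) :
    ∫⁻ x, ∏ i, f i (x i) ∂(Measure.pi μ) = ∏ i, ∫⁻ x, f i x ∂(μ i) := by
  induction n with
  | zero => simp [lintegral_const]
  | succ n ih =>
    rw [← ((measurePreserving_piFinSuccAbove μ 0).symm).lintegral_comp (by fun_prop)]
    simp_rw [MeasurableEquiv.piFinSuccAbove_symm_apply, Fin.insertNthEquiv,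
      Fin.prod_univ_succ, Fin.insertNth_zero, Equiv.coe_fn_mk, Fin.cons_succ, Fin.cons_zero,
      Fin.zero_succAbove, cast_eq]
    rw [lintegral_prod_mul (f := f 0)
      (g := fun x : Fin n → E => ∏ i, f i.succ (x i)) (hf 0).aemeasurable
      (Measurable.aemeasurable (by fun_prop))]
    congr 1
    exact ih (fun i => μ i.succ) (fun i => f i.succ) fun i => hf _

lemma pi_withDensity {E : Type*} [MeasurableSpace E] {n : ℕ} (μ : Measure E)
    [SigmaFinite μ] (f : E → ℝ≥0∞) (hf : Measurable f) [SigmaFinite (μ.withDensity f)] :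
    Measure.pi (fun _ : Fin n => μ.withDensity f) =
      (Measure.pi fun _ : Fin n => μ).withDensity fun x => ∏ i, f (x i) := by
  refine Measure.pi_eq fun s hs => ?_
  rw [withDensity_apply _ (MeasurableSet.univ_pi hs), Measure.restrict_pi_pi,
    lintegral_fin_prod (fun i => μ.restrict (s i)) (fun _ => f) fun _ => hf]
  refine Finset.prod_congr rfl fun i _ => ?_
  rw [withDensity_apply _ (hs i)]

lemma map_pi_prod_pi {E F G : Type*} [MeasurableSpace E] [MeasurableSpace F] [MeasurableSpace G]
    {n : ℕ} (μ : Measure E) (ν : Measure F) [IsProbabilityMeasure μ] [IsProbabilityMeasure ν]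
    (f : E × F → G) (hf : Measurable f) :
    ((Measure.pi fun _ : Fin n => μ).prod (Measure.pi fun _ : Fin n => ν)).map
      (fun p k => f (p.1 k, p.2 k)) = Measure.pi fun _ : Fin n => (μ.prod ν).map f := by
  have h := measurePreserving_arrowProdEquivProdArrow E F (Fin n) (fun _ => μ) (fun _ => ν)
  have : IsProbabilityMeasure ((μ.prod ν).map f) :=
    Measure.isProbabilityMeasure_map hf.aemeasurable
  rw [← h.map_eq, Measure.map_map (by fun_prop) h.measurable,
    ← Measure.pi_map_pi (fun _ => hf.aemeasurable)]
  rfl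

lemma integrable_eval_pi {E : Type*} [MeasurableSpace E] {n : ℕ} {μ : Measure E}
    [IsProbabilityMeasure μ] {f : E → ℝ} (hf : Integrable f μ) (k : Fin n) :
    Integrable (fun x => f (x k)) (Measure.pi fun _ : Fin n => μ) :=
  (measurePreserving_eval (fun _ : Fin n => μ) k).integrable_comp_of_integrable hf

lemma integral_eval_pi {E : Type*} [MeasurableSpace E] {n : ℕ} {μ : Measure E}
    [IsProbabilityMeasure μ] {f : E → ℝ} (hf : AEStronglyMeasurable f μ) (k : Fin n) :
    ∫ x, f (x k) ∂(Measure.pi fun _ : Fin n => μ) = ∫ x, f x ∂μ := by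
  have h := measurePreserving_eval (fun _ : Fin n => μ) k
  rw [← h.map_eq] at hf
  conv_rhs => rw [← h.map_eq]
  rw [integral_map h.measurable.aemeasurable hf]

/-! ### Gaussian blocks -/

/-- The law of `n` i.i.d. `N(0, S)` vectors. -/
def gaussBlock (n : ℕ) (S : Matrix (Fin r) (Fin r) ℝ) : Measure (Fin n → RVec r) :=
  Measure.pi fun _ => multivariateGaussian 0 S

instance (n : ℕ) (S : Matrix (Fin r) (Fin r) ℝ) : IsProbabilityMeasure (gaussBlock n S) := by
  unfold gaussBlock; infer_instance

lemma noiseLaw_eq_gaussBlock (n r : ℕ) : noiseLaw n r = gaussBlock n 1 := by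
  simp [noiseLaw, gaussBlock]

/-- The log-density of `gaussBlock n S`. -/
def logGaussBlock {n : ℕ} (S : Matrix (Fin r) (Fin r) ℝ) (z : Fin n → RVec r) : ℝ :=
  ∑ k, logGauss S (z k)

@[fun_prop]
lemma continuous_logGaussBlock {n : ℕ} (S : Matrix (Fin r) (Fin r) ℝ) :
    Continuous (logGaussBlock (n := n) S) := by
  unfold logGaussBlock; fun_prop

lemma gaussBlock_eq_withDensity (n : ℕ) {S : Matrix (Fin r) (Fin r) ℝ} (hS : S.PosDef) :
    gaussBlock n S =
      volume.withDensity fun z => ENNReal.ofReal (Real.exp (logGaussBlock S z)) := by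
  have h := multivariateGaussian_eq_withDensity hS
  have : IsProbabilityMeasure ((volume : Measure (RVec r)).withDensity
      fun x => ENNReal.ofReal (Real.exp (logGauss S x))) := by
    rw [← h]; infer_instance
  rw [gaussBlock, h, pi_withDensity _ _ (by fun_prop)]
  congr 1
  ext z
  rw [logGaussBlock, Real.exp_sum, ENNReal.ofReal_prod_of_nonneg fun _ _ => (Real.exp_pos _).le]

/-- Apply a matrix to each vector of a block. -/
def blockMap {s n : ℕ} (A : Matrix (Fin r) (Fin s) ℝ) (x : Fin n → RVec s) : Fin n → RVec r :=
  fun k => A.toEuclideanLin (x k)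

@[fun_prop]
lemma continuous_blockMap {s n : ℕ} (A : Matrix (Fin r) (Fin s) ℝ) :
    Continuous (blockMap (n := n) A) := by
  unfold blockMap
  exact continuous_pi fun k => (continuous_toEuclideanLin A).comp (continuous_apply k)

lemma map_prod_gaussBlock {s₁ s₂ n : ℕ} (A : Matrix (Fin r) (Fin s₁) ℝ)
    (B : Matrix (Fin r) (Fin s₂) ℝ)
    {S : Matrix (Fin s₁) (Fin s₁) ℝ} {T : Matrix (Fin s₂) (Fin s₂) ℝ} (hS : S.PosSemidef)
    (hT : T.PosSemidef) :
    ((gaussBlock n S).prod (gaussBlock n T)).map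
      (fun p => blockMap A p.1 + blockMap B p.2) =
      gaussBlock n (A * S * Aᵀ + B * T * Bᵀ) := by
  have h := map_pi_prod_pi (n := n) (multivariateGaussian 0 S) (multivariateGaussian 0 T)
    (fun p => A.toEuclideanLin p.1 + B.toEuclideanLin p.2) (by fun_prop)
  rw [map_prod_multivariateGaussian A B hS hT] at h
  exact h

/-! ### Gaussian conditioning -/

section Conditioning

variable {r r' : ℕ} {N : Matrix (Fin r) (Fin r) ℝ} {A : Matrix (Fin r) (Fin r') ℝ}
  {S : Matrix (Fin r') (Fin r') ℝ}

lemma mulVec_dotProduct_eq {m n : ℕ} (M : Matrix (Fin m) (Fin n) ℝ) (x : Fin n → ℝ)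
    (y : Fin m → ℝ) : (M *ᵥ x) ⬝ᵥ y = x ⬝ᵥ Mᵀ *ᵥ y := by
  rw [dotProduct_mulVec, vecMul_transpose]

lemma det_mul_det_schur (hN : N.PosDef) (hS : S.PosDef) :
    N.det * (S - Aᵀ * N⁻¹ * A).det = S.det * (N - A * S⁻¹ * Aᵀ).det := by
  have : Invertible N := hN.isUnit.invertible
  have : Invertible S := hS.isUnit.invertible
  rw [← invOf_eq_nonsing_inv, ← invOf_eq_nonsing_inv, ← det_fromBlocks₁₁, ← det_fromBlocks₂₂]

lemma posDef_schur (hN : N.PosDef) (hS : S.PosDef) (hV : (N - A * S⁻¹ * Aᵀ).PosDef) :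
    (S - Aᵀ * N⁻¹ * A).PosDef := by
  have : Invertible N := hN.isUnit.invertible
  have : Invertible S := hS.isUnit.invertible
  have h1 : (fromBlocks N A Aᴴ S).PosSemidef :=
    (PosDef.fromBlocks₂₂ N A hS).2 (by simpa using hV.posSemidef)
  have h2 : (S - Aᵀ * N⁻¹ * A).PosSemidef := by
    simpa using (PosDef.fromBlocks₁₁ A S hN).1 h1
  refine h2.posDef_iff_isUnit.2 ?_
  rw [Matrix.isUnit_iff_isUnit_det, isUnit_iff_ne_zero]
  intro h0
  have h3 := det_mul_det_schur (A := A) hN hS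
  rw [h0, mul_zero] at h3
  exact (mul_pos hS.det_pos hV.det_pos).ne h3

/-- The two ways of completing the square in the quadratic form of a Gaussian pair with covariance
`[N, A; Aᵀ, S]`. -/
lemma quad_add_quad_schur (hN : N.PosDef) (hS : S.PosDef) (hV : (N - A * S⁻¹ * Aᵀ).PosDef)
    (j : RVec r) (w : RVec r') :
    quad S⁻¹ w + quad (N - A * S⁻¹ * Aᵀ)⁻¹ (j - (A * S⁻¹).toEuclideanLin w) =
      quad N⁻¹ j + quad (S - Aᵀ * N⁻¹ * A)⁻¹ (w - (Aᵀ * N⁻¹).toEuclideanLin j) := by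
  have hΔ := posDef_schur hN hS hV
  have uN : IsUnit N.det := hN.det_pos.ne'.isUnit
  have uS : IsUnit S.det := hS.det_pos.ne'.isUnit
  have uV := hV.det_pos.ne'.isUnit
  have uD := hΔ.det_pos.ne'.isUnit
  have hNT : Nᵀ = N := by simpa using hN.isHermitian.eq
  have hST : Sᵀ = S := by simpa using hS.isHermitian.eq
  simp only [quad, Matrix.toLpLin_apply, WithLp.ofLp_sub]
  generalize j.ofLp = j
  generalize w.ofLp = w
  -- `(α, β)` solves the block system `N α + A β = j`, `Aᵀ α + S β = w`
  obtain ⟨α, hα⟩ : ∃ α, α = (N - A * S⁻¹ * Aᵀ)⁻¹ *ᵥ (j - (A * S⁻¹) *ᵥ w) := ⟨_, rfl⟩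
  obtain ⟨β, hβ⟩ : ∃ β, β = S⁻¹ *ᵥ (w - Aᵀ *ᵥ α) := ⟨_, rfl⟩
  have e1 : N *ᵥ α - (A * S⁻¹ * Aᵀ) *ᵥ α = j - (A * S⁻¹) *ᵥ w := by
    rw [← sub_mulVec, hα, mulVec_mulVec, Matrix.mul_nonsing_inv _ uV, one_mulVec]
  have e2 : S *ᵥ β = w - Aᵀ *ᵥ α := by
    rw [hβ, mulVec_mulVec, Matrix.mul_nonsing_inv _ uS, one_mulVec]
  have e3 : N *ᵥ α + A *ᵥ β = j := by
    have : A *ᵥ β = (A * S⁻¹) *ᵥ w - (A * S⁻¹ * Aᵀ) *ᵥ α := by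
      rw [hβ, mulVec_mulVec, mulVec_sub, mulVec_mulVec]
    rw [this]
    linear_combination (exp := 1) e1
  have e4 : w - (Aᵀ * N⁻¹) *ᵥ j = (S - Aᵀ * N⁻¹ * A) *ᵥ β := by
    rw [← e3, mulVec_add, mulVec_mulVec, mulVec_mulVec, Matrix.mul_assoc Aᵀ,
      Matrix.nonsing_inv_mul _ uN, Matrix.mul_one, sub_mulVec, e2]
    abel
  have e5 : (S - Aᵀ * N⁻¹ * A)⁻¹ *ᵥ (w - (Aᵀ * N⁻¹) *ᵥ j) = β := by
    rw [e4, mulVec_mulVec, Matrix.nonsing_inv_mul _ uD, one_mulVec]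
  have e6 : N⁻¹ *ᵥ j = α + (N⁻¹ * A) *ᵥ β := by
    rw [← e3, mulVec_add, mulVec_mulVec, Matrix.nonsing_inv_mul _ uN, one_mulVec, mulVec_mulVec]
  have e7 : S⁻¹ *ᵥ w = β + (S⁻¹ * Aᵀ) *ᵥ α := by
    rw [hβ, mulVec_sub, mulVec_mulVec]; abel
  rw [← hα, e5, e6, e7, sub_dotProduct, sub_dotProduct, dotProduct_add, dotProduct_add]
  have f1 : ((A * S⁻¹) *ᵥ w) ⬝ᵥ α = w ⬝ᵥ (S⁻¹ * Aᵀ) *ᵥ α := by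
    rw [mulVec_dotProduct_eq, transpose_mul, transpose_nonsing_inv, hST]
  have f2 : ((Aᵀ * N⁻¹) *ᵥ j) ⬝ᵥ β = j ⬝ᵥ (N⁻¹ * A) *ᵥ β := by
    rw [mulVec_dotProduct_eq, transpose_mul, transpose_nonsing_inv, hNT, transpose_transpose]
  rw [f1, f2]
  ring

/-- The density of a Gaussian pair with covariance `[N, A; Aᵀ, S]`, factored in the two possible
ways as a marginal density times a conditional density. -/
lemma logGauss_add_logGauss_schur (hN : N.PosDef) (hS : S.PosDef)
    (hV : (N - A * S⁻¹ * Aᵀ).PosDef) (j : RVec r) (w : RVec r') :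
    logGauss S w + logGauss (N - A * S⁻¹ * Aᵀ) (j - (A * S⁻¹).toEuclideanLin w) =
      logGauss N j + logGauss (S - Aᵀ * N⁻¹ * A) (w - (Aᵀ * N⁻¹).toEuclideanLin j) := by
  have h1 := quad_add_quad_schur hN hS hV j w
  have h2 := congrArg Real.log (det_mul_det_schur (A := A) hN hS)
  rw [Real.log_mul hN.det_pos.ne' (posDef_schur hN hS hV).det_pos.ne',
    Real.log_mul hS.det_pos.ne' hV.det_pos.ne'] at h2
  simp only [logGauss]
  linear_combination (-1 / 2) * h1 + (1 / 2) * h2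

/-- If `N` is the covariance of interference plus noise and the genie is smart, the genie signal
has the law of `Aᵀ N⁻¹ Y` plus an independent noise of covariance `S - Aᵀ N⁻¹ A`. -/
lemma smart_covariance {t : ℕ} (hN : N.PosDef) (H : Matrix (Fin r) (Fin t) ℝ)
    (H' : Matrix (Fin r') (Fin t) ℝ) (Q : Matrix (Fin t) (Fin t) ℝ)
    (hsmart : Aᵀ * N⁻¹ * H = H') :
    (Aᵀ * N⁻¹) * (H * Q * Hᵀ + N) * (Aᵀ * N⁻¹)ᵀ + (S - Aᵀ * N⁻¹ * A) = H' * Q * H'ᵀ + S := by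
  have hNT : Nᵀ = N := by simpa using hN.isHermitian.eq
  have uN : IsUnit N.det := hN.det_pos.ne'.isUnit
  rw [← hsmart, Matrix.mul_add, Matrix.add_mul]
  have : Aᵀ * N⁻¹ * N * (Aᵀ * N⁻¹)ᵀ = Aᵀ * N⁻¹ * A := by
    rw [Matrix.mul_assoc Aᵀ, Matrix.nonsing_inv_mul _ uN, transpose_mul, transpose_nonsing_inv, hNT]
    simp [Matrix.mul_assoc]
  rw [this]
  simp only [transpose_mul, Matrix.mul_assoc]
  abel

end Conditioning

/-! ### Gibbs' inequality -/

/-- Gibbs' inequality in additive form, from `1 + φ ≤ exp φ`. The right-hand side may be infinite,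
and it can be summed over messages before it is compared with a total mass. -/
lemma ofReal_one_add_integral_le {Ω : Type*} [MeasurableSpace Ω] {μ : Measure Ω}
    [IsProbabilityMeasure μ] {φ : Ω → ℝ} (hφ : Integrable φ μ) :
    ENNReal.ofReal (1 + ∫ ω, φ ω ∂μ) ≤ ∫⁻ ω, ENNReal.ofReal (Real.exp (φ ω)) ∂μ := by
  have h1 : 1 + ∫ ω, φ ω ∂μ = ∫ ω, (1 + φ ω) ∂μ := by
    rw [integral_add (integrable_const _) hφ]; simp
  have h2 : Integrable (fun ω => 1 + φ ω) μ := (integrable_const _).add hφ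
  rw [h1]
  calc ENNReal.ofReal (∫ ω, (1 + φ ω) ∂μ)
      ≤ ENNReal.ofReal (∫ ω, max (1 + φ ω) 0 ∂μ) := by
        refine ENNReal.ofReal_le_ofReal (integral_mono h2 h2.pos_part fun ω => le_max_left _ _)
    _ = ∫⁻ ω, ENNReal.ofReal (max (1 + φ ω) 0) ∂μ :=
        ofReal_integral_eq_lintegral_ofReal h2.pos_part (Eventually.of_forall fun _ => le_max_right _ _)
    _ ≤ _ := by
        refine lintegral_mono fun ω => ENNReal.ofReal_le_ofReal ?_
        refine max_le ?_ (Real.exp_pos _).le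
        linarith [Real.add_one_le_exp (φ ω)]

lemma integral_nonpos_of_lintegral_exp_le {Ω : Type*} [MeasurableSpace Ω] {μ : Measure Ω}
    [IsProbabilityMeasure μ] {φ : Ω → ℝ} (hφ : Integrable φ μ)
    (h : ∫⁻ ω, ENNReal.ofReal (Real.exp (φ ω)) ∂μ ≤ 1) : ∫ ω, φ ω ∂μ ≤ 0 := by
  have h1 := (ofReal_one_add_integral_le hφ).trans h
  rw [ENNReal.ofReal_le_one] at h1
  linarith

/-! ### Finite Gaussian mixtures -/

section Mixture

variable {r n M : ℕ}

/-- The law of `c m + Z` for a uniformly distributed index `m` and an independent block `Z` of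
i.i.d. `N(0, K)` vectors: the output of a codebook through additive Gaussian noise. -/
def mixLaw (c : Fin M → Fin n → RVec r) (K : Matrix (Fin r) (Fin r) ℝ) :
    Measure (Fin n → RVec r) :=
  (M : ℝ≥0∞)⁻¹ • ∑ m, (gaussBlock n K).map fun z => c m + z

/-- The density of `mixLaw c K` with respect to Lebesgue measure. -/
def mixDens (c : Fin M → Fin n → RVec r) (K : Matrix (Fin r) (Fin r) ℝ) (z : Fin n → RVec r) : ℝ :=
  (M : ℝ)⁻¹ * ∑ m, Real.exp (logGaussBlock K (z - c m))

lemma mixDens_pos [NeZero M] (c : Fin M → Fin n → RVec r) (K : Matrix (Fin r) (Fin r) ℝ)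
    (z : Fin n → RVec r) : 0 < mixDens c K z := by
  have : 0 < M := Nat.pos_of_ne_zero (NeZero.ne M)
  unfold mixDens
  refine mul_pos (by positivity) (Finset.sum_pos (fun _ _ => Real.exp_pos _) ?_)
  exact ⟨⟨0, this⟩, Finset.mem_univ _⟩

@[fun_prop]
lemma measurable_mixDens (c : Fin M → Fin n → RVec r) (K : Matrix (Fin r) (Fin r) ℝ) :
    Measurable (mixDens c K) := by
  unfold mixDens
  refine (Continuous.measurable ?_).const_mul _
  fun_prop

lemma lintegral_mixLaw (c : Fin M → Fin n → RVec r) (K : Matrix (Fin r) (Fin r) ℝ)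
    {f : (Fin n → RVec r) → ℝ≥0∞} (hf : Measurable f) :
    ∫⁻ z, f z ∂(mixLaw c K) = (M : ℝ≥0∞)⁻¹ * ∑ m, ∫⁻ z, f (c m + z) ∂(gaussBlock n K) := by
  rw [mixLaw, lintegral_smul_measure, lintegral_finsetSum_measure]
  simp_rw [lintegral_map hf (measurable_const_add _)]
  rfl

instance [NeZero M] (c : Fin M → Fin n → RVec r) (K : Matrix (Fin r) (Fin r) ℝ) :
    IsProbabilityMeasure (mixLaw c K) := by
  constructor
  have h := lintegral_mixLaw c K (f := fun _ => 1) measurable_const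
  simp only [lintegral_const, measure_univ, one_mul, Finset.sum_const, Finset.card_univ,
    Fintype.card_fin, nsmul_eq_mul, mul_one] at h
  rw [h, ENNReal.inv_mul_cancel (by simp [NeZero.ne M]) (by simp)]

lemma integrable_mixLaw (c : Fin M → Fin n → RVec r) (K : Matrix (Fin r) (Fin r) ℝ)
    {f : (Fin n → RVec r) → ℝ} (hf : Measurable f)
    (h : ∀ m, Integrable (fun z => f (c m + z)) (gaussBlock n K)) :
    Integrable f (mixLaw c K) := by
  rcases Nat.eq_zero_or_pos M with rfl | hM
  · have : mixLaw c K = 0 := by simp [mixLaw]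
    rw [this]; exact integrable_zero_measure
  refine Integrable.smul_measure ?_ (by simp [hM.ne'])
  refine integrable_finsetSum_measure.2 fun m _ => ?_
  exact (integrable_map_measure hf.aestronglyMeasurable (measurable_const_add _).aemeasurable).2 (h m)

lemma integral_mixLaw (c : Fin M → Fin n → RVec r) (K : Matrix (Fin r) (Fin r) ℝ)
    {f : (Fin n → RVec r) → ℝ} (hf : Measurable f)
    (h : ∀ m, Integrable (fun z => f (c m + z)) (gaussBlock n K)) :
    ∫ z, f z ∂(mixLaw c K) = (M : ℝ)⁻¹ * ∑ m, ∫ z, f (c m + z) ∂(gaussBlock n K) := by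
  rw [mixLaw, integral_smul_measure, integral_finsetSum_measure]
  · simp only [ENNReal.toReal_inv, ENNReal.toReal_natCast, smul_eq_mul]
    congr 1
    refine Finset.sum_congr rfl fun m _ => ?_
    rw [integral_map (measurable_const_add _).aemeasurable hf.aestronglyMeasurable]
  · intro m _
    exact (integrable_map_measure hf.aestronglyMeasurable
      (measurable_const_add _).aemeasurable).2 (h m)

lemma mixLaw_eq_withDensity (c : Fin M → Fin n → RVec r) {K : Matrix (Fin r) (Fin r) ℝ}
    (hK : K.PosDef) :
    mixLaw c K = volume.withDensity fun z => ENNReal.ofReal (mixDens c K z) := by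
  rcases Nat.eq_zero_or_pos M with rfl | hM
  · simp [mixLaw, mixDens]
  refine Measure.ext_of_lintegral _ fun f hf => ?_
  rw [lintegral_mixLaw c K hf, lintegral_withDensity_eq_lintegral_mul _ (by fun_prop) hf]
  have h1 : ∀ m, ∫⁻ z, f (c m + z) ∂(gaussBlock n K) =
      ∫⁻ z, ENNReal.ofReal (Real.exp (logGaussBlock K (z - c m))) * f z := by
    intro m
    rw [gaussBlock_eq_withDensity n hK, lintegral_withDensity_eq_lintegral_mul _ (by fun_prop)
      (by fun_prop), ← lintegral_add_left_eq_self
        (fun z => ENNReal.ofReal (Real.exp (logGaussBlock K (z - c m))) * f z) (c m)]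
    simp
  simp_rw [h1]
  have hmeas : ∀ m, Measurable fun z =>
      ENNReal.ofReal (Real.exp (logGaussBlock K (z - c m))) * f z := fun m => by fun_prop
  rw [← lintegral_finsetSum _ (fun m _ => hmeas m),
    ← lintegral_const_mul _ (Finset.measurable_sum _ fun m _ => hmeas m)]
  refine lintegral_congr fun z => ?_
  simp only [Pi.mul_apply, mixDens]
  rw [← Finset.sum_mul, ← mul_assoc, ENNReal.ofReal_mul (by positivity),
    ENNReal.ofReal_sum_of_nonneg fun _ _ => (Real.exp_pos _).le,
    ENNReal.ofReal_inv_of_pos (by exact_mod_cast hM), ENNReal.ofReal_natCast]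

/-- Log-density of a Gaussian mixture relative to the Gaussian law of covariance `V`. -/
def mixLLR (c : Fin M → Fin n → RVec r) (K V : Matrix (Fin r) (Fin r) ℝ)
    (z : Fin n → RVec r) : ℝ := Real.log (mixDens c K z) - logGaussBlock V z

@[fun_prop]
lemma measurable_mixLLR (c : Fin M → Fin n → RVec r) (K V : Matrix (Fin r) (Fin r) ℝ) :
    Measurable (mixLLR c K V) := by
  unfold mixLLR
  exact (Real.measurable_log.comp (measurable_mixDens c K)).sub
    (continuous_logGaussBlock V).measurable

lemma mixLaw_eq_gaussBlock_withDensity [NeZero M] (c : Fin M → Fin n → RVec r)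
    {K V : Matrix (Fin r) (Fin r) ℝ} (hK : K.PosDef) (hV : V.PosDef) :
    mixLaw c K = (gaussBlock n V).withDensity
      fun z => ENNReal.ofReal (Real.exp (mixLLR c K V z)) := by
  rw [mixLaw_eq_withDensity c hK, gaussBlock_eq_withDensity n hV, ← withDensity_mul _
    (by fun_prop) (by fun_prop)]
  congr 1
  ext z
  rw [Pi.mul_apply, ← ENNReal.ofReal_mul (Real.exp_pos _).le, ← Real.exp_add, mixLLR,
    add_sub_cancel, Real.exp_log (mixDens_pos c K z)]

lemma lintegral_exp_mixLLR [NeZero M] (c : Fin M → Fin n → RVec r)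
    {K V : Matrix (Fin r) (Fin r) ℝ} (hK : K.PosDef) (hV : V.PosDef) :
    ∫⁻ z, ENNReal.ofReal (Real.exp (mixLLR c K V z)) ∂(gaussBlock n V) = 1 := by
  have h : mixLaw c K Set.univ = 1 := measure_univ
  rwa [mixLaw_eq_gaussBlock_withDensity c hK hV, withDensity_apply _ .univ,
    Measure.restrict_univ] at h

lemma integrable_logGaussBlock_add (S K : Matrix (Fin r) (Fin r) ℝ) (b : Fin n → RVec r) :
    Integrable (fun z => logGaussBlock K (b + z)) (gaussBlock n S) := by
  unfold logGaussBlock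
  refine integrable_finsetSum _ fun k _ => ?_
  exact integrable_eval_pi (integrable_logGauss_add K (b k)) k

lemma integral_logGaussBlock_add {S : Matrix (Fin r) (Fin r) ℝ} (hS : S.PosSemidef)
    (K : Matrix (Fin r) (Fin r) ℝ) (b : Fin n → RVec r) :
    ∫ z, logGaussBlock K (b + z) ∂(gaussBlock n S) =
      ∑ k, (-(r * Real.log (2 * Real.pi) + Real.log K.det + quad K⁻¹ (b k) +
        (K⁻¹ * S).trace) / 2) := by
  unfold logGaussBlock
  refine (integral_finsetSum _ fun k _ =>
    integrable_eval_pi (integrable_logGauss_add K (b k)) k).trans ?_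
  refine Finset.sum_congr rfl fun k _ => ?_
  rw [← integral_logGauss_add hS]
  exact integral_eval_pi (f := fun x => logGauss K (b k + x))
    (integrable_logGauss_add K (b k)).aestronglyMeasurable k

lemma quad_nonneg {M : Matrix (Fin r) (Fin r) ℝ} (hM : M.PosSemidef) (x : RVec r) :
    0 ≤ quad M x := by
  simpa [quad] using hM.dotProduct_mulVec_nonneg x.ofLp

lemma logGaussBlock_le {K : Matrix (Fin r) (Fin r) ℝ} (hK : K.PosDef) (z : Fin n → RVec r) :
    logGaussBlock K z ≤ n * (-(r * Real.log (2 * Real.pi) + Real.log K.det) / 2) := by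
  have : ∀ k ∈ Finset.univ, logGauss K (z k) ≤
      -(r * Real.log (2 * Real.pi) + Real.log K.det) / 2 := by
    intro k _
    have := quad_nonneg hK.inv.posSemidef (z k)
    unfold logGauss
    linarith
  have h := Finset.sum_le_card_nsmul _ _ _ this
  rwa [Finset.card_univ, Fintype.card_fin, nsmul_eq_mul] at h

lemma integrable_log_mixDens_add [NeZero M] (c : Fin M → Fin n → RVec r)
    {K : Matrix (Fin r) (Fin r) ℝ} (hK : K.PosDef) (S : Matrix (Fin r) (Fin r) ℝ)
    (b : Fin n → RVec r) :
    Integrable (fun z => Real.log (mixDens c K (b + z))) (gaussBlock n S) := by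
  have hM : 0 < M := Nat.pos_of_ne_zero (NeZero.ne M)
  set C := n * (-(r * Real.log (2 * Real.pi) + Real.log K.det) / 2)
  set m₀ : Fin M := ⟨0, hM⟩
  have hI : Integrable (fun z => |C| + |logGaussBlock K ((b - c m₀) + z) - Real.log M|)
      (gaussBlock n S) :=
    (integrable_const _).add
      (((integrable_logGaussBlock_add S K _).sub (integrable_const _)).abs)
  refine hI.mono' (Real.measurable_log.comp ((measurable_mixDens c K).comp
    (measurable_const_add b))).aestronglyMeasurable (Eventually.of_forall fun z => ?_)
  have hpos := mixDens_pos c K (b + z)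
  have hMr : (0 : ℝ) < M := by exact_mod_cast hM
  have hup : Real.log (mixDens c K (b + z)) ≤ C := by
    rw [Real.log_le_iff_le_exp hpos, mixDens]
    have : ∑ m, Real.exp (logGaussBlock K (b + z - c m)) ≤ ∑ _m : Fin M, Real.exp C :=
      Finset.sum_le_sum fun m _ => Real.exp_le_exp.2 (logGaussBlock_le hK _)
    rw [Finset.sum_const, Finset.card_univ, Fintype.card_fin, nsmul_eq_mul] at this
    calc (M : ℝ)⁻¹ * _ ≤ (M : ℝ)⁻¹ * (M * Real.exp C) := by gcongr
      _ = _ := by field_simp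
  have hlow : logGaussBlock K ((b - c m₀) + z) - Real.log M ≤ Real.log (mixDens c K (b + z)) := by
    rw [Real.le_log_iff_exp_le hpos, Real.exp_sub, Real.exp_log hMr, mixDens, div_eq_inv_mul]
    gcongr
    rw [show b - c m₀ + z = b + z - c m₀ by abel]
    exact Finset.single_le_sum (f := fun m => Real.exp (logGaussBlock K (b + z - c m)))
      (fun _ _ => (Real.exp_pos _).le) (Finset.mem_univ m₀)
  rw [Real.norm_eq_abs, abs_le]
  constructor
  · linarith [neg_abs_le (logGaussBlock K ((b - c m₀) + z) - Real.log M), abs_nonneg C]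
  · linarith [abs_nonneg (logGaussBlock K ((b - c m₀) + z) - Real.log M), le_abs_self C]

lemma integrable_mixLLR_add [NeZero M] (c : Fin M → Fin n → RVec r)
    {K : Matrix (Fin r) (Fin r) ℝ} (hK : K.PosDef) (V S : Matrix (Fin r) (Fin r) ℝ)
    (b : Fin n → RVec r) :
    Integrable (fun z => mixLLR c K V (b + z)) (gaussBlock n S) :=
  (integrable_log_mixDens_add c hK S b).sub (integrable_logGaussBlock_add S V b)

lemma integrable_mixLLR [NeZero M] (c : Fin M → Fin n → RVec r)
    {K : Matrix (Fin r) (Fin r) ℝ} (hK : K.PosDef) (V : Matrix (Fin r) (Fin r) ℝ) :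
    Integrable (mixLLR c K V) (mixLaw c K) :=
  integrable_mixLaw c K (by fun_prop) fun m => integrable_mixLLR_add c hK V K (c m)

/-- Adding independent Gaussian noise to a Gaussian mixture enlarges its covariance. -/
lemma map_prod_mixLaw {s : ℕ} (c : Fin M → Fin n → RVec r) {K : Matrix (Fin r) (Fin r) ℝ}
    (hK : K.PosSemidef) (B : Matrix (Fin r) (Fin s) ℝ) {D : Matrix (Fin s) (Fin s) ℝ}
    (hD : D.PosSemidef) [NeZero M] :
    ((gaussBlock n D).prod (mixLaw c K)).map (fun p => p.2 + blockMap B p.1) =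
      mixLaw c (K + B * D * Bᵀ) := by
  refine Measure.ext_of_lintegral _ fun f hf => ?_
  have hmeas : Measurable fun p : (Fin n → RVec s) × (Fin n → RVec r) => p.2 + blockMap B p.1 := by
    fun_prop
  have hmeas2 : Measurable fun p : (Fin n → RVec s) × (Fin n → RVec r) =>
      blockMap B p.1 + blockMap 1 p.2 := by
    fun_prop
  rw [lintegral_map hf hmeas, lintegral_mixLaw _ _ hf, lintegral_prod _ (by fun_prop)]
  have h1 : ∀ w : Fin n → RVec s, ∫⁻ u, f (u + blockMap B w) ∂(mixLaw c K) =
      (M : ℝ≥0∞)⁻¹ * ∑ m, ∫⁻ z, f (c m + z + blockMap B w) ∂(gaussBlock n K) := fun w =>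
    lintegral_mixLaw c K (f := fun u => f (u + blockMap B w)) (by fun_prop)
  have hm : ∀ m, Measurable fun p : (Fin n → RVec s) × (Fin n → RVec r) =>
      f (c m + p.2 + blockMap B p.1) := by
    intro m
    fun_prop
  simp_rw [h1]
  rw [lintegral_const_mul _ (Finset.measurable_sum _ fun m _ => (hm m).lintegral_prod_right'),
    lintegral_finsetSum _ fun m _ => (hm m).lintegral_prod_right']
  congr 1
  refine Finset.sum_congr rfl fun m _ => ?_
  have h2 := map_prod_gaussBlock (n := n) B (1 : Matrix (Fin r) (Fin r) ℝ) hD hK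
  rw [show K + B * D * Bᵀ = B * D * Bᵀ + 1 * K * (1 : Matrix (Fin r) (Fin r) ℝ)ᵀ by simp [add_comm],
    ← h2, lintegral_map (by fun_prop) hmeas2, lintegral_prod _ (by fun_prop)]
  refine lintegral_congr fun w => lintegral_congr fun z => ?_
  congr 1
  ext k
  simp [blockMap]
  ring

end Mixture

/-! ### Data processing and the genie-aided Fano inequality -/

section Genie

variable {r r' n M M' : ℕ}

lemma blockMap_one (x : Fin n → RVec r) : blockMap 1 x = x := by
  ext k; simp [blockMap]

/-- Data processing: additive Gaussian noise of covariance `D` does not increase the divergence of a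
Gaussian mixture from a Gaussian law. -/
lemma integral_mixLLR_add_noise_le [NeZero M] (c : Fin M → Fin n → RVec r)
    {K V D : Matrix (Fin r) (Fin r) ℝ} (hK : K.PosDef) (hV : V.PosDef) (hD : D.PosSemidef) :
    ∫ z, mixLLR c (K + D) (V + D) z ∂(mixLaw c (K + D)) ≤ ∫ z, mixLLR c K V z ∂(mixLaw c K) := by
  have hKD : (K + D).PosDef := hK.add_posSemidef hD
  have hVD : (V + D).PosDef := hV.add_posSemidef hD
  set μ := (gaussBlock n D).prod (mixLaw c K)
  have hmap : μ.map (fun p => p.2 + p.1) = mixLaw c (K + D) := by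
    simpa [blockMap_one] using map_prod_mixLaw c hK.posSemidef 1 hD
  have hmapG : ((gaussBlock n D).prod (gaussBlock n V)).map (fun p => p.2 + p.1) =
      gaussBlock n (V + D) := by
    have := map_prod_gaussBlock (n := n) (1 : Matrix (Fin r) (Fin r) ℝ)
      (1 : Matrix (Fin r) (Fin r) ℝ) hD hV.posSemidef
    simpa [blockMap_one, add_comm] using this
  have hI2 : Integrable (fun p : (Fin n → RVec r) × (Fin n → RVec r) =>
      mixLLR c (K + D) (V + D) (p.2 + p.1)) μ := by
    have := integrable_mixLLR c hKD (V + D)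
    rw [← hmap] at this
    exact (integrable_map_measure (by fun_prop) (by fun_prop)).1 this
  have hI1 : Integrable (fun p : (Fin n → RVec r) × (Fin n → RVec r) => mixLLR c K V p.2) μ :=
    (integrable_mixLLR c hK V).comp_snd _
  have h := integral_nonpos_of_lintegral_exp_le (hI2.sub hI1) ?_
  · have e2 : ∫ p, mixLLR c (K + D) (V + D) (p.2 + p.1) ∂μ =
        ∫ z, mixLLR c (K + D) (V + D) z ∂(mixLaw c (K + D)) := by
      rw [← hmap, integral_map (by fun_prop) (by fun_prop)]
    have e1 : ∫ p, mixLLR c K V p.2 ∂μ = ∫ z, mixLLR c K V z ∂(mixLaw c K) := by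
      simp [μ, integral_fun_snd]
    have e3 := integral_sub hI2 hI1
    rw [e1, e2] at e3
    simp only [Pi.sub_apply] at h
    linarith
  · simp only [Pi.sub_apply, μ]
    rw [lintegral_prod _ (by fun_prop)]
    have hin : ∀ v : Fin n → RVec r, ∫⁻ s, ENNReal.ofReal (Real.exp
        (mixLLR c (K + D) (V + D) (s + v) - mixLLR c K V s)) ∂(mixLaw c K) =
        ∫⁻ s, ENNReal.ofReal (Real.exp (mixLLR c (K + D) (V + D) (s + v))) ∂(gaussBlock n V) := by
      intro v
      rw [mixLaw_eq_gaussBlock_withDensity c hK hV,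
        lintegral_withDensity_eq_lintegral_mul _ (by fun_prop) (by fun_prop)]
      refine lintegral_congr fun s => ?_
      rw [Pi.mul_apply, ← ENNReal.ofReal_mul (Real.exp_pos _).le, ← Real.exp_add, add_sub_cancel]
    simp_rw [hin]
    rw [← lintegral_prod (fun p : (Fin n → RVec r) × (Fin n → RVec r) =>
        ENNReal.ofReal (Real.exp (mixLLR c (K + D) (V + D) (p.2 + p.1)))) (by fun_prop),
      ← lintegral_map (f := fun z => ENNReal.ofReal (Real.exp (mixLLR c (K + D) (V + D) z)))
        (by fun_prop) (by fun_prop), hmapG, lintegral_exp_mixLLR c hKD hVD]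

/-- The joint law of interference plus noise `J` of covariance `N` and genie noise `W` of covariance
`S`, with cross-covariance `A`, drawn as `W` and then `J`, or as `J` and then `W`. -/
lemma map_prod_gaussBlock_schur {N : Matrix (Fin r) (Fin r) ℝ} {A : Matrix (Fin r) (Fin r') ℝ}
    {S : Matrix (Fin r') (Fin r') ℝ} (hN : N.PosDef) (hS : S.PosDef)
    (hV : (N - A * S⁻¹ * Aᵀ).PosDef) :
    ((gaussBlock n S).prod (gaussBlock n (N - A * S⁻¹ * Aᵀ))).map
      (fun p => (p.2 + blockMap (A * S⁻¹) p.1, p.1)) =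
    ((gaussBlock n N).prod (gaussBlock n (S - Aᵀ * N⁻¹ * A))).map
      (fun p => (p.1, p.2 + blockMap (Aᵀ * N⁻¹) p.1)) := by
  have hΔ := posDef_schur hN hS hV
  have hdens : ∀ (j : Fin n → RVec r) (w : Fin n → RVec r'),
      logGaussBlock S w + logGaussBlock (N - A * S⁻¹ * Aᵀ) (j - blockMap (A * S⁻¹) w) =
      logGaussBlock N j + logGaussBlock (S - Aᵀ * N⁻¹ * A) (w - blockMap (Aᵀ * N⁻¹) j) := by
    intro j w
    simp only [logGaussBlock, ← Finset.sum_add_distrib]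
    exact Finset.sum_congr rfl fun k _ => logGauss_add_logGauss_schur hN hS hV (j k) (w k)
  refine Measure.ext_of_lintegral _ fun f hf => ?_
  rw [lintegral_map hf (by fun_prop), lintegral_map hf (by fun_prop),
    lintegral_prod _ (by fun_prop), lintegral_prod _ (by fun_prop)]
  have hL : ∀ w : Fin n → RVec r', ∫⁻ u, f (u + blockMap (A * S⁻¹) w, w)
      ∂(gaussBlock n (N - A * S⁻¹ * Aᵀ)) = ∫⁻ j, ENNReal.ofReal (Real.exp
        (logGaussBlock (N - A * S⁻¹ * Aᵀ) (j - blockMap (A * S⁻¹) w))) * f (j, w) := by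
    intro w
    rw [gaussBlock_eq_withDensity n hV,
      lintegral_withDensity_eq_lintegral_mul _ (by fun_prop) (by fun_prop),
      ← lintegral_add_right_eq_self (fun j => ENNReal.ofReal (Real.exp
        (logGaussBlock (N - A * S⁻¹ * Aᵀ) (j - blockMap (A * S⁻¹) w))) * f (j, w))
        (blockMap (A * S⁻¹) w)]
    simp
  have hR : ∀ j : Fin n → RVec r, ∫⁻ δ, f (j, δ + blockMap (Aᵀ * N⁻¹) j)
      ∂(gaussBlock n (S - Aᵀ * N⁻¹ * A)) = ∫⁻ w, ENNReal.ofReal (Real.exp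
        (logGaussBlock (S - Aᵀ * N⁻¹ * A) (w - blockMap (Aᵀ * N⁻¹) j))) * f (j, w) := by
    intro j
    rw [gaussBlock_eq_withDensity n hΔ,
      lintegral_withDensity_eq_lintegral_mul _ (by fun_prop) (by fun_prop),
      ← lintegral_add_right_eq_self (fun w => ENNReal.ofReal (Real.exp
        (logGaussBlock (S - Aᵀ * N⁻¹ * A) (w - blockMap (Aᵀ * N⁻¹) j))) * f (j, w))
        (blockMap (Aᵀ * N⁻¹) j)]
    simp
  simp_rw [hL, hR]
  have m1 : Measurable fun p : (Fin n → RVec r') × (Fin n → RVec r) => ENNReal.ofReal (Real.exp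
        (logGaussBlock (N - A * S⁻¹ * Aᵀ) (p.2 - blockMap (A * S⁻¹) p.1))) * f (p.2, p.1) := by
    fun_prop
  have m2 : Measurable fun p : (Fin n → RVec r) × (Fin n → RVec r') => ENNReal.ofReal (Real.exp
        (logGaussBlock (S - Aᵀ * N⁻¹ * A) (p.2 - blockMap (Aᵀ * N⁻¹) p.1))) * f (p.1, p.2) := by
    fun_prop
  rw [gaussBlock_eq_withDensity n hS, gaussBlock_eq_withDensity n hN,
    lintegral_withDensity_eq_lintegral_mul _ (by fun_prop) m1.lintegral_prod_right',
    lintegral_withDensity_eq_lintegral_mul _ (by fun_prop) m2.lintegral_prod_right']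
  simp only [Pi.mul_apply]
  have e1 : ∀ w : Fin n → RVec r', ENNReal.ofReal (Real.exp (logGaussBlock S w)) *
      ∫⁻ j, ENNReal.ofReal (Real.exp
        (logGaussBlock (N - A * S⁻¹ * Aᵀ) (j - blockMap (A * S⁻¹) w))) * f (j, w) =
      ∫⁻ j, ENNReal.ofReal (Real.exp (logGaussBlock N j +
        logGaussBlock (S - Aᵀ * N⁻¹ * A) (w - blockMap (Aᵀ * N⁻¹) j))) * f (j, w) := by
    intro w
    rw [← lintegral_const_mul _ (by fun_prop)]
    refine lintegral_congr fun j => ?_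
    rw [← hdens, Real.exp_add, ENNReal.ofReal_mul (Real.exp_pos _).le, mul_assoc]
  have e2 : ∀ j : Fin n → RVec r, ENNReal.ofReal (Real.exp (logGaussBlock N j)) *
      ∫⁻ w, ENNReal.ofReal (Real.exp
        (logGaussBlock (S - Aᵀ * N⁻¹ * A) (w - blockMap (Aᵀ * N⁻¹) j))) * f (j, w) =
      ∫⁻ w, ENNReal.ofReal (Real.exp (logGaussBlock N j +
        logGaussBlock (S - Aᵀ * N⁻¹ * A) (w - blockMap (Aᵀ * N⁻¹) j))) * f (j, w) := by
    intro j
    rw [← lintegral_const_mul _ (by fun_prop)]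
    refine lintegral_congr fun w => ?_
    rw [Real.exp_add, ENNReal.ofReal_mul (Real.exp_pos _).le, mul_assoc]
  simp_rw [e1, e2]
  exact lintegral_lintegral_swap (by fun_prop)

/-- Change of measure between the noise law seen from a transmitted codeword `h` and a reference
output law. -/
lemma lintegral_shift_gaussBlock {N Y : Matrix (Fin r) (Fin r) ℝ} (hN : N.PosDef) (hY : Y.PosDef)
    (h : Fin n → RVec r) {F : (Fin n → RVec r) → ℝ≥0∞} (hF : Measurable F) :
    ∫⁻ j, ENNReal.ofReal (Real.exp (logGaussBlock Y (h + j) - logGaussBlock N j)) * F (h + j)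
      ∂(gaussBlock n N) = ∫⁻ y, F y ∂(gaussBlock n Y) := by
  rw [gaussBlock_eq_withDensity n hN, gaussBlock_eq_withDensity n hY,
    lintegral_withDensity_eq_lintegral_mul _ (by fun_prop) (by fun_prop),
    lintegral_withDensity_eq_lintegral_mul _ (by fun_prop) hF,
    ← lintegral_add_left_eq_self
      ((fun y => ENNReal.ofReal (Real.exp (logGaussBlock Y y))) * F) h]
  refine lintegral_congr fun j => ?_
  simp only [Pi.mul_apply]
  rw [← mul_assoc, ← ENNReal.ofReal_mul (Real.exp_pos _).le, ← Real.exp_add, add_sub_cancel]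

/-- The score `log (M / 2)` of the message chosen by the decoder `d`, and `log (1 / 2)` of every other
message. After division by `M`, the exponentials of the scores of all messages sum to at most one, so
they serve as the decoder's posterior in Gibbs' inequality; this is how Fano's inequality arises. -/
def decScore (d : (Fin n → RVec r) → Fin M) (m : Fin M) (y : Fin n → RVec r) : ℝ :=
  -Real.log 2 + {y | d y = m}.indicator (fun _ => Real.log M) y

lemma measurable_decScore {d : (Fin n → RVec r) → Fin M} (hd : Measurable d) (m : Fin M) :
    Measurable (decScore d m) := by
  unfold decScore
  exact measurable_const.add (measurable_const.indicator (hd (measurableSet_singleton m)))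

lemma sum_exp_decScore_le [NeZero M] (d : (Fin n → RVec r) → Fin M) (y : Fin n → RVec r) :
    ∑ m, Real.exp (decScore d m y) ≤ M := by
  have hM : (1 : ℝ) ≤ M := by exact_mod_cast Nat.one_le_iff_ne_zero.2 (NeZero.ne M)
  have h : ∀ m, Real.exp (decScore d m y) = 1 / 2 + if d y = m then (M - 1 : ℝ) / 2 else 0 := by
    intro m
    unfold decScore
    rw [Real.exp_add, Real.exp_neg, Real.exp_log (by norm_num), Set.indicator_apply]
    by_cases hm : d y = m
    · simp only [Set.mem_ofPred_eq, hm, if_true]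
      rw [Real.exp_log (by linarith)]
      ring
    · simp [hm]
  simp_rw [h, Finset.sum_add_distrib, Finset.sum_ite_eq, Finset.mem_univ, if_true]
  simp
  linarith

/-- Fano's inequality for a receiver that also observes a smart genie signal. The codewords `h m`
arrive with interference `g m'` and white noise; `mixLaw g 1` is the law of interference plus noise
`J`. The genie signal is `h' m + W`, where `W` has covariance `S` and cross-covariance `A` with the
white noise, whose part independent of `W` has covariance `K`. The covariances `N`, `Y`, `T`, and
`N - A S⁻¹ Aᵀ` are those of Gaussian reference laws for `J`, for the output, for the genie signal, and
for `J - A S⁻¹ W`; the last two enter through divergences. The rate bound is Gibbs' inequality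
against the law of (message, output, genie signal) in which the message has the posterior given by
the decoder, the output is `N(0, Y)`, and the genie signal given the output is that of the reference
laws, reweighted by its true density over the reference density. -/
theorem genie_fano [NeZero M] [NeZero M'] {N Y K : Matrix (Fin r) (Fin r) ℝ}
    {A : Matrix (Fin r) (Fin r') ℝ} {S T : Matrix (Fin r') (Fin r') ℝ}
    (hN : N.PosDef) (hY : Y.PosDef) (hK : K.PosDef) (hS : S.PosDef) (hT : T.PosDef)
    (hV : (N - A * S⁻¹ * Aᵀ).PosDef) (hKA : K + A * S⁻¹ * Aᵀ = 1)
    (hTY : (Aᵀ * N⁻¹) * Y * (Aᵀ * N⁻¹)ᵀ + (S - Aᵀ * N⁻¹ * A) = T)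
    (h : Fin M → Fin n → RVec r) (g : Fin M' → Fin n → RVec r) (h' : Fin M → Fin n → RVec r')
    (hh' : ∀ m, blockMap (Aᵀ * N⁻¹) (h m) = h' m)
    (d : (Fin n → RVec r) → Fin M) (hd : Measurable d) :
    Real.log M - Real.log 2 -
        ((M : ℝ)⁻¹ * ∑ m, (mixLaw g 1).real {j | d (h m + j) ≠ m}) * Real.log M ≤
      (M : ℝ)⁻¹ * ∑ m, (∫ j, (logGaussBlock N j - logGaussBlock Y (h m + j)) ∂(mixLaw g 1)) +
      ∫ u, mixLLR g K (N - A * S⁻¹ * Aᵀ) u ∂(mixLaw g K) -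
      ∫ s, mixLLR h' S T s ∂(mixLaw h' S) := by
  have hMr : (0 : ℝ) < M := by exact_mod_cast Nat.pos_of_ne_zero (NeZero.ne M)
  set V := N - A * S⁻¹ * Aᵀ with hVdef
  set Δ := S - Aᵀ * N⁻¹ * A with hΔdef
  have hΔ : Δ.PosDef := posDef_schur hN hS hV
  have uS : IsUnit S.det := hS.det_pos.ne'.isUnit
  have hST : Sᵀ = S := by simpa using hS.isHermitian.eq
  set μ := (gaussBlock n S).prod (mixLaw g K) with hμ
  -- `μ` is the joint law of the genie noise `W` and of `U = J - A S⁻¹ W`, where `J` is the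
  -- interference plus noise; given the codewords `g`, the two are independent
  have hJ : μ.map (fun p => p.2 + blockMap (A * S⁻¹) p.1) = mixLaw g 1 := by
    rw [hμ, map_prod_mixLaw g hK.posSemidef _ hS.posSemidef, ← hKA]
    congr 2
    rw [transpose_mul, transpose_nonsing_inv, hST, Matrix.mul_assoc A, Matrix.nonsing_inv_mul _ uS,
      Matrix.mul_one, Matrix.mul_assoc]
  have hJm : Measurable fun p : (Fin n → RVec r') × (Fin n → RVec r) =>
    p.2 + blockMap (A * S⁻¹) p.1 := by fun_prop
  have hdm := measurable_decScore hd
  -- integrability of the four terms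
  have iψ : ∀ m, Integrable (fun j => decScore d m (h m + j)) (mixLaw g 1) := by
    intro m
    unfold decScore
    refine (integrable_const _).add ?_
    refine (integrable_const (Real.log M)).indicator (s := {j | d (h m + j) = m}) ?_
    exact (hd.comp (measurable_const_add _)) (measurableSet_singleton m)
  have iG : ∀ m, Integrable (fun j => logGaussBlock N j - logGaussBlock Y (h m + j))
      (mixLaw g 1) := by
    intro m
    refine integrable_mixLaw g 1 (by fun_prop) fun m' => ?_
    refine (integrable_logGaussBlock_add _ _ _).sub ?_
    simp_rw [← add_assoc]
    exact integrable_logGaussBlock_add _ _ _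
  have iψ' : ∀ m, Integrable (fun p : (Fin n → RVec r') × (Fin n → RVec r) =>
      decScore d m (h m + (p.2 + blockMap (A * S⁻¹) p.1))) μ := fun m => by
    have := iψ m
    rw [← hJ] at this
    exact (integrable_map_measure ((hdm m).comp (measurable_const_add _)).aestronglyMeasurable
      hJm.aemeasurable).1 this
  have iG' : ∀ m, Integrable (fun p : (Fin n → RVec r') × (Fin n → RVec r) =>
      logGaussBlock N (p.2 + blockMap (A * S⁻¹) p.1) -
        logGaussBlock Y (h m + (p.2 + blockMap (A * S⁻¹) p.1))) μ := fun m => by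
    have := iG m
    rw [← hJ] at this
    exact (integrable_map_measure (by fun_prop) hJm.aemeasurable).1 this
  have iS : ∀ m, Integrable (fun p : (Fin n → RVec r') × (Fin n → RVec r) =>
      mixLLR h' S T (h' m + p.1)) μ := fun m =>
    (integrable_mixLLR_add h' hS T S (h' m)).comp_fst _
  have iU : Integrable (fun p : (Fin n → RVec r') × (Fin n → RVec r) => mixLLR g K V p.2) μ :=
    (integrable_mixLLR g hK V).comp_snd _
  -- the log-likelihood ratio, given message `m`, of the reference law over the true joint law
  set φ : Fin M → (Fin n → RVec r') × (Fin n → RVec r) → ℝ := fun m p =>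
    decScore d m (h m + (p.2 + blockMap (A * S⁻¹) p.1)) + mixLLR h' S T (h' m + p.1) -
      (logGaussBlock N (p.2 + blockMap (A * S⁻¹) p.1) -
        logGaussBlock Y (h m + (p.2 + blockMap (A * S⁻¹) p.1))) - mixLLR g K V p.2 with hφ
  have iφ : ∀ m, Integrable (φ m) μ := fun m => (((iψ' m).add (iS m)).sub (iG' m)).sub iU
  have hint : ∀ m, ∫ p, φ m p ∂μ =
      (-Real.log 2 + (1 - (mixLaw g 1).real {j | d (h m + j) ≠ m}) * Real.log M) +
      (∫ s, mixLLR h' S T (h' m + s) ∂(gaussBlock n S)) -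
      (∫ j, (logGaussBlock N j - logGaussBlock Y (h m + j)) ∂(mixLaw g 1)) -
      ∫ u, mixLLR g K V u ∂(mixLaw g K) := by
    intro m
    have hset : MeasurableSet {j | d (h m + j) = m} :=
      (hd.comp (measurable_const_add _)) (measurableSet_singleton m)
    have e1 : ∫ p, decScore d m (h m + (p.2 + blockMap (A * S⁻¹) p.1)) ∂μ =
        -Real.log 2 + (1 - (mixLaw g 1).real {j | d (h m + j) ≠ m}) * Real.log M := by
      rw [← integral_map (μ := μ) (f := fun j => decScore d m (h m + j)) hJm.aemeasurable
        ((hdm m).comp (measurable_const_add _)).aestronglyMeasurable, hJ]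
      unfold decScore
      have hi : Integrable ({j | d (h m + j) = m}.indicator fun _ => Real.log M) (mixLaw g 1) :=
        (integrable_const _).indicator hset
      have : ∀ j, {y | d y = m}.indicator (fun _ => Real.log M) (h m + j) =
          {j | d (h m + j) = m}.indicator (fun _ => Real.log M) j := fun j => rfl
      simp_rw [this]
      rw [integral_add (integrable_const _) hi, integral_indicator_const _ hset,
        show {j | d (h m + j) ≠ m} = {j | d (h m + j) = m}ᶜ from rfl, probReal_compl_eq_one_sub hset]
      simp
    have e2 : ∫ p, mixLLR h' S T (h' m + p.1) ∂μ =
        ∫ s, mixLLR h' S T (h' m + s) ∂(gaussBlock n S) := by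
      simp [hμ, integral_fun_fst (f := fun s => mixLLR h' S T (h' m + s))]
    have e3 : ∫ p, (logGaussBlock N (p.2 + blockMap (A * S⁻¹) p.1) -
        logGaussBlock Y (h m + (p.2 + blockMap (A * S⁻¹) p.1))) ∂μ =
        ∫ j, (logGaussBlock N j - logGaussBlock Y (h m + j)) ∂(mixLaw g 1) := by
      rw [← integral_map (μ := μ) (f := fun j => logGaussBlock N j - logGaussBlock Y (h m + j))
        hJm.aemeasurable (by fun_prop), hJ]
    have e4 : ∫ p, mixLLR g K V p.2 ∂μ = ∫ u, mixLLR g K V u ∂(mixLaw g K) := by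
      simp [hμ, integral_fun_snd]
    have := integral_sub (((iψ' m).add (iS m)).sub (iG' m)) iU
    rw [integral_sub' ((iψ' m).add (iS m)) (iG' m), integral_add' (iψ' m) (iS m), e1, e2, e3, e4]
      at this
    exact this
  -- Gibbs' inequality, summed over the messages
  have hL : ∀ m, ∫⁻ p, ENNReal.ofReal (Real.exp (φ m p)) ∂μ =
      ∫⁻ y, ENNReal.ofReal (Real.exp (decScore d m y)) * ∫⁻ δ, ENNReal.ofReal (Real.exp
        (mixLLR h' S T (δ + blockMap (Aᵀ * N⁻¹) y))) ∂(gaussBlock n Δ) ∂(gaussBlock n Y) := by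
    intro m
    have hdm' := hdm m
    set f : (Fin n → RVec r) × (Fin n → RVec r') → ℝ≥0∞ := fun q =>
      ENNReal.ofReal (Real.exp (decScore d m (h m + q.1) + mixLLR h' S T (h' m + q.2) -
        (logGaussBlock N q.1 - logGaussBlock Y (h m + q.1)))) with hf
    have hfm : Measurable f := by fun_prop
    calc ∫⁻ p, ENNReal.ofReal (Real.exp (φ m p)) ∂μ
        = ∫⁻ w, ∫⁻ u, f (u + blockMap (A * S⁻¹) w, w) ∂(gaussBlock n V) ∂(gaussBlock n S) := by
          rw [hμ, lintegral_prod _ (by fun_prop)]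
          refine lintegral_congr fun w => ?_
          rw [mixLaw_eq_gaussBlock_withDensity g hK hV,
            lintegral_withDensity_eq_lintegral_mul _ (by fun_prop) (by fun_prop)]
          refine lintegral_congr fun u => ?_
          rw [Pi.mul_apply, ← ENNReal.ofReal_mul (Real.exp_pos _).le, ← Real.exp_add,
            hφ, add_sub_cancel]
      _ = ∫⁻ j, ∫⁻ δ, f (j, δ + blockMap (Aᵀ * N⁻¹) j) ∂(gaussBlock n Δ) ∂(gaussBlock n N) := by
          rw [← lintegral_prod (fun p : (Fin n → RVec r') × (Fin n → RVec r) =>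
              f (p.2 + blockMap (A * S⁻¹) p.1, p.1)) (by fun_prop),
            ← lintegral_prod (fun p : (Fin n → RVec r) × (Fin n → RVec r') =>
              f (p.1, p.2 + blockMap (Aᵀ * N⁻¹) p.1)) (by fun_prop)]
          have := congrArg (fun ν => ∫⁻ q, f q ∂ν) (map_prod_gaussBlock_schur (n := n) hN hS hV)
          rwa [lintegral_map hfm (by fun_prop), lintegral_map hfm (by fun_prop)] at this
      _ = _ := by
          have hGm : Measurable fun y => ENNReal.ofReal (Real.exp (decScore d m y)) *
              ∫⁻ δ, ENNReal.ofReal (Real.exp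
                (mixLLR h' S T (δ + blockMap (Aᵀ * N⁻¹) y))) ∂(gaussBlock n Δ) := by
            refine Measurable.mul (by fun_prop) ?_
            exact Measurable.lintegral_prod_right' (f := fun p : (Fin n → RVec r) ×
              (Fin n → RVec r') => ENNReal.ofReal (Real.exp
                (mixLLR h' S T (p.2 + blockMap (Aᵀ * N⁻¹) p.1)))) (by fun_prop)
          rw [← lintegral_shift_gaussBlock hN hY (h m) hGm]
          refine lintegral_congr fun j => ?_
          rw [← mul_assoc, ← lintegral_const_mul _ (by fun_prop)]
          refine lintegral_congr fun δ => ?_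
          have hlin : h' m + (δ + blockMap (Aᵀ * N⁻¹) j) = δ + blockMap (Aᵀ * N⁻¹) (h m + j) := by
            rw [← hh']
            ext k
            simp [blockMap]
            ring
          simp only [hf]
          rw [← ENNReal.ofReal_mul (Real.exp_pos _).le, ← Real.exp_add,
            ← ENNReal.ofReal_mul (Real.exp_pos _).le, ← Real.exp_add, hlin]
          congr 2
          ring
  have hsumL : ∑ m, ∫⁻ p, ENNReal.ofReal (Real.exp (φ m p)) ∂μ ≤ M := by
    simp_rw [hL]
    have hGm : Measurable fun y : Fin n → RVec r => ∫⁻ δ, ENNReal.ofReal (Real.exp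
        (mixLLR h' S T (δ + blockMap (Aᵀ * N⁻¹) y))) ∂(gaussBlock n Δ) :=
      Measurable.lintegral_prod_right' (f := fun p : (Fin n → RVec r) ×
        (Fin n → RVec r') => ENNReal.ofReal (Real.exp
          (mixLLR h' S T (p.2 + blockMap (Aᵀ * N⁻¹) p.1)))) (by fun_prop)
    have hm : ∀ m, Measurable fun y : Fin n → RVec r =>
        ENNReal.ofReal (Real.exp (decScore d m y)) * ∫⁻ δ, ENNReal.ofReal (Real.exp
          (mixLLR h' S T (δ + blockMap (Aᵀ * N⁻¹) y))) ∂(gaussBlock n Δ) := fun m =>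
      Measurable.mul (by have := hdm m; fun_prop) hGm
    rw [← lintegral_finsetSum _ fun m _ => hm m]
    calc _ ≤ ∫⁻ y, (M : ℝ≥0∞) * ∫⁻ δ, ENNReal.ofReal (Real.exp
        (mixLLR h' S T (δ + blockMap (Aᵀ * N⁻¹) y))) ∂(gaussBlock n Δ) ∂(gaussBlock n Y) := by
          refine lintegral_mono fun y => ?_
          rw [← Finset.sum_mul]
          gcongr
          rw [← ENNReal.ofReal_sum_of_nonneg fun _ _ => (Real.exp_pos _).le,
            ← ENNReal.ofReal_natCast]
          exact ENNReal.ofReal_le_ofReal (sum_exp_decScore_le d y)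
      _ = M := by
          rw [lintegral_const_mul _ hGm, ← lintegral_prod (fun p : (Fin n → RVec r) ×
            (Fin n → RVec r') => ENNReal.ofReal (Real.exp
              (mixLLR h' S T (p.2 + blockMap (Aᵀ * N⁻¹) p.1)))) (by fun_prop),
            ← lintegral_map (f := fun z => ENNReal.ofReal (Real.exp (mixLLR h' S T z)))
              (by fun_prop) (by fun_prop)]
          have := map_prod_gaussBlock (n := n) (Aᵀ * N⁻¹) 1 hY.posSemidef hΔ.posSemidef
          simp only [blockMap_one, Matrix.one_mul, transpose_one, Matrix.mul_one, hTY] at this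
          simp_rw [add_comm _ (blockMap (Aᵀ * N⁻¹) _)]
          rw [this, lintegral_exp_mixLLR h' hS hT, mul_one]
  have hsum : ∑ m, ∫ p, φ m p ∂μ ≤ 0 := by
    have h1 : ENNReal.ofReal (∑ m, (1 + ∫ p, φ m p ∂μ)) ≤ ENNReal.ofReal M := by
      rw [ENNReal.ofReal_natCast]
      refine le_trans ?_ hsumL
      refine (Finset.le_sum_of_subadditive ENNReal.ofReal
        ENNReal.ofReal_zero.le
        (fun _ _ => ENNReal.ofReal_add_le) _ _).trans ?_
      exact Finset.sum_le_sum fun m _ => ofReal_one_add_integral_le (iφ m)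
    rw [ENNReal.ofReal_le_ofReal_iff hMr.le, Finset.sum_add_distrib] at h1
    simpa using h1
  simp_rw [hint, Finset.sum_sub_distrib, Finset.sum_add_distrib] at hsum
  rw [integral_mixLaw h' S (by fun_prop) fun m => integrable_mixLLR_add h' hS T S (h' m)]
  have hsum' := mul_le_mul_of_nonneg_left hsum (inv_nonneg.2 hMr.le)
  simp only [Finset.sum_const, Finset.card_univ, Fintype.card_fin, nsmul_eq_mul, mul_zero,
    ← Finset.sum_mul, Finset.sum_sub_distrib, mul_one] at hsum'
  have hMM : (M : ℝ)⁻¹ * M = 1 := inv_mul_cancel₀ hMr.ne'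
  have key : ∀ a b c e f l : ℝ, (M : ℝ)⁻¹ * ((M : ℝ) * -a + (M - b) * e + c - f - M * l) =
      (M : ℝ)⁻¹ * M * (-a) + ((M : ℝ)⁻¹ * M - (M : ℝ)⁻¹ * b) * e + (M : ℝ)⁻¹ * c -
        (M : ℝ)⁻¹ * f - (M : ℝ)⁻¹ * M * l := by
    intros; ring
  rw [key, hMM] at hsum'
  linarith

end Genie

/-! ### The converse for a single block code -/

section Converse

variable {t t' r n M M' : ℕ}

/-- Covariance of interference plus noise at a receiver. -/
def intCov (G : Matrix (Fin r) (Fin t') ℝ) (Q' : Matrix (Fin t') (Fin t') ℝ) :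
    Matrix (Fin r) (Fin r) ℝ := G * Q' * Gᵀ + 1

/-- Covariance of the received signal. -/
def outCov (H : Matrix (Fin r) (Fin t) ℝ) (G : Matrix (Fin r) (Fin t') ℝ)
    (Q : Matrix (Fin t) (Fin t) ℝ) (Q' : Matrix (Fin t') (Fin t') ℝ) :
    Matrix (Fin r) (Fin r) ℝ := H * Q * Hᵀ + intCov G Q'

lemma posSemidef_conj {s r : ℕ} (G : Matrix (Fin r) (Fin s) ℝ) {Q : Matrix (Fin s) (Fin s) ℝ}
    (hQ : Q.PosSemidef) : (G * Q * Gᵀ).PosSemidef := by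
  simpa using hQ.mul_mul_conjTranspose_same G

lemma posDef_intCov (G : Matrix (Fin r) (Fin t') ℝ) {Q' : Matrix (Fin t') (Fin t') ℝ}
    (hQ' : Q'.PosSemidef) : (intCov G Q').PosDef :=
  (PosDef.one).posSemidef_add (posSemidef_conj G hQ')

lemma posDef_outCov (H : Matrix (Fin r) (Fin t) ℝ) (G : Matrix (Fin r) (Fin t') ℝ)
    {Q : Matrix (Fin t) (Fin t) ℝ} {Q' : Matrix (Fin t') (Fin t') ℝ} (hQ : Q.PosSemidef)
    (hQ' : Q'.PosSemidef) : (outCov H G Q Q').PosDef :=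
  (posDef_intCov G hQ').posSemidef_add (posSemidef_conj H hQ)

/-- The tangent plane at `(Q, Q')`, evaluated at `(C, C')`, of the Gaussian rate
`(log det (outCov) - log det (intCov)) / 2`. -/
def tangentRate (H : Matrix (Fin r) (Fin t) ℝ) (G : Matrix (Fin r) (Fin t') ℝ)
    (Q : Matrix (Fin t) (Fin t) ℝ) (Q' : Matrix (Fin t') (Fin t') ℝ)
    (C : Matrix (Fin t) (Fin t) ℝ) (C' : Matrix (Fin t') (Fin t') ℝ) : ℝ :=
  (Real.log (outCov H G Q Q').det - Real.log (intCov G Q').det +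
    ((outCov H G Q Q')⁻¹ * outCov H G C C').trace - ((intCov G Q')⁻¹ * intCov G C').trace) / 2

lemma quad_toEuclideanLin {s : ℕ} (P : Matrix (Fin r) (Fin r) ℝ) (H : Matrix (Fin r) (Fin s) ℝ)
    (x : RVec s) :
    quad P (H.toEuclideanLin x) = (P * (H * vecMulVec x.ofLp x.ofLp * Hᵀ)).trace := by
  rw [mul_vecMulVec, vecMulVec_mul, vecMul_transpose, mul_vecMulVec, trace_vecMulVec,
    quad, Matrix.toLpLin_apply, dotProduct_comm]

lemma sum_quad_blockMap (P : Matrix (Fin r) (Fin r) ℝ) (H : Matrix (Fin r) (Fin t) ℝ)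
    (c : Codebook M n t) :
    ∑ k, (M : ℝ)⁻¹ * ∑ m, quad P (blockMap H (c m) k) =
      n * (P * (H * avgCov c * Hᵀ)).trace := by
  rcases Nat.eq_zero_or_pos n with rfl | hn
  · simp
  have hn' : (n : ℝ) ≠ 0 := by exact_mod_cast hn.ne'
  simp only [avgCov, blockMap, quad_toEuclideanLin]
  simp only [Matrix.mul_smul, Matrix.smul_mul, Matrix.mul_sum, Matrix.sum_mul, trace_smul,
    trace_sum, smul_eq_mul]
  rw [← mul_assoc, mul_inv_cancel₀ hn', one_mul]

lemma quad_add {P : Matrix (Fin r) (Fin r) ℝ} (x y : RVec r) :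
    quad P (x + y) = quad P x + quad P y +
      (x.ofLp ⬝ᵥ P *ᵥ y.ofLp + y.ofLp ⬝ᵥ P *ᵥ x.ofLp) := by
  simp only [quad, WithLp.ofLp_add, mulVec_add, add_dotProduct, dotProduct_add]
  ring

lemma sum_sum_quad_add [NeZero M] [NeZero M'] (P : Matrix (Fin r) (Fin r) ℝ)
    (x : Fin M → RVec r) (y : Fin M' → RVec r) (hx : ∑ m, x m = 0) :
    (M : ℝ)⁻¹ * ∑ m, (M' : ℝ)⁻¹ * ∑ m', quad P (x m + y m') =
      (M : ℝ)⁻¹ * ∑ m, quad P (x m) + (M' : ℝ)⁻¹ * ∑ m', quad P (y m') := by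
  have hM : (M : ℝ) ≠ 0 := by exact_mod_cast NeZero.ne M
  have hM' : (M' : ℝ) ≠ 0 := by exact_mod_cast NeZero.ne M'
  have hx' : ∑ m, (x m).ofLp = 0 := by
    have := congrArg WithLp.ofLp hx
    simpa using this
  have h1 : ∑ m, ∑ m', (x m).ofLp ⬝ᵥ P *ᵥ (y m').ofLp = 0 := by
    rw [Finset.sum_comm]
    simp_rw [← sum_dotProduct, hx']
    simp
  have h2 : ∑ m, ∑ m', (y m').ofLp ⬝ᵥ P *ᵥ (x m).ofLp = 0 := by
    rw [Finset.sum_comm]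
    simp_rw [← dotProduct_sum, ← mulVec_sum, hx']
    simp
  rw [← Finset.mul_sum]
  simp_rw [quad_add, Finset.sum_add_distrib]
  rw [h1, h2]
  simp only [Finset.sum_const, Finset.card_univ, Fintype.card_fin, nsmul_eq_mul,
    ← Finset.mul_sum]
  field_simp
  ring

/-- The TIN term of the outer bound depends on the code only through its average covariances. The
mean of one codebook has to vanish for the cross terms between the two users to average out. -/
lemma average_logGaussBlock_sub [NeZero M] [NeZero M'] (H : Matrix (Fin r) (Fin t) ℝ)
    (G : Matrix (Fin r) (Fin t') ℝ) (Q : Matrix (Fin t) (Fin t) ℝ)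
    (Q' : Matrix (Fin t') (Fin t') ℝ) (c : Codebook M n t) (c' : Codebook M' n t')
    (hc : ∀ k, ∑ m, c m k = 0) :
    (M : ℝ)⁻¹ * ∑ m, (∫ j, (logGaussBlock (intCov G Q') j -
      logGaussBlock (outCov H G Q Q') (blockMap H (c m) + j))
        ∂(mixLaw (fun m' => blockMap G (c' m')) 1)) =
      n * tangentRate H G Q Q' (avgCov c) (avgCov c') := by
  have hM : (M : ℝ) ≠ 0 := by exact_mod_cast NeZero.ne M
  have hM' : (M' : ℝ) ≠ 0 := by exact_mod_cast NeZero.ne M'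
  set N := intCov G Q'
  set Y := outCov H G Q Q'
  have hi : ∀ m, ∫ j, (logGaussBlock N j - logGaussBlock Y (blockMap H (c m) + j))
        ∂(mixLaw (fun m' => blockMap G (c' m')) 1) =
      ∑ k, ((Real.log Y.det - Real.log N.det + Y⁻¹.trace - N⁻¹.trace) / 2 +
        (M' : ℝ)⁻¹ * ∑ m', (quad Y⁻¹ (blockMap H (c m) k + blockMap G (c' m') k) -
          quad N⁻¹ (blockMap G (c' m') k)) / 2) := by
    intro m
    rw [integral_mixLaw _ _ (by fun_prop) fun m' => (integrable_logGaussBlock_add _ _ _).sub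
      (by simp_rw [← add_assoc]; exact integrable_logGaussBlock_add _ _ _)]
    have : ∀ m', ∫ z, (logGaussBlock N (blockMap G (c' m') + z) -
        logGaussBlock Y (blockMap H (c m) + (blockMap G (c' m') + z))) ∂(gaussBlock n 1) =
        ∑ k, ((Real.log Y.det - Real.log N.det + Y⁻¹.trace - N⁻¹.trace) / 2 +
          (quad Y⁻¹ (blockMap H (c m) k + blockMap G (c' m') k) -
          quad N⁻¹ (blockMap G (c' m') k)) / 2) := by
      intro m'
      simp_rw [← add_assoc]
      rw [integral_sub (integrable_logGaussBlock_add _ _ _) (integrable_logGaussBlock_add _ _ _),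
        integral_logGaussBlock_add PosSemidef.one, integral_logGaussBlock_add PosSemidef.one,
        ← Finset.sum_sub_distrib]
      refine Finset.sum_congr rfl fun k _ => ?_
      simp only [Matrix.mul_one, Pi.add_apply]
      ring
    simp_rw [this]
    rw [Finset.sum_comm, Finset.mul_sum]
    refine Finset.sum_congr rfl fun k _ => ?_
    rw [Finset.sum_add_distrib, mul_add]
    congr 1
    simp
    field_simp
  simp_rw [hi]
  rw [Finset.sum_comm, Finset.mul_sum]
  have hk : ∀ k, (M : ℝ)⁻¹ * ∑ m, ((Real.log Y.det - Real.log N.det + Y⁻¹.trace - N⁻¹.trace) / 2 +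
        (M' : ℝ)⁻¹ * ∑ m', (quad Y⁻¹ (blockMap H (c m) k + blockMap G (c' m') k) -
          quad N⁻¹ (blockMap G (c' m') k)) / 2) =
      (Real.log Y.det - Real.log N.det + Y⁻¹.trace - N⁻¹.trace) / 2 +
      ((M : ℝ)⁻¹ * ∑ m, quad Y⁻¹ (blockMap H (c m) k) +
        (M' : ℝ)⁻¹ * ∑ m', quad Y⁻¹ (blockMap G (c' m') k) -
        (M' : ℝ)⁻¹ * ∑ m', quad N⁻¹ (blockMap G (c' m') k)) / 2 := by
    intro k
    have hx : ∑ m, blockMap H (c m) k = 0 := by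
      simp only [blockMap, ← map_sum, hc, map_zero]
    rw [← sum_sum_quad_add Y⁻¹ _ _ hx]
    simp only [Finset.sum_add_distrib, Finset.sum_sub_distrib, ← Finset.sum_div, Finset.sum_const,
      Finset.card_univ, Fintype.card_fin, nsmul_eq_mul, ← Finset.mul_sum]
    field_simp
  simp_rw [hk]
  have s1 := sum_quad_blockMap Y⁻¹ H c
  have s2 := sum_quad_blockMap Y⁻¹ G c'
  have s3 := sum_quad_blockMap N⁻¹ G c'
  simp only [Finset.sum_add_distrib, ← Finset.sum_div, Finset.sum_sub_distrib, s1, s2, s3]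
  simp only [tangentRate, outCov, intCov, Matrix.mul_add, trace_add, Matrix.mul_one,
    Finset.sum_const, Finset.card_univ, Fintype.card_fin, nsmul_eq_mul, N, Y]
  ring

lemma errorProb_eq [NeZero M'] (H : Matrix (Fin r) (Fin t) ℝ)
    (G : Matrix (Fin r) (Fin t') ℝ) (c : Codebook M n t) (c' : Codebook M' n t')
    {d : (Fin n → RVec r) → Fin M} (hd : Measurable d) :
    errorProb H G c c' d = (M : ℝ)⁻¹ * ∑ m, (mixLaw (fun m' => blockMap G (c' m')) 1).real
      {j | d (blockMap H (c m) + j) ≠ m} := by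
  rw [errorProb, mul_inv, mul_assoc, Finset.mul_sum]
  congr 1
  refine Finset.sum_congr rfl fun m _ => ?_
  have hs : MeasurableSet {j | d (blockMap H (c m) + j) ≠ m} :=
    (hd.comp (measurable_const_add _)) (measurableSet_singleton m).compl
  rw [measureReal_def, mixLaw, Measure.smul_apply, Measure.finsetSum_apply, smul_eq_mul,
    ENNReal.toReal_mul, ENNReal.toReal_inv, ENNReal.toReal_natCast, ENNReal.toReal_sum]
  · congr 1
    refine Finset.sum_congr rfl fun m' _ => ?_
    rw [Measure.map_apply (measurable_const_add _) hs, ← measureReal_def, noiseLaw_eq_gaussBlock]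
    congr 1
    ext z
    simp only [Set.mem_ofPred_eq, Set.mem_preimage, ← add_assoc]
    rfl
  · intro m' _
    rw [Measure.map_apply (measurable_const_add _) hs]
    exact measure_ne_top _ _

/-- The genie-aided outer bound for a block code whose codebooks have mean zero. The divergences left
by Fano's inequality at one receiver cancel, through data processing, against those at the other. -/
theorem sum_rate_le_tangentRate_of_centred {t₁ t₂ r₁ r₂ n M₁ M₂ : ℕ} [NeZero M₁] [NeZero M₂]
    (ch : InterferenceChannel t₁ t₂ r₁ r₂)
    {Q₁ : Matrix (Fin t₁) (Fin t₁) ℝ} {Q₂ : Matrix (Fin t₂) (Fin t₂) ℝ}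
    (hQ₁ : Q₁.PosSemidef) (hQ₂ : Q₂.PosSemidef)
    {A₁ : Matrix (Fin r₁) (Fin r₂) ℝ} {A₂ : Matrix (Fin r₂) (Fin r₁) ℝ}
    {S₁ : Matrix (Fin r₂) (Fin r₂) ℝ} {S₂ : Matrix (Fin r₁) (Fin r₁) ℝ}
    (hS₁ : S₁.PosDef) (hS₂ : S₂.PosDef)
    (huseful₁ : (1 - A₂ * S₂⁻¹ * A₂ᵀ - S₁).PosSemidef)
    (huseful₂ : (1 - A₁ * S₁⁻¹ * A₁ᵀ - S₂).PosSemidef)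
    (hsmart₁ : A₁ᵀ * (intCov ch.H₁₂ Q₂)⁻¹ * ch.H₁₁ = ch.H₂₁)
    (hsmart₂ : A₂ᵀ * (intCov ch.H₂₁ Q₁)⁻¹ * ch.H₂₂ = ch.H₁₂)
    (c₁ : Codebook M₁ n t₁) (c₂ : Codebook M₂ n t₂)
    (hc₁ : ∀ k, ∑ m, c₁ m k = 0) (hc₂ : ∀ k, ∑ m, c₂ m k = 0)
    {d₁ : (Fin n → RVec r₁) → Fin M₁} {d₂ : (Fin n → RVec r₂) → Fin M₂}
    (hd₁ : Measurable d₁) (hd₂ : Measurable d₂) :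
    (1 - errorProb ch.H₁₁ ch.H₁₂ c₁ c₂ d₁) * Real.log M₁ +
      (1 - errorProb ch.H₂₂ ch.H₂₁ c₂ c₁ d₂) * Real.log M₂ - 2 * Real.log 2 ≤
    n * (tangentRate ch.H₁₁ ch.H₁₂ Q₁ Q₂ (avgCov c₁) (avgCov c₂) +
      tangentRate ch.H₂₂ ch.H₂₁ Q₂ Q₁ (avgCov c₂) (avgCov c₁)) := by
  set N₁ := intCov ch.H₁₂ Q₂ with hN₁def
  set N₂ := intCov ch.H₂₁ Q₁ with hN₂def
  have hN₁ : N₁.PosDef := posDef_intCov _ hQ₂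
  have hN₂ : N₂.PosDef := posDef_intCov _ hQ₁
  set K₁ := 1 - A₁ * S₁⁻¹ * A₁ᵀ with hK₁def
  set K₂ := 1 - A₂ * S₂⁻¹ * A₂ᵀ with hK₂def
  have hK₁ : K₁.PosDef := by simpa using hS₂.add_posSemidef huseful₂
  have hK₂ : K₂.PosDef := by simpa using hS₁.add_posSemidef huseful₁
  set T₁ := ch.H₂₁ * Q₁ * ch.H₂₁ᵀ + S₁ with hT₁def
  set T₂ := ch.H₁₂ * Q₂ * ch.H₁₂ᵀ + S₂ with hT₂def
  have hT₁ : T₁.PosDef := hS₁.posSemidef_add (posSemidef_conj _ hQ₁)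
  have hT₂ : T₂.PosDef := hS₂.posSemidef_add (posSemidef_conj _ hQ₂)
  have eV₁ : N₁ - A₁ * S₁⁻¹ * A₁ᵀ = T₂ + (K₁ - S₂) := by
    simp only [hN₁def, hT₂def, hK₁def, intCov]; abel
  have eV₂ : N₂ - A₂ * S₂⁻¹ * A₂ᵀ = T₁ + (K₂ - S₁) := by
    simp only [hN₂def, hT₁def, hK₂def, intCov]; abel
  have hV₁ : (N₁ - A₁ * S₁⁻¹ * A₁ᵀ).PosDef := eV₁ ▸ hT₂.add_posSemidef huseful₂
  have hV₂ : (N₂ - A₂ * S₂⁻¹ * A₂ᵀ).PosDef := eV₂ ▸ hT₁.add_posSemidef huseful₁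
  have hmap : ∀ {a b e : ℕ} (P : Matrix (Fin a) (Fin b) ℝ) (R : Matrix (Fin b) (Fin e) ℝ)
      (x : Fin n → RVec e), blockMap P (blockMap R x) = blockMap (P * R) x := by
    intro a b e P R x
    ext k
    simp [blockMap, Matrix.toLpLin_apply]
  have F₁ := genie_fano (Y := outCov ch.H₁₁ ch.H₁₂ Q₁ Q₂) hN₁ (posDef_outCov _ _ hQ₁ hQ₂) hK₁ hS₁
    hT₁ hV₁ (by simp [hK₁def]) (smart_covariance hN₁ _ _ _ hsmart₁)
    (fun m => blockMap ch.H₁₁ (c₁ m)) (fun m => blockMap ch.H₁₂ (c₂ m))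
    (fun m => blockMap ch.H₂₁ (c₁ m)) (fun m => by rw [hmap, hsmart₁]) d₁ hd₁
  have F₂ := genie_fano (Y := outCov ch.H₂₂ ch.H₂₁ Q₂ Q₁) hN₂ (posDef_outCov _ _ hQ₂ hQ₁) hK₂ hS₂
    hT₂ hV₂ (by simp [hK₂def]) (smart_covariance hN₂ _ _ _ hsmart₂)
    (fun m => blockMap ch.H₂₂ (c₂ m)) (fun m => blockMap ch.H₂₁ (c₁ m))
    (fun m => blockMap ch.H₁₂ (c₂ m)) (fun m => by rw [hmap, hsmart₂]) d₂ hd₂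
  rw [← errorProb_eq _ _ _ _ hd₁, average_logGaussBlock_sub _ _ _ _ _ _ hc₁] at F₁
  rw [← errorProb_eq _ _ _ _ hd₂, average_logGaussBlock_sub _ _ _ _ _ _ hc₂] at F₂
  -- the genie signal of one user is a less noisy version of the interference at the other receiver
  have G₁ := integral_mixLLR_add_noise_le (fun m => blockMap ch.H₁₂ (c₂ m)) hS₂ hT₂ huseful₂
  have G₂ := integral_mixLLR_add_noise_le (fun m => blockMap ch.H₂₁ (c₁ m)) hS₁ hT₁ huseful₁
  rw [← eV₁, add_sub_cancel] at G₁
  rw [← eV₂, add_sub_cancel] at G₂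
  linarith

/-- Subtract from every codeword the mean of the codebook. -/
def centre (c : Codebook M n t) : Codebook M n t := fun m k => c m k - (M : ℝ)⁻¹ • ∑ j, c j k

lemma sum_centre [NeZero M] (c : Codebook M n t) (k : Fin n) : ∑ m, centre c m k = 0 := by
  have hM : (M : ℝ) ≠ 0 := by exact_mod_cast NeZero.ne M
  simp only [centre, Finset.sum_sub_distrib, Finset.sum_const, Finset.card_univ, Fintype.card_fin]
  rw [← Nat.cast_smul_eq_nsmul ℝ, smul_smul, mul_inv_cancel₀ hM, one_smul, sub_self]

lemma posSemidef_avgCov (c : Codebook M n t) : (avgCov c).PosSemidef := by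
  unfold avgCov
  refine PosSemidef.smul (posSemidef_sum _ fun k _ => PosSemidef.smul
    (posSemidef_sum _ fun m _ => ?_) (by positivity)) (by positivity)
  simpa using posSemidef_vecMulVec_self_star (c m k).ofLp

lemma trace_avgCov (c : Codebook M n t) :
    (avgCov c).trace = (n : ℝ)⁻¹ * ∑ k, (M : ℝ)⁻¹ * ∑ m, ‖c m k‖ ^ 2 := by
  simp only [avgCov, trace_smul, trace_sum, trace_vecMulVec, smul_eq_mul,
    EuclideanSpace.real_norm_sq_eq, dotProduct, ← pow_two]

lemma trace_avgCov_centre_le [NeZero M] (c : Codebook M n t) :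
    (avgCov (centre c)).trace ≤ (avgCov c).trace := by
  have hM : (M : ℝ) ≠ 0 := by exact_mod_cast NeZero.ne M
  rw [trace_avgCov, trace_avgCov]
  refine mul_le_mul_of_nonneg_left (Finset.sum_le_sum fun k _ =>
    mul_le_mul_of_nonneg_left ?_ (by positivity)) (by positivity)
  set a := (M : ℝ)⁻¹ • ∑ j, c j k with ha
  have h1 : ∀ m, ‖centre c m k‖ ^ 2 = ‖c m k‖ ^ 2 - 2 * inner ℝ (c m k) a + ‖a‖ ^ 2 :=
    fun m => norm_sub_sq_real _ _
  have h2 : ∑ m, inner ℝ (c m k) a = M * ‖a‖ ^ 2 := by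
    rw [← sum_inner, ← real_inner_self_eq_norm_sq, ← real_inner_smul_left]
    congr 1
    rw [ha, smul_smul, mul_inv_cancel₀ hM, one_smul]
  rw [Finset.sum_congr rfl fun m _ => h1 m, Finset.sum_add_distrib, Finset.sum_sub_distrib,
    ← Finset.mul_sum, h2]
  simp only [Finset.sum_const, Finset.card_univ, Fintype.card_fin, nsmul_eq_mul]
  have : (0 : ℝ) ≤ M * ‖a‖ ^ 2 := by positivity
  linarith

/-- Centring both codebooks shifts the output by a known vector, which the decoder can undo. -/
lemma errorProb_centre (H : Matrix (Fin r) (Fin t) ℝ) (G : Matrix (Fin r) (Fin t') ℝ)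
    (c : Codebook M n t) (c' : Codebook M' n t') (d : (Fin n → RVec r) → Fin M) :
    errorProb H G (centre c) (centre c') (fun y => d fun k => y k +
      (H.toEuclideanLin ((M : ℝ)⁻¹ • ∑ j, c j k) + G.toEuclideanLin ((M' : ℝ)⁻¹ • ∑ j, c' j k))) =
    errorProb H G c c' d := by
  unfold errorProb
  congr 1
  refine Finset.sum_congr rfl fun m _ => Finset.sum_congr rfl fun m' _ => ?_
  congr 1
  ext z
  simp only [Set.mem_ofPred_eq]
  have : (fun k => H.toEuclideanLin (centre c m k) + G.toEuclideanLin (centre c' m' k) + z k +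
      (H.toEuclideanLin ((M : ℝ)⁻¹ • ∑ j, c j k) + G.toEuclideanLin ((M' : ℝ)⁻¹ • ∑ j, c' j k))) =
      fun k => H.toEuclideanLin (c m k) + G.toEuclideanLin (c' m' k) + z k := by
    ext1 k
    simp only [centre, map_sub]
    abel
  rw [this]

end Converse

/-! ### The asymptotic outer bound -/

lemma numMsg_pos (n : ℕ) (R : ℝ≥0) : 0 < numMsg n R := Nat.ceil_pos.2 (Real.exp_pos _)

instance (n : ℕ) (R : ℝ≥0) : NeZero (numMsg n R) := ⟨(numMsg_pos n R).ne'⟩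

lemma le_log_numMsg (n : ℕ) (R : ℝ≥0) : n * (R : ℝ) ≤ Real.log (numMsg n R) := by
  rw [Real.le_log_iff_exp_le (by exact_mod_cast numMsg_pos n R)]
  exact Nat.le_ceil _

lemma centre_mem_powerSet {M n t : ℕ} [NeZero M] {c : Codebook M n t} {P : ℝ}
    (hc : avgCov c ∈ powerSet t P) : avgCov (centre c) ∈ powerSet t P :=
  ⟨posSemidef_avgCov _, (trace_avgCov_centre_le c).trans hc.2⟩

/-- The outer bound on achievable sum rates, for `B` above the tangent plane at `(Q₁, Q₂)` of the TIN
sum rate on the feasible set. -/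
theorem add_le_of_achievable {t₁ t₂ r₁ r₂ : ℕ}
    (ch : InterferenceChannel t₁ t₂ r₁ r₂)
    {Q₁ : Matrix (Fin t₁) (Fin t₁) ℝ} {Q₂ : Matrix (Fin t₂) (Fin t₂) ℝ}
    (hQ₁ : Q₁.PosSemidef) (hQ₂ : Q₂.PosSemidef)
    {A₁ : Matrix (Fin r₁) (Fin r₂) ℝ} {A₂ : Matrix (Fin r₂) (Fin r₁) ℝ}
    {S₁ : Matrix (Fin r₂) (Fin r₂) ℝ} {S₂ : Matrix (Fin r₁) (Fin r₁) ℝ}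
    (hS₁ : S₁.PosDef) (hS₂ : S₂.PosDef)
    (huseful₁ : (1 - A₂ * S₂⁻¹ * A₂ᵀ - S₁).PosSemidef)
    (huseful₂ : (1 - A₁ * S₁⁻¹ * A₁ᵀ - S₂).PosSemidef)
    (hsmart₁ : A₁ᵀ * (intCov ch.H₁₂ Q₂)⁻¹ * ch.H₁₁ = ch.H₂₁)
    (hsmart₂ : A₂ᵀ * (intCov ch.H₂₁ Q₁)⁻¹ * ch.H₂₂ = ch.H₁₂)
    {B : ℝ} (hB : ∀ C₁ ∈ powerSet t₁ ch.P₁, ∀ C₂ ∈ powerSet t₂ ch.P₂,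
      tangentRate ch.H₁₁ ch.H₁₂ Q₁ Q₂ C₁ C₂ + tangentRate ch.H₂₂ ch.H₂₁ Q₂ Q₁ C₂ C₁ ≤ B)
    {R₁ R₂ : ℝ≥0} (hR : ch.Achievable R₁ R₂) : (R₁ : ℝ) + R₂ ≤ B := by
  obtain ⟨C, hP, he₁, he₂⟩ := hR
  set e₁ := fun n => errorProb ch.H₁₁ ch.H₁₂ (C n).enc₁ (C n).enc₂ (C n).dec₁
  set e₂ := fun n => errorProb ch.H₂₂ ch.H₂₁ (C n).enc₂ (C n).enc₁ (C n).dec₂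
  have hbound : ∀ n : ℕ, (1 - e₁ n) * Real.log (numMsg n R₁) +
      (1 - e₂ n) * Real.log (numMsg n R₂) - 2 * Real.log 2 ≤ n * B := by
    intro n
    have h := sum_rate_le_tangentRate_of_centred ch hQ₁ hQ₂ hS₁ hS₂ huseful₁ huseful₂ hsmart₁
      hsmart₂ (centre (C n).enc₁) (centre (C n).enc₂) (sum_centre _) (sum_centre _)
      (d₁ := fun y => (C n).dec₁ fun k => y k +
        (ch.H₁₁.toEuclideanLin (((numMsg n R₁ : ℕ) : ℝ)⁻¹ • ∑ j, (C n).enc₁ j k) +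
          ch.H₁₂.toEuclideanLin (((numMsg n R₂ : ℕ) : ℝ)⁻¹ • ∑ j, (C n).enc₂ j k)))
      (d₂ := fun y => (C n).dec₂ fun k => y k +
        (ch.H₂₂.toEuclideanLin (((numMsg n R₂ : ℕ) : ℝ)⁻¹ • ∑ j, (C n).enc₂ j k) +
          ch.H₂₁.toEuclideanLin (((numMsg n R₁ : ℕ) : ℝ)⁻¹ • ∑ j, (C n).enc₁ j k)))
      ((C n).measurable_dec₁.comp (by fun_prop)) ((C n).measurable_dec₂.comp (by fun_prop))
    rw [errorProb_centre, errorProb_centre] at h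
    refine h.trans (mul_le_mul_of_nonneg_left ?_ (Nat.cast_nonneg n))
    exact hB _ (centre_mem_powerSet (hP n).1) _ (centre_mem_powerSet (hP n).2)
  have hlim : Tendsto (fun n : ℕ => (1 - e₁ n) * R₁ + (1 - e₂ n) * R₂ - 2 * Real.log 2 / n) atTop
      (𝓝 ((1 - 0) * R₁ + (1 - 0) * R₂ - 0)) :=
    (((tendsto_const_nhds.sub he₁).mul_const _).add
      ((tendsto_const_nhds.sub he₂).mul_const _)).sub (tendsto_const_div_atTop_nhds_zero_nat _)
  have hfin := le_of_tendsto (b := B) hlim ?_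
  · simpa using hfin
  filter_upwards [eventually_gt_atTop 0, he₁.eventually (gt_mem_nhds one_pos),
    he₂.eventually (gt_mem_nhds one_pos)] with n hn h1 h2
  have hn' : (0 : ℝ) < n := by exact_mod_cast hn
  have a1 := mul_le_mul_of_nonneg_left (le_log_numMsg n R₁) (sub_nonneg.2 (le_of_lt h1))
  have a2 := mul_le_mul_of_nonneg_left (le_log_numMsg n R₂) (sub_nonneg.2 (le_of_lt h2))
  have h3 : n * ((1 - e₁ n) * R₁ + (1 - e₂ n) * R₂ - 2 * Real.log 2 / n) ≤ n * B := by
    refine le_trans ?_ (hbound n)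
    have : (n : ℝ) * (2 * Real.log 2 / n) = 2 * Real.log 2 := by field_simp
    rw [mul_sub, this]
    simp only [e₁, e₂]
    linarith
  exact le_of_mul_le_mul_left h3 hn'

/-! ### The rate of Gaussian inputs -/

section TinRate

variable {t t' r : ℕ}

/-- The mutual information `I(X; Y)` for Gaussian inputs in closed form, as a real number:
`log det (H Q Hᵀ + G Q' Gᵀ + 1) / 2 - log det (G Q' Gᵀ + 1) / 2`. -/
def gaussRate (H : Matrix (Fin r) (Fin t) ℝ) (G : Matrix (Fin r) (Fin t') ℝ)
    (Q : Matrix (Fin t) (Fin t) ℝ) (Q' : Matrix (Fin t') (Fin t') ℝ) : ℝ :=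
  (Real.log (outCov H G Q Q').det - Real.log (intCov G Q').det) / 2

/-- The information density at `p = (x, y)` of the channel from own input to output, under Gaussian
inputs. -/
def infoDensity (H : Matrix (Fin r) (Fin t) ℝ) (G : Matrix (Fin r) (Fin t') ℝ)
    (Q : Matrix (Fin t) (Fin t) ℝ) (Q' : Matrix (Fin t') (Fin t') ℝ) (p : RVec t × RVec r) : ℝ :=
  logGauss (intCov G Q') (p.2 - H.toEuclideanLin p.1) - logGauss (outCov H G Q Q') p.2

@[fun_prop]
lemma measurable_infoDensity (H : Matrix (Fin r) (Fin t) ℝ) (G : Matrix (Fin r) (Fin t') ℝ)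
    (Q : Matrix (Fin t) (Fin t) ℝ) (Q' : Matrix (Fin t') (Fin t') ℝ) :
    Measurable (infoDensity H G Q Q') := by
  have : Continuous (infoDensity H G Q Q') := by unfold infoDensity; fun_prop
  exact this.measurable

variable (H : Matrix (Fin r) (Fin t) ℝ) (G : Matrix (Fin r) (Fin t') ℝ)
  {Q : Matrix (Fin t) (Fin t) ℝ} {Q' : Matrix (Fin t') (Fin t') ℝ}

lemma map_interference_add_noise (hQ' : Q'.PosSemidef) :
    ((multivariateGaussian 0 Q').prod (stdGaussian (RVec r))).map
      (fun v => G.toEuclideanLin v.1 + v.2) = multivariateGaussian 0 (intCov G Q') := by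
  have h := map_prod_multivariateGaussian G (1 : Matrix (Fin r) (Fin r) ℝ) hQ' PosSemidef.one
  simpa [intCov] using h

lemma gaussianInOut_eq_map (hQ' : Q'.PosSemidef) :
    gaussianInOut H G Q Q' =
      ((multivariateGaussian 0 Q).prod (multivariateGaussian 0 (intCov G Q'))).map
        fun p => (p.1, H.toEuclideanLin p.1 + p.2) := by
  rw [← map_interference_add_noise G hQ', ← Measure.map_id (μ := multivariateGaussian 0 Q),
    Measure.map_prod_map _ _ (by fun_prop) (by fun_prop),
    Measure.map_map (by fun_prop) (by fun_prop), gaussianInOut]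
  congr 1
  ext1 w
  simp [add_assoc]

lemma fst_gaussianInOut (hQ' : Q'.PosSemidef) :
    (gaussianInOut H G Q Q').fst = multivariateGaussian 0 Q := by
  rw [gaussianInOut_eq_map H G hQ', Measure.fst, Measure.map_map (by fun_prop) (by fun_prop)]
  exact Measure.fst_prod

lemma snd_gaussianInOut (hQ : Q.PosSemidef) (hQ' : Q'.PosSemidef) :
    (gaussianInOut H G Q Q').snd = multivariateGaussian 0 (outCov H G Q Q') := by
  rw [gaussianInOut_eq_map H G hQ', Measure.snd, Measure.map_map (by fun_prop) (by fun_prop)]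
  have h := map_prod_multivariateGaussian H (1 : Matrix (Fin r) (Fin r) ℝ) hQ
    (posDef_intCov G hQ').posSemidef
  simpa [outCov, Function.comp_def] using h

instance : IsProbabilityMeasure (gaussianInOut H G Q Q') :=
  Measure.isProbabilityMeasure_map (by fun_prop)

lemma gaussianInOut_eq_withDensity (hQ : Q.PosSemidef) (hQ' : Q'.PosSemidef) :
    gaussianInOut H G Q Q' =
      ((multivariateGaussian 0 Q).prod (multivariateGaussian 0 (outCov H G Q Q'))).withDensity
        fun p => ENNReal.ofReal (Real.exp (infoDensity H G Q Q' p)) := by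
  refine Measure.ext_of_lintegral _ fun f hf => ?_
  rw [gaussianInOut_eq_map H G hQ', lintegral_map hf (by fun_prop), lintegral_prod _ (by fun_prop),
    lintegral_withDensity_eq_lintegral_mul _ (by fun_prop) hf, lintegral_prod _ (by fun_prop)]
  refine lintegral_congr fun x => ?_
  rw [multivariateGaussian_eq_withDensity (posDef_intCov G hQ'),
    multivariateGaussian_eq_withDensity (posDef_outCov H G hQ hQ'),
    lintegral_withDensity_eq_lintegral_mul _ (by fun_prop) (by fun_prop),
    lintegral_withDensity_eq_lintegral_mul _ (by fun_prop) (by fun_prop),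
    ← lintegral_sub_right_eq_self _ (H.toEuclideanLin x)]
  refine lintegral_congr fun y => ?_
  simp only [Pi.mul_apply, infoDensity]
  rw [← mul_assoc, ← ENNReal.ofReal_mul (Real.exp_pos _).le, ← Real.exp_add, add_sub_cancel,
    add_sub_cancel]

lemma integrable_infoDensity (hQ : Q.PosSemidef) (hQ' : Q'.PosSemidef) :
    Integrable (infoDensity H G Q Q') (gaussianInOut H G Q Q') := by
  have h1 : Integrable (fun p => logGauss (outCov H G Q Q') p.2) (gaussianInOut H G Q Q') := by
    have : Integrable (logGauss (outCov H G Q Q')) (gaussianInOut H G Q Q').snd := by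
      rw [snd_gaussianInOut H G hQ hQ']
      simpa using integrable_logGauss_add (outCov H G Q Q') 0
    exact (integrable_map_measure (by fun_prop) (by fun_prop)).1 this
  have h2 : Integrable (fun p => logGauss (intCov G Q') (p.2 - H.toEuclideanLin p.1))
      (gaussianInOut H G Q Q') := by
    rw [gaussianInOut_eq_map H G hQ', integrable_map_measure (by fun_prop) (by fun_prop)]
    have : Integrable (logGauss (intCov G Q')) (multivariateGaussian 0 (intCov G Q')) := by
      simpa using integrable_logGauss_add (intCov G Q') 0
    have h3 := this.comp_snd (multivariateGaussian 0 Q)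
    simpa [Function.comp_def] using h3
  exact h2.sub h1

lemma integral_infoDensity (hQ : Q.PosSemidef) (hQ' : Q'.PosSemidef) :
    ∫ p, infoDensity H G Q Q' p ∂(gaussianInOut H G Q Q') = gaussRate H G Q Q' := by
  have hN := posDef_intCov G hQ'
  have hY := posDef_outCov H G hQ hQ'
  have h1 : Integrable (fun p => logGauss (outCov H G Q Q') p.2) (gaussianInOut H G Q Q') := by
    have : Integrable (logGauss (outCov H G Q Q')) (gaussianInOut H G Q Q').snd := by
      rw [snd_gaussianInOut H G hQ hQ']
      simpa using integrable_logGauss_add (outCov H G Q Q') 0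
    exact (integrable_map_measure (by fun_prop) (by fun_prop)).1 this
  have e1 : ∫ p, logGauss (outCov H G Q Q') p.2 ∂(gaussianInOut H G Q Q') =
      ∫ y, logGauss (outCov H G Q Q') (0 + y) ∂(multivariateGaussian 0 (outCov H G Q Q')) := by
    rw [← snd_gaussianInOut H G hQ hQ', Measure.snd, integral_map (by fun_prop) (by fun_prop)]
    simp
  have e2 : ∫ p, logGauss (intCov G Q') (p.2 - H.toEuclideanLin p.1) ∂(gaussianInOut H G Q Q') =
      ∫ y, logGauss (intCov G Q') (0 + y) ∂(multivariateGaussian 0 (intCov G Q')) := by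
    rw [gaussianInOut_eq_map H G hQ', integral_map (by fun_prop) (by fun_prop)]
    simp only [add_sub_cancel_left, zero_add]
    rw [integral_fun_snd]
    simp
  have h2 : Integrable (fun p => logGauss (intCov G Q') (p.2 - H.toEuclideanLin p.1))
      (gaussianInOut H G Q Q') := by
    refine ((integrable_infoDensity H G hQ hQ').add h1).congr (Eventually.of_forall fun p => ?_)
    simp [infoDensity]
  unfold infoDensity
  rw [integral_sub h2 h1, e1, e2, integral_logGauss_add hN.posSemidef,
    integral_logGauss_add hY.posSemidef, gaussRate,
    Matrix.nonsing_inv_mul _ hN.det_pos.ne'.isUnit, Matrix.nonsing_inv_mul _ hY.det_pos.ne'.isUnit]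
  simp [quad]
  ring

lemma llr_gaussianInOut (hQ : Q.PosSemidef) (hQ' : Q'.PosSemidef) :
    llr (gaussianInOut H G Q Q') ((gaussianInOut H G Q Q').fst.prod (gaussianInOut H G Q Q').snd)
      =ᵐ[gaussianInOut H G Q Q'] infoDensity H G Q Q' := by
  rw [fst_gaussianInOut H G hQ', snd_gaussianInOut H G hQ hQ']
  set π := (multivariateGaussian 0 Q).prod (multivariateGaussian 0 (outCov H G Q Q'))
  have hac : gaussianInOut H G Q Q' ≪ π := by
    rw [gaussianInOut_eq_withDensity H G hQ hQ']; exact withDensity_absolutelyContinuous _ _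
  have h : (gaussianInOut H G Q Q').rnDeriv π =ᵐ[π]
      fun p => ENNReal.ofReal (Real.exp (infoDensity H G Q Q' p)) := by
    conv_lhs => rw [gaussianInOut_eq_withDensity H G hQ hQ']
    exact Measure.rnDeriv_withDensity _ (by fun_prop)
  filter_upwards [hac.ae_le h] with p hp
  rw [llr, hp, ENNReal.toReal_ofReal (Real.exp_pos _).le, Real.log_exp]

/-- The TIN rate is finite and equals its closed form. Nonnegativity is part of the claim because
`ENNReal.ofReal` truncates. -/
theorem tinRate_eq (hQ : Q.PosSemidef) (hQ' : Q'.PosSemidef) :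
    0 ≤ gaussRate H G Q Q' ∧ tinRate H G Q Q' = ENNReal.ofReal (gaussRate H G Q Q') := by
  set ρ := gaussianInOut H G Q Q' with hρ
  have hllr := llr_gaussianInOut H G hQ hQ'
  have hint : Integrable (llr ρ (ρ.fst.prod ρ.snd)) ρ :=
    (integrable_infoDensity H G hQ hQ').congr hllr.symm
  have hac : ρ ≪ ρ.fst.prod ρ.snd := by
    rw [hρ, fst_gaussianInOut H G hQ', snd_gaussianInOut H G hQ hQ',
      gaussianInOut_eq_withDensity H G hQ hQ']
    exact withDensity_absolutelyContinuous _ _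
  have hval : ∫ p, llr ρ (ρ.fst.prod ρ.snd) p ∂ρ = gaussRate H G Q Q' := by
    rw [integral_congr_ae hllr, integral_infoDensity H G hQ hQ']
  refine ⟨?_, ?_⟩
  · have := InformationTheory.integral_llr_add_sub_measure_univ_nonneg hac hint
    rw [hval] at this
    simpa using this
  · rw [tinRate, mutualInfo, InformationTheory.klDiv_of_ac_of_integrable hac hint, hval]
    simp

end TinRate

/-! ### First-order optimality -/

section FirstOrder

/-- Jacobi's formula for the logarithm of the determinant along a line. -/
lemma hasDerivAt_log_det {r : ℕ} {Y : Matrix (Fin r) (Fin r) ℝ} (hY : Y.PosDef)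
    (D : Matrix (Fin r) (Fin r) ℝ) :
    HasDerivAt (fun s : ℝ => Real.log (Y + s • D).det) (Y⁻¹ * D).trace 0 := by
  have uY : IsUnit Y.det := hY.det_pos.ne'.isUnit
  set p := (det (1 + (Polynomial.X : Polynomial ℝ) • (Y⁻¹ * D).map Polynomial.C)).divX.divX
  have hdet : ∀ s : ℝ, (Y + s • D).det =
      Y.det * (1 + (Y⁻¹ * D).trace * s + p.eval s * s ^ 2) := by
    intro s
    have : Y + s • D = Y * (1 + s • (Y⁻¹ * D)) := by
      rw [Matrix.mul_add, Matrix.mul_one, Matrix.mul_smul, ← Matrix.mul_assoc,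
        Matrix.mul_nonsing_inv _ uY, Matrix.one_mul]
    rw [this, det_mul, det_one_add_smul]
  simp_rw [hdet]
  have h1 : HasDerivAt (fun s : ℝ => (Y⁻¹ * D).trace * s) (Y⁻¹ * D).trace 0 := by
    simpa using (hasDerivAt_id (0 : ℝ)).const_mul (Y⁻¹ * D).trace
  have h2 : HasDerivAt (fun s : ℝ => p.eval s * s ^ 2) 0 0 := by
    have := (p.hasDerivAt (0 : ℝ)).mul ((hasDerivAt_id (0 : ℝ)).pow 2)
    refine (this.congr_deriv ?_).congr_of_eventuallyEq (Eventually.of_forall fun s => ?_)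
    · simp
    · simp
  have h3 : HasDerivAt
      (fun s : ℝ => Y.det * (1 + (Y⁻¹ * D).trace * s + p.eval s * s ^ 2))
      (Y.det * ((Y⁻¹ * D).trace + 0)) 0 := ((h1.const_add 1).add h2).const_mul _
  refine (h3.log (by simpa using hY.det_pos.ne')).congr_deriv ?_
  have := hY.det_pos.ne'
  simp only [add_zero, mul_zero, ne_eq, OfNat.ofNat_ne_zero, not_false_eq_true, zero_pow, mul_one]
  field_simp

lemma convex_powerSet (t : ℕ) (P : ℝ) : Convex ℝ (powerSet t P) := by
  intro Q hQ C hC a b ha hb hab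
  refine ⟨(hQ.1.smul ha).add (hC.1.smul hb), ?_⟩
  rw [trace_add, trace_smul, trace_smul, smul_eq_mul, smul_eq_mul]
  calc a * Q.trace + b * C.trace ≤ a * P + b * P := by
        gcongr
        · exact hQ.2
        · exact hC.2
    _ = P := by rw [← add_mul, hab, one_mul]

variable {t t' r : ℕ}

/-- The derivative of the Gaussian rate at `(Q, Q')` towards `(C, C')` is the rise of its tangent
plane. -/
lemma hasDerivAt_gaussRate (H : Matrix (Fin r) (Fin t) ℝ) (G : Matrix (Fin r) (Fin t') ℝ)
    {Q : Matrix (Fin t) (Fin t) ℝ} {Q' : Matrix (Fin t') (Fin t') ℝ} (hQ : Q.PosSemidef)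
    (hQ' : Q'.PosSemidef) (C : Matrix (Fin t) (Fin t) ℝ) (C' : Matrix (Fin t') (Fin t') ℝ) :
    HasDerivAt (fun s : ℝ => gaussRate H G (Q + s • (C - Q)) (Q' + s • (C' - Q')))
      (tangentRate H G Q Q' C C' - gaussRate H G Q Q') 0 := by
  have hN := posDef_intCov G hQ'
  have hY := posDef_outCov H G hQ hQ'
  have e1 : ∀ s : ℝ, intCov G (Q' + s • (C' - Q')) =
      intCov G Q' + s • (intCov G C' - intCov G Q') := by
    intro s
    simp only [intCov, add_sub_add_right_eq_sub, Matrix.mul_add, Matrix.add_mul, Matrix.mul_smul,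
      Matrix.smul_mul, Matrix.mul_sub, Matrix.sub_mul]
    abel
  have e2 : ∀ s : ℝ, outCov H G (Q + s • (C - Q)) (Q' + s • (C' - Q')) =
      outCov H G Q Q' + s • (outCov H G C C' - outCov H G Q Q') := by
    intro s
    simp only [outCov]
    rw [e1]
    simp only [Matrix.mul_add, Matrix.add_mul, Matrix.mul_smul,
      Matrix.smul_mul, Matrix.mul_sub, Matrix.sub_mul, smul_sub, smul_add]
    abel
  have h := ((hasDerivAt_log_det hY (outCov H G C C' - outCov H G Q Q')).sub
    (hasDerivAt_log_det hN (intCov G C' - intCov G Q'))).div_const 2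
  unfold gaussRate
  simp_rw [e1, e2]
  refine HasDerivAt.congr_deriv h ?_
  rw [tangentRate, Matrix.mul_sub, Matrix.mul_sub, trace_sub, trace_sub,
    Matrix.nonsing_inv_mul _ hY.det_pos.ne'.isUnit, Matrix.nonsing_inv_mul _ hN.det_pos.ne'.isUnit]
  ring

lemma deriv_nonpos_of_eventually_le {φ : ℝ → ℝ} {a : ℝ} (h : HasDerivAt φ a 0)
    (hle : ∀ᶠ s in 𝓝[>] (0 : ℝ), φ s ≤ φ 0) : a ≤ 0 := by
  have h1 : Tendsto (slope φ 0) (𝓝[>] 0) (𝓝 a) :=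
    (hasDerivAt_iff_tendsto_slope.1 h).mono_left (nhdsWithin_mono _ fun s hs => ne_of_gt hs)
  refine le_of_tendsto h1 ?_
  filter_upwards [hle, self_mem_nhdsWithin] with s hs hs0
  rw [slope_def_field]
  exact div_nonpos_of_nonpos_of_nonneg (by linarith) (by simpa using le_of_lt hs0)

/-- At a local maximizer of the sum rate over the convex feasible set, the tangent plane lies
below the maximum on the whole feasible set. -/
theorem tangentRate_le_of_isLocalMaxOn {t₁ t₂ r₁ r₂ : ℕ}
    (ch : InterferenceChannel t₁ t₂ r₁ r₂)
    {Q₁ : Matrix (Fin t₁) (Fin t₁) ℝ} {Q₂ : Matrix (Fin t₂) (Fin t₂) ℝ}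
    (hQ₁ : Q₁ ∈ powerSet t₁ ch.P₁) (hQ₂ : Q₂ ∈ powerSet t₂ ch.P₂)
    (hlocal : IsLocalMaxOn
      (fun Q : Matrix (Fin t₁) (Fin t₁) ℝ × Matrix (Fin t₂) (Fin t₂) ℝ => ch.tinSumRate Q.1 Q.2)
      (powerSet t₁ ch.P₁ ×ˢ powerSet t₂ ch.P₂) (Q₁, Q₂))
    {C₁ : Matrix (Fin t₁) (Fin t₁) ℝ} {C₂ : Matrix (Fin t₂) (Fin t₂) ℝ}
    (hC₁ : C₁ ∈ powerSet t₁ ch.P₁) (hC₂ : C₂ ∈ powerSet t₂ ch.P₂) :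
    tangentRate ch.H₁₁ ch.H₁₂ Q₁ Q₂ C₁ C₂ + tangentRate ch.H₂₂ ch.H₂₁ Q₂ Q₁ C₂ C₁ ≤
      gaussRate ch.H₁₁ ch.H₁₂ Q₁ Q₂ + gaussRate ch.H₂₂ ch.H₂₁ Q₂ Q₁ := by
  have hd := (hasDerivAt_gaussRate ch.H₁₁ ch.H₁₂ hQ₁.1 hQ₂.1 C₁ C₂).add
    (hasDerivAt_gaussRate ch.H₂₂ ch.H₂₁ hQ₂.1 hQ₁.1 C₂ C₁)
  have hmem : ∀ s ∈ Set.Icc (0 : ℝ) 1,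
      (Q₁ + s • (C₁ - Q₁), Q₂ + s • (C₂ - Q₂)) ∈ powerSet t₁ ch.P₁ ×ˢ powerSet t₂ ch.P₂ :=
    fun s hs => ⟨(convex_powerSet _ _).add_smul_sub_mem hQ₁ hC₁ hs,
      (convex_powerSet _ _).add_smul_sub_mem hQ₂ hC₂ hs⟩
  have hcont : Continuous fun s : ℝ => (Q₁ + s • (C₁ - Q₁), Q₂ + s • (C₂ - Q₂)) := by fun_prop
  have hev : ∀ᶠ s in 𝓝[>] (0 : ℝ), s ∈ Set.Icc (0 : ℝ) 1 := by
    filter_upwards [Ioc_mem_nhdsGT (one_pos : (0 : ℝ) < 1)] with s hs using ⟨hs.1.le, hs.2⟩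
  have htend : Tendsto (fun s : ℝ => (Q₁ + s • (C₁ - Q₁), Q₂ + s • (C₂ - Q₂))) (𝓝[>] 0)
      (𝓝[powerSet t₁ ch.P₁ ×ˢ powerSet t₂ ch.P₂] (Q₁, Q₂)) := by
    refine tendsto_nhdsWithin_iff.2 ⟨?_, hev.mono hmem⟩
    have := hcont.tendsto 0
    simp only [zero_smul, add_zero] at this
    exact this.mono_left nhdsWithin_le_nhds
  have h := deriv_nonpos_of_eventually_le hd ?_
  · linarith
  filter_upwards [htend.eventually hlocal, hev] with s hs hs01
  obtain ⟨hs₁, hs₂⟩ := hmem s hs01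
  simp only [InterferenceChannel.tinSumRate] at hs
  have a1 := tinRate_eq ch.H₁₁ ch.H₁₂ hs₁.1 hs₂.1
  have a2 := tinRate_eq ch.H₂₂ ch.H₂₁ hs₂.1 hs₁.1
  have b1 := tinRate_eq ch.H₁₁ ch.H₁₂ hQ₁.1 hQ₂.1
  have b2 := tinRate_eq ch.H₂₂ ch.H₂₁ hQ₂.1 hQ₁.1
  rw [a1.2, a2.2, b1.2, b2.2, ← ENNReal.ofReal_add a1.1 a2.1, ← ENNReal.ofReal_add b1.1 b2.1,
    ENNReal.ofReal_le_ofReal_iff (add_nonneg b1.1 b2.1)] at hs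
  simpa using hs

end FirstOrder

/-! ### Deviations of i.i.d. sums -/

section Deviations

variable {E : Type*} [MeasurableSpace E]

/-- Weak law of large numbers, lower tail. -/
lemma tendsto_measure_sum_le (ρ : Measure E) [IsProbabilityMeasure ρ] {f : E → ℝ}
    (hf : Measurable f) (hint : Integrable f ρ) {τ : ℝ} (hτ : τ < ∫ x, f x ∂ρ) :
    Tendsto (fun n : ℕ => (Measure.pi fun _ : Fin n => ρ) {x | ∑ k, f (x k) ≤ n * τ})
      atTop (𝓝 0) := by
  set P : Measure (ℕ → E) := Measure.infinitePi fun _ => ρ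
  have hmp : ∀ k, MeasurePreserving (fun ω : ℕ → E => ω k) P ρ := fun k =>
    measurePreserving_eval_infinitePi (fun _ : ℕ => ρ) k
  have hslln := strong_law_ae_real (μ := P) (fun k ω => f (ω k))
    ((hmp 0).integrable_comp_of_integrable hint)
    (fun i j hij => (iIndepFun_infinitePi (P := fun _ : ℕ => ρ) (X := fun _ => f)
      fun _ => hf).indepFun hij)
    (fun k => ⟨Measurable.aemeasurable (by fun_prop), Measurable.aemeasurable (by fun_prop), by
      have h1 := (hmp k).map_eq
      have h2 := (hmp 0).map_eq
      rw [show (fun ω : ℕ → E => f (ω k)) = f ∘ fun ω => ω k from rfl,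
        show (fun ω : ℕ → E => f (ω 0)) = f ∘ fun ω => ω 0 from rfl,
        ← Measure.map_map hf (by fun_prop), ← Measure.map_map hf (by fun_prop), h1, h2]⟩)
  have hmean : ∫ ω, f (ω 0) ∂P = ∫ x, f x ∂ρ := by
    have h := (hmp 0).map_eq
    conv_rhs => rw [← h]
    rw [integral_map (hmp 0).measurable.aemeasurable hf.aestronglyMeasurable]
  simp only [hmean] at hslln
  have hmeas := tendstoInMeasure_of_tendsto_ae (fun n => Measurable.aestronglyMeasurable
    (by fun_prop)) hslln
  have hpos : 0 < ENNReal.ofReal (∫ x, f x ∂ρ - τ) := ENNReal.ofReal_pos.2 (by linarith)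
  refine tendsto_of_tendsto_of_tendsto_of_le_of_le' tendsto_const_nhds (hmeas _ hpos)
    (Eventually.of_forall fun _ => zero_le) ?_
  filter_upwards [eventually_gt_atTop 0] with n hn
  have hn' : (0 : ℝ) < n := by exact_mod_cast hn
  have hmap : P.map (fun ω (k : Fin n) => ω k) = Measure.pi fun _ : Fin n => ρ := by
    rw [Measure.map_infinitePi_infinitePi_of_inj (P := fun _ : ℕ => ρ) Fin.val_injective,
      Measure.infinitePi_eq_pi]
  rw [← hmap, Measure.map_apply (by fun_prop)
    (measurableSet_le (by fun_prop) measurable_const)]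
  refine measure_mono fun ω hω => ?_
  simp only [Set.mem_preimage, Set.mem_ofPred_eq] at hω ⊢
  rw [edist_dist, Real.dist_eq, Finset.sum_range]
  refine ENNReal.ofReal_le_ofReal ?_
  have : (∑ k : Fin n, f (ω k)) / n ≤ τ := by rw [div_le_iff₀ hn']; linarith
  rw [abs_sub_comm]
  exact le_trans (by linarith) (le_abs_self _)

/-- Markov's inequality for the product of `exp (f xₖ)`, which has mean one. -/
lemma measure_lt_sum_le_exp {n : ℕ} (π : Measure E) [IsProbabilityMeasure π] {f : E → ℝ}
    (hf : Measurable f) (hexp : ∫⁻ x, ENNReal.ofReal (Real.exp (f x)) ∂π = 1) (θ : ℝ) :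
    (Measure.pi fun _ : Fin n => π) {x | θ < ∑ k, f (x k)} ≤ ENNReal.ofReal (Real.exp (-θ)) := by
  have h1 : ∫⁻ x, ENNReal.ofReal (Real.exp (∑ k, f (x k))) ∂(Measure.pi fun _ : Fin n => π) = 1 := by
    simp_rw [Real.exp_sum, ENNReal.ofReal_prod_of_nonneg fun _ _ => (Real.exp_pos _).le]
    rw [lintegral_fin_prod (fun _ => π) (fun _ x => ENNReal.ofReal (Real.exp (f x)))
      fun _ => by fun_prop]
    simp [hexp]
  have h2 := meas_ge_le_lintegral_div (μ := Measure.pi fun _ : Fin n => π)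
    (f := fun x => ENNReal.ofReal (Real.exp (∑ k, f (x k)))) (Measurable.aemeasurable (by fun_prop))
    (ENNReal.ofReal_pos.2 (Real.exp_pos θ)).ne' ENNReal.ofReal_ne_top
  rw [h1, one_div, ← ENNReal.ofReal_inv_of_pos (Real.exp_pos _), ← Real.exp_neg] at h2
  exact (measure_mono fun x hx => ENNReal.ofReal_le_ofReal (Real.exp_le_exp.2 (le_of_lt hx))).trans h2

end Deviations

/-! ### Threshold decoding of random codebooks -/

section RandomCoding

variable {t t' r n M M' : ℕ}

/-- The law of a random codebook whose vectors `c m k` are i.i.d. `N(0, Q)`. -/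
def codebookLaw (M n : ℕ) (Q : Matrix (Fin t) (Fin t) ℝ) : Measure (Codebook M n t) :=
  Measure.pi fun _ => gaussBlock n Q

instance (Q : Matrix (Fin t) (Fin t) ℝ) : IsProbabilityMeasure (codebookLaw M n Q) := by
  unfold codebookLaw; infer_instance

/-- `m` is the only message whose codeword has a score above the threshold. -/
def Decodes (i : RVec t × RVec r → ℝ) (θ : ℝ) (p : Codebook M n t × (Fin n → RVec r))
    (m : Fin M) : Prop :=
  θ < ∑ k, i (p.1 m k, p.2 k) ∧ ∀ m' ≠ m, ∑ k, i (p.1 m' k, p.2 k) ≤ θ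

open Classical in
/-- The threshold decoder: the only message with a score above `θ` if there is one, and an
arbitrary message otherwise. -/
def thresholdDec [NeZero M] (i : RVec t × RVec r → ℝ) (θ : ℝ)
    (p : Codebook M n t × (Fin n → RVec r)) : Fin M :=
  if h : ∃ m, Decodes i θ p m then h.choose else 0

lemma Decodes.unique {i : RVec t × RVec r → ℝ} {θ : ℝ} {p : Codebook M n t × (Fin n → RVec r)}
    {m m' : Fin M} (h : Decodes i θ p m) (h' : Decodes i θ p m') : m = m' := by
  by_contra hne
  exact absurd h.1 (not_lt.2 (h'.2 m hne))

lemma thresholdDec_eq_of_decodes [NeZero M] {i : RVec t × RVec r → ℝ} {θ : ℝ}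
    {p : Codebook M n t × (Fin n → RVec r)} {m : Fin M} (h : Decodes i θ p m) :
    thresholdDec i θ p = m := by
  have h' : ∃ m, Decodes i θ p m := ⟨m, h⟩
  rw [thresholdDec, dif_pos h']
  exact h'.choose_spec.unique h

lemma thresholdDec_eq_iff [NeZero M] {i : RVec t × RVec r → ℝ} {θ : ℝ}
    {p : Codebook M n t × (Fin n → RVec r)} {m : Fin M} :
    thresholdDec i θ p = m ↔ Decodes i θ p m ∨ (m = 0 ∧ ∀ m', ¬ Decodes i θ p m') := by
  constructor
  · intro h
    by_cases h' : ∃ m, Decodes i θ p m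
    · obtain ⟨m', hm'⟩ := h'
      rw [thresholdDec_eq_of_decodes hm'] at h
      exact Or.inl (h ▸ hm')
    · rw [thresholdDec, dif_neg h'] at h
      exact Or.inr ⟨h.symm, not_exists.1 h'⟩
  · rintro (h | ⟨rfl, h⟩)
    · exact thresholdDec_eq_of_decodes h
    · rw [thresholdDec, dif_neg (not_exists.2 h)]

lemma measurableSet_decodes {i : RVec t × RVec r → ℝ} (hi : Measurable i) (θ : ℝ) (m : Fin M) :
    MeasurableSet {p : Codebook M n t × (Fin n → RVec r) | Decodes i θ p m} := by
  have hs : ∀ m, Measurable fun p : Codebook M n t × (Fin n → RVec r) =>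
      ∑ k, i (p.1 m k, p.2 k) := fun m => by fun_prop
  have : {p : Codebook M n t × (Fin n → RVec r) | Decodes i θ p m} =
      {p | θ < ∑ k, i (p.1 m k, p.2 k)} ∩
        ⋂ m', ⋂ (_ : m' ≠ m), {p | ∑ k, i (p.1 m' k, p.2 k) ≤ θ} := by
    ext p
    simp [Decodes]
  rw [this]
  exact (measurableSet_lt measurable_const (hs m)).inter <| MeasurableSet.iInter fun m' =>
    MeasurableSet.iInter fun _ => measurableSet_le (hs m') measurable_const

lemma measurable_thresholdDec [NeZero M] {i : RVec t × RVec r → ℝ} (hi : Measurable i) (θ : ℝ) :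
    Measurable (thresholdDec (M := M) (n := n) i θ) := by
  refine measurable_to_countable' fun m => ?_
  have : thresholdDec (M := M) (n := n) i θ ⁻¹' {m} = {p | Decodes i θ p m} ∪
      ({p | m = 0} ∩ ⋂ m', {p | Decodes i θ p m'}ᶜ) := by
    ext p
    simpa using thresholdDec_eq_iff
  rw [this]
  exact (measurableSet_decodes hi θ m).union <| (MeasurableSet.const _).inter <|
    MeasurableSet.iInter fun m' => (measurableSet_decodes hi θ m').compl

lemma setOf_thresholdDec_ne_subset [NeZero M] (i : RVec t × RVec r → ℝ) (θ : ℝ)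
    (m : Fin M) :
    {p : Codebook M n t × (Fin n → RVec r) | thresholdDec i θ p ≠ m} ⊆
      {p | ∑ k, i (p.1 m k, p.2 k) ≤ θ} ∪
        ⋃ m' ∈ Finset.univ.erase m, {p | θ < ∑ k, i (p.1 m' k, p.2 k)} := by
  intro p hp
  by_contra hc
  simp only [Set.mem_union, Set.mem_ofPred_eq, Set.mem_iUnion, not_or, not_exists, not_le,
    not_lt, Finset.mem_erase, Finset.mem_univ, and_true] at hc
  exact hp (thresholdDec_eq_of_decodes ⟨hc.1, fun m' hm' => hc.2 m' hm'⟩)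


variable (H : Matrix (Fin r) (Fin t) ℝ) (G : Matrix (Fin r) (Fin t') ℝ)
  {Q : Matrix (Fin t) (Fin t) ℝ} {Q' : Matrix (Fin t') (Fin t') ℝ}

lemma map_eval_codebookLaw (Q : Matrix (Fin t) (Fin t) ℝ) (m : Fin M) :
    (codebookLaw M n Q).map (fun c => c m) = gaussBlock n Q :=
  (measurePreserving_eval (fun _ : Fin M => gaussBlock n Q) m).map_eq

lemma map_eval_eval_codebookLaw (Q : Matrix (Fin t) (Fin t) ℝ) {m m' : Fin M} (h : m ≠ m') :
    (codebookLaw M n Q).map (fun c => (c m, c m')) = (gaussBlock n Q).prod (gaussBlock n Q) := by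
  have hind : IndepFun (fun c : Codebook M n t => c m) (fun c => c m') (codebookLaw M n Q) :=
    (iIndepFun_pi (μ := fun _ : Fin M => gaussBlock n Q) (X := fun _ x => x)
      fun _ => aemeasurable_id).indepFun h
  rw [(indepFun_iff_map_prod_eq_prod_map_map (measurable_pi_apply m).aemeasurable
    (measurable_pi_apply m').aemeasurable).1 hind,
    map_eval_codebookLaw, map_eval_codebookLaw]

/-- Averaging over the interfering codebook turns interference plus noise into Gaussian noise. -/
lemma lintegral_noiseLaw_interference (hQ' : Q'.PosSemidef) (m' : Fin M')
    {S : Set (Fin n → RVec r)} (hS : MeasurableSet S) :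
    ∫⁻ c', noiseLaw n r {z | blockMap G (c' m') + z ∈ S} ∂(codebookLaw M' n Q') =
      gaussBlock n (intCov G Q') S := by
  have h := map_prod_gaussBlock (n := n) G (1 : Matrix (Fin r) (Fin r) ℝ) hQ' PosSemidef.one
  have hm : MeasurableSet
      ((fun p : (Fin n → RVec t') × (Fin n → RVec r) => blockMap G p.1 + p.2) ⁻¹' S) :=
    (by fun_prop : Measurable _) hS
  have h' : ((gaussBlock n Q').prod (gaussBlock n 1)).map (fun p => blockMap G p.1 + p.2) =
      gaussBlock n (intCov G Q') := by
    simpa [blockMap_one, intCov] using h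
  rw [noiseLaw_eq_gaussBlock, ← h', Measure.map_apply (by fun_prop) hS, Measure.prod_apply hm,
    ← map_eval_codebookLaw (M := M') Q' m', lintegral_map (measurable_measure_prodMk_left hm)
    (by fun_prop)]
  rfl

/-- Averaged over the codebook, the transmitted codeword and the output are i.i.d. Gaussian pairs. -/
lemma lintegral_own_score_le (hQ' : Q'.PosSemidef) (m : Fin M)
    {i : RVec t × RVec r → ℝ} (hi : Measurable i) (θ : ℝ) :
    ∫⁻ c, gaussBlock n (intCov G Q')
        {j | ∑ k, i (c m k, (blockMap H (c m) + j) k) ≤ θ} ∂(codebookLaw M n Q) =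
      (Measure.pi fun _ : Fin n => gaussianInOut H G Q Q') {x | ∑ k, i (x k) ≤ θ} := by
  have hm : MeasurableSet {p : (Fin n → RVec t) × (Fin n → RVec r) |
      ∑ k, i (p.1 k, (blockMap H p.1 + p.2) k) ≤ θ} := by
    refine measurableSet_le ?_ measurable_const
    simp only [Pi.add_apply, blockMap]
    fun_prop
  have h := map_pi_prod_pi (n := n) (multivariateGaussian 0 Q)
    (multivariateGaussian 0 (intCov G Q')) (fun p => (p.1, H.toEuclideanLin p.1 + p.2))
    (by fun_prop)
  rw [gaussianInOut_eq_map H G hQ', ← h, Measure.map_apply (by fun_prop)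
    (measurableSet_le (by fun_prop) measurable_const)]
  have h2 := Measure.prod_apply (μ := gaussBlock n Q) (ν := gaussBlock n (intCov G Q')) hm
  rw [← map_eval_codebookLaw (M := M) Q m,
    lintegral_map (measurable_measure_prodMk_left hm) (by fun_prop)] at h2
  rw [map_eval_codebookLaw] at h2
  exact h2.symm

/-- A codeword that was not transmitted is independent of the output, so its score exceeds `θ` with
probability at most `exp (-θ)`. -/
lemma lintegral_other_score_le (hQ : Q.PosSemidef) (hQ' : Q'.PosSemidef) {m m' : Fin M}
    (hne : m ≠ m') (θ : ℝ) :
    ∫⁻ c, gaussBlock n (intCov G Q')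
        {j | θ < ∑ k, infoDensity H G Q Q' (c m' k, (blockMap H (c m) + j) k)}
        ∂(codebookLaw M n Q) ≤ ENNReal.ofReal (Real.exp (-θ)) := by
  set i := infoDensity H G Q Q'
  have hi : Measurable i := measurable_infoDensity _ _ _ _
  set T : (Fin n → RVec t) → Set (Fin n → RVec r) := fun x' => {y | θ < ∑ k, i (x' k, y k)}
  have hmT : MeasurableSet {p : (Fin n → RVec t) × (Fin n → RVec r) | p.2 ∈ T p.1} :=
    measurableSet_lt (f := fun _ => θ) (g := fun p : (Fin n → RVec t) × (Fin n → RVec r) =>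
      ∑ k, i (p.1 k, p.2 k)) measurable_const (by fun_prop)
  have hmT' : MeasurableSet {p : ((Fin n → RVec t) × (Fin n → RVec t)) × (Fin n → RVec r) |
      blockMap H p.1.1 + p.2 ∈ T p.1.2} := by
    have : Measurable fun p : ((Fin n → RVec t) × (Fin n → RVec t)) × (Fin n → RVec r) =>
      (p.1.2, blockMap H p.1.1 + p.2) := by fun_prop
    exact this hmT
  have hmF : Measurable fun p : (Fin n → RVec t) × (Fin n → RVec t) =>
      gaussBlock n (intCov G Q') {j | blockMap H p.1 + j ∈ T p.2} :=
    measurable_measure_prodMk_left hmT'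
  have hY : ((gaussBlock n Q).prod (gaussBlock n (intCov G Q'))).map
      (fun p => blockMap H p.1 + p.2) = gaussBlock n (outCov H G Q Q') := by
    have h := map_prod_gaussBlock (n := n) H (1 : Matrix (Fin r) (Fin r) ℝ) hQ
      (posDef_intCov G hQ').posSemidef
    simpa [blockMap_one, outCov] using h
  calc ∫⁻ c, gaussBlock n (intCov G Q') {j | blockMap H (c m) + j ∈ T (c m')}
        ∂(codebookLaw M n Q)
      = ∫⁻ p, gaussBlock n (intCov G Q') {j | blockMap H p.1 + j ∈ T p.2}
          ∂((gaussBlock n Q).prod (gaussBlock n Q)) := by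
        rw [← map_eval_eval_codebookLaw Q hne,
          lintegral_map hmF (by fun_prop)]
    _ = ∫⁻ x', gaussBlock n (outCov H G Q Q') (T x') ∂(gaussBlock n Q) := by
        rw [lintegral_prod_symm _ hmF.aemeasurable]
        refine lintegral_congr fun x' => ?_
        have hT : MeasurableSet (T x') := measurable_prodMk_left hmT
        rw [← hY, Measure.map_apply (by fun_prop) hT, Measure.prod_apply
          ((by fun_prop : Measurable fun p : (Fin n → RVec t) × (Fin n → RVec r) =>
            blockMap H p.1 + p.2) hT)]
        rfl
    _ = (Measure.pi fun _ : Fin n =>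
          (multivariateGaussian 0 Q).prod (multivariateGaussian 0 (outCov H G Q Q')))
            {x | θ < ∑ k, i (x k)} := by
        have h := map_pi_prod_pi (n := n) (multivariateGaussian 0 Q)
          (multivariateGaussian 0 (outCov H G Q Q')) (fun p => p) measurable_id
        rw [Measure.map_id'] at h
        rw [← h, Measure.map_apply (by fun_prop) (measurableSet_lt measurable_const (by fun_prop))]
        exact (Measure.prod_apply hmT).symm
    _ ≤ ENNReal.ofReal (Real.exp (-θ)) := by
        refine measure_lt_sum_le_exp _ hi ?_ θ
        have h := gaussianInOut_eq_withDensity H G hQ hQ'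
        have h1 : gaussianInOut H G Q Q' Set.univ = 1 := measure_univ
        rwa [h, withDensity_apply _ MeasurableSet.univ, Measure.restrict_univ] at h1

lemma measurable_noiseLaw_thresholdDec_ne [NeZero M] {i : RVec t × RVec r → ℝ} (hi : Measurable i)
    (θ : ℝ) (m : Fin M) (m' : Fin M') :
    Measurable fun p : Codebook M n t × Codebook M' n t' => noiseLaw n r
      {z | thresholdDec i θ (p.1, blockMap H (p.1 m) + blockMap G (p.2 m') + z) ≠ m} := by
  have hs : MeasurableSet {q : (Codebook M n t × Codebook M' n t') × (Fin n → RVec r) |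
      thresholdDec i θ (q.1.1, blockMap H (q.1.1 m) + blockMap G (q.1.2 m') + q.2) ≠ m} := by
    have h1 : Measurable fun q : (Codebook M n t × Codebook M' n t') × (Fin n → RVec r) =>
      thresholdDec i θ (q.1.1, blockMap H (q.1.1 m) + blockMap G (q.1.2 m') + q.2) :=
      (measurable_thresholdDec hi θ).comp (by fun_prop)
    exact h1 (measurableSet_singleton m).compl
  have : SFinite (noiseLaw n r) := by unfold noiseLaw; infer_instance
  exact measurable_measure_prodMk_left hs

lemma lintegral_noiseLaw_thresholdDec_ne_le [NeZero M] (hQ : Q.PosSemidef) (hQ' : Q'.PosSemidef)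
    (θ : ℝ) (m : Fin M) (m' : Fin M') :
    ∫⁻ p, noiseLaw n r {z | thresholdDec (infoDensity H G Q Q') θ
        (p.1, blockMap H (p.1 m) + blockMap G (p.2 m') + z) ≠ m}
        ∂((codebookLaw M n Q).prod (codebookLaw M' n Q')) ≤
      (Measure.pi fun _ : Fin n => gaussianInOut H G Q Q')
        {x | ∑ k, infoDensity H G Q Q' (x k) ≤ θ} + M * ENNReal.ofReal (Real.exp (-θ)) := by
  set i := infoDensity H G Q Q'
  have hi : Measurable i := measurable_infoDensity _ _ _ _
  rw [lintegral_prod _ (measurable_noiseLaw_thresholdDec_ne H G hi θ m m').aemeasurable]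
  have hdec : ∀ c : Codebook M n t,
      MeasurableSet {j : Fin n → RVec r | thresholdDec i θ (c, blockMap H (c m) + j) ≠ m} := by
    intro c
    have h1 : Measurable fun j : Fin n → RVec r => thresholdDec i θ (c, blockMap H (c m) + j) :=
      (measurable_thresholdDec hi θ).comp (by fun_prop)
    exact h1 (measurableSet_singleton m).compl
  have hs : ∀ l : Fin M, Measurable fun q : Codebook M n t × (Fin n → RVec r) =>
      ∑ k, i (q.1 l k, (blockMap H (q.1 m) + q.2) k) := by
    intro l
    simp only [Pi.add_apply, blockMap]
    fun_prop
  have hm1 : Measurable fun c : Codebook M n t => gaussBlock n (intCov G Q')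
      {j | ∑ k, i (c m k, (blockMap H (c m) + j) k) ≤ θ} :=
    measurable_measure_prodMk_left (measurableSet_le (hs m) measurable_const)
  have hm2 : ∀ l, Measurable fun c : Codebook M n t => gaussBlock n (intCov G Q')
      {j | θ < ∑ k, i (c l k, (blockMap H (c m) + j) k)} := fun l =>
    measurable_measure_prodMk_left (measurableSet_lt measurable_const (hs l))
  calc _ = ∫⁻ c, gaussBlock n (intCov G Q')
        {j | thresholdDec i θ (c, blockMap H (c m) + j) ≠ m} ∂(codebookLaw M n Q) := by
        refine lintegral_congr fun c => ?_
        rw [← lintegral_noiseLaw_interference G hQ' m' (hdec c)]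
        simp only [Set.mem_ofPred_eq, add_assoc]
    _ ≤ ∫⁻ c, (gaussBlock n (intCov G Q')
          {j | ∑ k, i (c m k, (blockMap H (c m) + j) k) ≤ θ} +
          ∑ l ∈ Finset.univ.erase m, gaussBlock n (intCov G Q')
            {j | θ < ∑ k, i (c l k, (blockMap H (c m) + j) k)}) ∂(codebookLaw M n Q) := by
        refine lintegral_mono fun c => ?_
        have hsub : {j : Fin n → RVec r | thresholdDec i θ (c, blockMap H (c m) + j) ≠ m} ⊆
            {j | ∑ k, i (c m k, (blockMap H (c m) + j) k) ≤ θ} ∪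
            ⋃ l ∈ Finset.univ.erase m, {j | θ < ∑ k, i (c l k, (blockMap H (c m) + j) k)} := by
          intro j hj
          simpa using setOf_thresholdDec_ne_subset i θ m hj
        refine (measure_mono hsub).trans
          ((measure_union_le _ _).trans (add_le_add le_rfl ?_))
        exact measure_biUnion_finset_le _ _
    _ ≤ _ := by
        rw [lintegral_add_left hm1, lintegral_finsetSum _ fun l _ => hm2 l,
          lintegral_own_score_le H G hQ' m hi]
        refine add_le_add le_rfl ?_
        calc _ ≤ ∑ l ∈ Finset.univ.erase m, ENNReal.ofReal (Real.exp (-θ)) :=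
              Finset.sum_le_sum fun l hl =>
                lintegral_other_score_le H G hQ hQ' (Finset.ne_of_mem_erase hl).symm θ
          _ ≤ _ := by
              rw [Finset.sum_const, nsmul_eq_mul]
              gcongr
              exact (Finset.card_le_univ _).trans (by simp)

lemma ofReal_errorProb [NeZero M] [NeZero M'] (c : Codebook M n t) (c' : Codebook M' n t')
    (d : (Fin n → RVec r) → Fin M) :
    ENNReal.ofReal (errorProb H G c c' d) = ((M : ℝ≥0∞) * M')⁻¹ * ∑ m, ∑ m',
      noiseLaw n r {z | d (blockMap H (c m) + blockMap G (c' m') + z) ≠ m} := by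
  have hp : IsProbabilityMeasure (noiseLaw n r) := by
    rw [noiseLaw_eq_gaussBlock]; infer_instance
  have hM : (0 : ℝ) < M := by exact_mod_cast Nat.pos_of_ne_zero (NeZero.ne M)
  have hM' : (0 : ℝ) < M' := by exact_mod_cast Nat.pos_of_ne_zero (NeZero.ne M')
  rw [errorProb, ENNReal.ofReal_mul (by positivity), ENNReal.ofReal_inv_of_pos (by positivity),
    ENNReal.ofReal_mul (by positivity), ENNReal.ofReal_natCast, ENNReal.ofReal_natCast,
    ENNReal.ofReal_sum_of_nonneg fun m _ => Finset.sum_nonneg fun _ _ => measureReal_nonneg]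
  congr 1
  refine Finset.sum_congr rfl fun m _ => ?_
  rw [ENNReal.ofReal_sum_of_nonneg fun _ _ => measureReal_nonneg]
  refine Finset.sum_congr rfl fun m' _ => ?_
  rw [ofReal_measureReal]
  rfl

lemma measurable_errorProb_thresholdDec [NeZero M] [NeZero M'] {i : RVec t × RVec r → ℝ}
    (hi : Measurable i) (θ : ℝ) :
    Measurable fun p : Codebook M n t × Codebook M' n t' =>
      ENNReal.ofReal (errorProb H G p.1 p.2 fun y => thresholdDec i θ (p.1, y)) := by
  simp_rw [ofReal_errorProb]
  exact (Finset.measurable_fun_sum _ fun m _ => Finset.measurable_fun_sum _ fun m' _ =>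
    measurable_noiseLaw_thresholdDec_ne H G hi θ m m').const_mul _

/-- Random coding bound: the average error probability over both random codebooks is at most the
probability that the transmitted codeword misses the threshold, plus a union bound over the other
codewords. -/
theorem lintegral_errorProb_thresholdDec_le [NeZero M] [NeZero M'] (hQ : Q.PosSemidef)
    (hQ' : Q'.PosSemidef) (θ : ℝ) :
    ∫⁻ p, ENNReal.ofReal (errorProb H G p.1 p.2
        fun y => thresholdDec (infoDensity H G Q Q') θ (p.1, y))
        ∂((codebookLaw M n Q).prod (codebookLaw M' n Q')) ≤
      (Measure.pi fun _ : Fin n => gaussianInOut H G Q Q')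
        {x | ∑ k, infoDensity H G Q Q' (x k) ≤ θ} + M * ENNReal.ofReal (Real.exp (-θ)) := by
  have hi : Measurable (infoDensity H G Q Q') := measurable_infoDensity _ _ _ _
  have hM : (M : ℝ≥0∞) * M' ≠ 0 := by
    simp [NeZero.ne M, NeZero.ne M']
  have hM2 : (M : ℝ≥0∞) * M' ≠ ⊤ := ENNReal.mul_ne_top (by simp) (by simp)
  have hmeas := measurable_noiseLaw_thresholdDec_ne (n := n) (M := M) (M' := M') H G hi θ
  simp_rw [ofReal_errorProb]
  rw [lintegral_const_mul _ (Finset.measurable_fun_sum _ fun m _ =>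
    Finset.measurable_fun_sum _ fun m' _ => hmeas m m'), ENNReal.inv_mul_le_iff hM hM2,
    lintegral_finsetSum _ fun m _ => Finset.measurable_fun_sum _ fun m' _ => hmeas m m']
  calc _ ≤ ∑ m : Fin M, ∑ m' : Fin M', ((Measure.pi fun _ : Fin n => gaussianInOut H G Q Q')
        {x | ∑ k, infoDensity H G Q Q' (x k) ≤ θ} + M * ENNReal.ofReal (Real.exp (-θ))) := by
        refine Finset.sum_le_sum fun m _ => ?_
        rw [lintegral_finsetSum _ fun m' _ => hmeas m m']
        exact Finset.sum_le_sum fun m' _ =>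
          lintegral_noiseLaw_thresholdDec_ne_le H G hQ hQ' θ m m'
    _ = _ := by
        simp only [Finset.sum_const, Finset.card_univ, Fintype.card_fin, nsmul_eq_mul]
        ring

end RandomCoding

/-! ### Power of random codebooks -/

section Power

variable {t n M : ℕ} {Q : Matrix (Fin t) (Fin t) ℝ}

lemma integrable_norm_sq_multivariateGaussian :
    Integrable (fun x : RVec t => ‖x‖ ^ 2) (multivariateGaussian 0 Q) := by
  simpa [quad_one] using integrable_quad_add (S := Q) 1 0

lemma integral_norm_sq_multivariateGaussian (hQ : Q.PosSemidef) :
    ∫ x, ‖x‖ ^ 2 ∂(multivariateGaussian (0 : RVec t) Q) = Q.trace := by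
  simpa [quad_one] using integral_quad_add hQ 1 0

lemma measurePreserving_eval_eval_codebookLaw (Q : Matrix (Fin t) (Fin t) ℝ) (m : Fin M)
    (k : Fin n) :
    MeasurePreserving (fun c : Codebook M n t => c m k) (codebookLaw M n Q)
      (multivariateGaussian 0 Q) :=
  (measurePreserving_eval (fun _ : Fin n => multivariateGaussian (0 : RVec t) Q) k).comp
    (measurePreserving_eval (fun _ : Fin M => gaussBlock n Q) m)

lemma integrable_trace_avgCov :
    Integrable (fun c => (avgCov c).trace) (codebookLaw M n Q) := by
  simp_rw [trace_avgCov]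
  exact (integrable_finsetSum _ fun k _ => (integrable_finsetSum _ fun m _ =>
    (measurePreserving_eval_eval_codebookLaw Q m k).integrable_comp_of_integrable
      integrable_norm_sq_multivariateGaussian).const_mul _).const_mul _

lemma integral_trace_avgCov_le [NeZero M] (hQ : Q.PosSemidef) :
    ∫ c, (avgCov c).trace ∂(codebookLaw M n Q) ≤ Q.trace := by
  have hi : ∀ m k, Integrable (fun c : Codebook M n t => ‖c m k‖ ^ 2) (codebookLaw M n Q) :=
    fun m k => (measurePreserving_eval_eval_codebookLaw Q m k).integrable_comp_of_integrable
      integrable_norm_sq_multivariateGaussian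
  have hv : ∀ m k, ∫ c, ‖c m k‖ ^ 2 ∂(codebookLaw M n Q) = Q.trace := by
    intro m k
    have h := (measurePreserving_eval_eval_codebookLaw (M := M) (n := n) Q m k).map_eq
    rw [← integral_norm_sq_multivariateGaussian hQ, ← h, integral_map
      (measurePreserving_eval_eval_codebookLaw Q m k).measurable.aemeasurable (by fun_prop)]
  have hM : (M : ℝ) ≠ 0 := by exact_mod_cast NeZero.ne M
  simp_rw [trace_avgCov]
  rw [integral_const_mul, integral_finsetSum _ fun k _ =>
    (integrable_finsetSum _ fun m _ => hi m k).const_mul _]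
  simp_rw [integral_const_mul]
  simp_rw [integral_finsetSum _ fun m _ => hi m _, hv]
  simp only [Finset.sum_const, Finset.card_univ, Fintype.card_fin, nsmul_eq_mul]
  rcases Nat.eq_zero_or_pos n with rfl | hn
  · simpa using hQ.trace_nonneg
  · have hn' : (n : ℝ) ≠ 0 := by exact_mod_cast hn.ne'
    field_simp
    exact le_rfl

/-- A random codebook whose covariance leaves a relative power margin `ε` meets the power
constraint with probability at least `ε`, whatever its size. -/
lemma le_measure_trace_avgCov_le [NeZero M] (hQ : Q.PosSemidef) {P ε : ℝ} (hP : 0 ≤ P)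
    (hε : ε ≤ 1) (htr : Q.trace ≤ (1 - ε) * P) :
    ENNReal.ofReal ε ≤ codebookLaw M n Q {c | (avgCov c).trace ≤ P} := by
  have hnn : ∀ c : Codebook M n t, 0 ≤ (avgCov c).trace := fun c => (posSemidef_avgCov c).trace_nonneg
  have hint := integrable_trace_avgCov (M := M) (n := n) (Q := Q)
  have hle := integral_trace_avgCov_le (M := M) (n := n) hQ
  have hmeas : MeasurableSet {c : Codebook M n t | (avgCov c).trace ≤ P} := by
    simp_rw [trace_avgCov]
    exact measurableSet_le (by fun_prop) measurable_const
  rw [← ofReal_measureReal]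
  refine ENNReal.ofReal_le_ofReal ?_
  rcases hP.eq_or_lt with rfl | hP
  · -- with zero power the codewords vanish almost surely
    have h0 : ∫ c, (avgCov c).trace ∂(codebookLaw M n Q) = 0 :=
      le_antisymm (by linarith) (integral_nonneg hnn)
    have h1 := (integral_eq_zero_iff_of_nonneg hnn hint).1 h0
    have h2 : codebookLaw M n Q {c | (avgCov c).trace ≤ 0} = 1 := by
      rw [← prob_compl_eq_zero_iff hmeas, ← mem_ae_iff]
      filter_upwards [h1] with c hc using le_of_eq hc
    rw [measureReal_def, h2]
    simpa using hε
  · have h1 := mul_meas_ge_le_integral_of_nonneg (Eventually.of_forall hnn) hint P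
    have h2 : (codebookLaw M n Q).real {c | P ≤ (avgCov c).trace} ≤ 1 - ε := by
      refine le_of_mul_le_mul_left ?_ hP
      linarith
    have h3 := probReal_add_probReal_compl (μ := codebookLaw M n Q) hmeas
    have h4 : (codebookLaw M n Q).real {c | (avgCov c).trace ≤ P}ᶜ ≤
        (codebookLaw M n Q).real {c | P ≤ (avgCov c).trace} :=
      measureReal_mono fun c (hc : ¬ (avgCov c).trace ≤ P) => le_of_lt (not_le.1 hc)
    linarith

end Power

/-! ### Achievability -/

section Achievability

variable {t t' r : ℕ}

lemma tendsto_numMsg_mul_exp {R : ℝ≥0} {τ : ℝ} (hτ : (R : ℝ) < τ) :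
    Tendsto (fun n : ℕ => (numMsg n R : ℝ≥0∞) * ENNReal.ofReal (Real.exp (-(n * τ)))) atTop
      (𝓝 0) := by
  have hexp : ∀ a : ℝ, 0 < a → Tendsto (fun n : ℕ => Real.exp (-(n * a))) atTop (𝓝 0) := by
    intro a ha
    exact Real.tendsto_exp_neg_atTop_nhds_zero.comp
      (tendsto_natCast_atTop_atTop.atTop_mul_const ha)
  have hlim := ENNReal.tendsto_ofReal
    ((hexp (τ - R) (sub_pos.2 hτ)).add (hexp τ (lt_of_le_of_lt R.2 hτ)))
  rw [add_zero, ENNReal.ofReal_zero] at hlim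
  refine tendsto_of_tendsto_of_tendsto_of_le_of_le tendsto_const_nhds hlim (fun _ => zero_le) ?_
  intro n
  have h1 : (numMsg n R : ℝ) ≤ Real.exp (n * R) + 1 := (Nat.ceil_lt_add_one (Real.exp_pos _).le).le
  simp only
  rw [← ENNReal.ofReal_natCast, ← ENNReal.ofReal_mul (Nat.cast_nonneg _)]
  refine ENNReal.ofReal_le_ofReal ?_
  calc (numMsg n R : ℝ) * Real.exp (-(n * τ)) ≤ (Real.exp (n * R) + 1) * Real.exp (-(n * τ)) := by
        gcongr
    _ = Real.exp (-(n * (τ - R))) + Real.exp (-(n * τ)) := by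
        rw [add_mul, one_mul, ← Real.exp_add]
        ring_nf

/-- Below the Gaussian rate there are decoders for which the error probability, averaged over
random codebooks, vanishes. -/
lemma exists_decoders (H : Matrix (Fin r) (Fin t) ℝ) (G : Matrix (Fin r) (Fin t') ℝ)
    {Q : Matrix (Fin t) (Fin t) ℝ} {Q' : Matrix (Fin t') (Fin t') ℝ} (hQ : Q.PosSemidef)
    (hQ' : Q'.PosSemidef) {R : ℝ≥0} (R' : ℝ≥0) (hR : R = 0 ∨ (R : ℝ) < gaussRate H G Q Q') :
    ∃ (D : ∀ n, Codebook (numMsg n R) n t → (Fin n → RVec r) → Fin (numMsg n R)) (δ : ℕ → ℝ≥0∞),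
      (∀ n c, Measurable (D n c)) ∧
      (∀ n, Measurable fun p : Codebook (numMsg n R) n t × Codebook (numMsg n R') n t' =>
        ENNReal.ofReal (errorProb H G p.1 p.2 (D n p.1))) ∧
      Tendsto δ atTop (𝓝 0) ∧
      ∀ n, ∫⁻ p, ENNReal.ofReal (errorProb H G p.1 p.2 (D n p.1))
        ∂((codebookLaw (numMsg n R) n Q).prod (codebookLaw (numMsg n R') n Q')) ≤ δ n := by
  rcases hR with rfl | hR
  · -- at rate zero there is a single message
    have hsub : ∀ n, Subsingleton (Fin (numMsg n 0)) := by
      intro n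
      have : numMsg n 0 = 1 := by simp [numMsg]
      rw [this]
      infer_instance
    have h0 : ∀ n (c : Codebook (numMsg n 0) n t) (c' : Codebook (numMsg n R') n t'),
        errorProb H G c c' (fun _ => 0) = 0 := by
      intro n c c'
      have : ∀ m : Fin (numMsg n 0), ¬ ((0 : Fin (numMsg n 0)) ≠ m) := fun m =>
        not_not.2 ((hsub n).elim _ _)
      simp [errorProb, this]
    exact ⟨fun n _ _ => 0, 0, fun n c => measurable_const, fun n => by simp [h0],
      tendsto_const_nhds, fun n => by simp [h0]⟩
  · obtain ⟨τ, hτ₁, hτ₂⟩ := exists_between hR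
    refine ⟨fun n c y => thresholdDec (infoDensity H G Q Q') (n * τ) (c, y), fun n =>
      (Measure.pi fun _ : Fin n => gaussianInOut H G Q Q')
        {x | ∑ k, infoDensity H G Q Q' (x k) ≤ n * τ} +
        (numMsg n R : ℝ≥0∞) * ENNReal.ofReal (Real.exp (-(n * τ))),
      fun n c => (measurable_thresholdDec (measurable_infoDensity _ _ _ _) _).comp (by fun_prop),
      fun n => measurable_errorProb_thresholdDec H G (measurable_infoDensity _ _ _ _) _, ?_,
      fun n => lintegral_errorProb_thresholdDec_le H G hQ hQ' _⟩
    have h1 := tendsto_measure_sum_le (gaussianInOut H G Q Q') (measurable_infoDensity H G Q Q')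
      (integrable_infoDensity H G hQ hQ') (τ := τ) (by rwa [integral_infoDensity H G hQ hQ'])
    simpa using h1.add (tendsto_numMsg_mul_exp hτ₁)

lemma tendsto_zero_of_ofReal_le {e : ℕ → ℝ} {δ : ℕ → ℝ≥0∞} (he : ∀ n, 0 ≤ e n)
    (hδ : Tendsto δ atTop (𝓝 0)) (h : ∀ n, ENNReal.ofReal (e n) ≤ δ n) :
    Tendsto e atTop (𝓝 0) := by
  have h1 : Tendsto (fun n => ENNReal.ofReal (e n)) atTop (𝓝 0) :=
    tendsto_of_tendsto_of_tendsto_of_le_of_le tendsto_const_nhds hδ (fun _ => zero_le) h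
  have h2 := (ENNReal.tendsto_toReal ENNReal.zero_ne_top).comp h1
  simpa [Function.comp_def, ENNReal.toReal_ofReal (he _)] using h2

lemma errorProb_nonneg {M M' n : ℕ} (H : Matrix (Fin r) (Fin t) ℝ) (G : Matrix (Fin r) (Fin t') ℝ)
    (c : Codebook M n t) (c' : Codebook M' n t') (d : (Fin n → RVec r) → Fin M) :
    0 ≤ errorProb H G c c' d :=
  mul_nonneg (by positivity) (Finset.sum_nonneg fun _ _ => Finset.sum_nonneg fun _ _ =>
    measureReal_nonneg)

/-- Rates below the Gaussian rates are achievable when the covariances leave a relative power margin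
`ε`. At rate zero the single message needs no decoding, hence the alternative `Rᵢ = 0`. -/
theorem achievable_of_lt_gaussRate {t₁ t₂ r₁ r₂ : ℕ} (ch : InterferenceChannel t₁ t₂ r₁ r₂)
    {Q₁ : Matrix (Fin t₁) (Fin t₁) ℝ} {Q₂ : Matrix (Fin t₂) (Fin t₂) ℝ}
    (hQ₁ : Q₁.PosSemidef) (hQ₂ : Q₂.PosSemidef) (hP₁ : 0 ≤ ch.P₁) (hP₂ : 0 ≤ ch.P₂)
    {ε : ℝ} (hε : 0 < ε) (hε1 : ε ≤ 1) (htr₁ : Q₁.trace ≤ (1 - ε) * ch.P₁)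
    (htr₂ : Q₂.trace ≤ (1 - ε) * ch.P₂) {R₁ R₂ : ℝ≥0}
    (hR₁ : R₁ = 0 ∨ (R₁ : ℝ) < gaussRate ch.H₁₁ ch.H₁₂ Q₁ Q₂)
    (hR₂ : R₂ = 0 ∨ (R₂ : ℝ) < gaussRate ch.H₂₂ ch.H₂₁ Q₂ Q₁) :
    ch.Achievable R₁ R₂ := by
  obtain ⟨D₁, δ₁, hD₁, hm₁, hδ₁, hE₁⟩ := exists_decoders ch.H₁₁ ch.H₁₂ hQ₁ hQ₂ R₂ hR₁
  obtain ⟨D₂, δ₂, hD₂, hm₂, hδ₂, hE₂⟩ := exists_decoders ch.H₂₂ ch.H₂₁ hQ₂ hQ₁ R₁ hR₂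
  set κ : ℝ≥0∞ := ENNReal.ofReal ε * ENNReal.ofReal ε
  have hκ : κ ≠ 0 := mul_ne_zero (ENNReal.ofReal_pos.2 hε).ne' (ENNReal.ofReal_pos.2 hε).ne'
  -- the good event has probability at least `ε ^ 2`, so some good pair of codebooks has an error
  -- of at most `ε⁻²` times the average
  have hex : ∀ n, ∃ p : Codebook (numMsg n R₁) n t₁ × Codebook (numMsg n R₂) n t₂,
      ((avgCov p.1).trace ≤ ch.P₁ ∧ (avgCov p.2).trace ≤ ch.P₂) ∧
      ENNReal.ofReal (errorProb ch.H₁₁ ch.H₁₂ p.1 p.2 (D₁ n p.1)) +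
        ENNReal.ofReal (errorProb ch.H₂₂ ch.H₂₁ p.2 p.1 (D₂ n p.2)) ≤ κ⁻¹ * (δ₁ n + δ₂ n) := by
    intro n
    set μ₁ := codebookLaw (numMsg n R₁) n Q₁
    set μ₂ := codebookLaw (numMsg n R₂) n Q₂
    set F : Codebook (numMsg n R₁) n t₁ × Codebook (numMsg n R₂) n t₂ → ℝ≥0∞ := fun p =>
      ENNReal.ofReal (errorProb ch.H₁₁ ch.H₁₂ p.1 p.2 (D₁ n p.1)) +
        ENNReal.ofReal (errorProb ch.H₂₂ ch.H₂₁ p.2 p.1 (D₂ n p.2))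
    have hm₂' := (hm₂ n).comp (measurable_swap (α := Codebook (numMsg n R₁) n t₁))
    have hF : Measurable F := (hm₁ n).add hm₂'
    have hFint : ∫⁻ p, F p ∂(μ₁.prod μ₂) ≤ δ₁ n + δ₂ n := by
      rw [lintegral_add_left (hm₁ n)]
      refine add_le_add (hE₁ n) (le_trans (le_of_eq ?_) (hE₂ n))
      rw [← lintegral_prod_swap]
      rfl
    set S := {c : Codebook (numMsg n R₁) n t₁ | (avgCov c).trace ≤ ch.P₁} ×ˢ
      {c : Codebook (numMsg n R₂) n t₂ | (avgCov c).trace ≤ ch.P₂}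
    have hS : κ ≤ (μ₁.prod μ₂) S := by
      rw [Measure.prod_prod]
      exact mul_le_mul' (le_measure_trace_avgCov_le hQ₁ hP₁ hε1 htr₁)
        (le_measure_trace_avgCov_le hQ₂ hP₂ hε1 htr₂)
    obtain ⟨p, hpS, hp⟩ := exists_le_setLAverage (μ := μ₁.prod μ₂) (s := S) (f := F)
      (fun h => hκ (le_antisymm (hS.trans h.le) zero_le)) (measure_ne_top _ _)
      hF.aemeasurable
    refine ⟨p, hpS, hp.trans ?_⟩
    rw [setLAverage_eq, ENNReal.div_eq_inv_mul]
    exact mul_le_mul' (ENNReal.inv_le_inv.2 hS) ((setLIntegral_le_lintegral _ _).trans hFint)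
  choose p hpow herr using hex
  have hlim : Tendsto (fun n => κ⁻¹ * (δ₁ n + δ₂ n)) atTop (𝓝 0) := by
    have := ENNReal.Tendsto.const_mul (a := κ⁻¹) (hδ₁.add hδ₂) (Or.inr (ENNReal.inv_ne_top.2 hκ))
    simpa using this
  exact ⟨fun n => ⟨(p n).1, (p n).2, D₁ n (p n).1, D₂ n (p n).2, hD₁ n _, hD₂ n _⟩,
    fun n => ⟨⟨posSemidef_avgCov _, (hpow n).1⟩, ⟨posSemidef_avgCov _, (hpow n).2⟩⟩,
    tendsto_zero_of_ofReal_le (fun n => errorProb_nonneg _ _ _ _ _) hlim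
      fun n => le_self_add.trans (herr n),
    tendsto_zero_of_ofReal_le (fun n => errorProb_nonneg _ _ _ _ _) hlim
      fun n => le_add_self.trans (herr n)⟩

/-- The pair of Gaussian rates is the limit of achievable pairs, obtained by backing off by `ε` in
power and in rate. -/
theorem gaussRate_mem_capacityRegion {t₁ t₂ r₁ r₂ : ℕ} (ch : InterferenceChannel t₁ t₂ r₁ r₂)
    {Q₁ : Matrix (Fin t₁) (Fin t₁) ℝ} {Q₂ : Matrix (Fin t₂) (Fin t₂) ℝ}
    (hQ₁ : Q₁ ∈ powerSet t₁ ch.P₁) (hQ₂ : Q₂ ∈ powerSet t₂ ch.P₂) :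
    ((gaussRate ch.H₁₁ ch.H₁₂ Q₁ Q₂).toNNReal, (gaussRate ch.H₂₂ ch.H₂₁ Q₂ Q₁).toNNReal) ∈
      ch.capacityRegion := by
  have hP₁ : 0 ≤ ch.P₁ := hQ₁.1.trace_nonneg.trans hQ₁.2
  have hP₂ : 0 ≤ ch.P₂ := hQ₂.1.trace_nonneg.trans hQ₂.2
  set a₁ : ℝ → ℝ := fun ε => gaussRate ch.H₁₁ ch.H₁₂ (Q₁ + ε • (0 - Q₁)) (Q₂ + ε • (0 - Q₂))
  set a₂ : ℝ → ℝ := fun ε => gaussRate ch.H₂₂ ch.H₂₁ (Q₂ + ε • (0 - Q₂)) (Q₁ + ε • (0 - Q₁))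
  have h₁ : Tendsto (fun ε => a₁ ε - ε) (𝓝[>] 0) (𝓝 (gaussRate ch.H₁₁ ch.H₁₂ Q₁ Q₂)) := by
    have h := (hasDerivAt_gaussRate ch.H₁₁ ch.H₁₂ hQ₁.1 hQ₂.1 0 0).continuousAt.tendsto.sub
      tendsto_id
    simp only [zero_smul, add_zero, sub_zero] at h
    exact h.mono_left nhdsWithin_le_nhds
  have h₂ : Tendsto (fun ε => a₂ ε - ε) (𝓝[>] 0) (𝓝 (gaussRate ch.H₂₂ ch.H₂₁ Q₂ Q₁)) := by
    have h := (hasDerivAt_gaussRate ch.H₂₂ ch.H₂₁ hQ₂.1 hQ₁.1 0 0).continuousAt.tendsto.sub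
      tendsto_id
    simp only [zero_smul, add_zero, sub_zero] at h
    exact h.mono_left nhdsWithin_le_nhds
  refine mem_closure_of_tendsto (((continuous_real_toNNReal.tendsto _).comp h₁).prodMk_nhds
    ((continuous_real_toNNReal.tendsto _).comp h₂)) ?_
  filter_upwards [Ioc_mem_nhdsGT (one_pos : (0 : ℝ) < 1)] with ε hε
  have hscale : ∀ {t : ℕ} (Q : Matrix (Fin t) (Fin t) ℝ), Q + ε • (0 - Q) = (1 - ε) • Q := by
    intro t Q
    rw [zero_sub, smul_neg, sub_smul, one_smul, sub_eq_add_neg]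
  have hpsd : ∀ {t : ℕ} {Q : Matrix (Fin t) (Fin t) ℝ}, Q.PosSemidef →
      (Q + ε • (0 - Q)).PosSemidef := by
    intro t Q hQ
    rw [hscale]
    exact hQ.smul (sub_nonneg.2 hε.2)
  have htr : ∀ {t : ℕ} {Q : Matrix (Fin t) (Fin t) ℝ} {P : ℝ}, Q.trace ≤ P →
      (Q + ε • (0 - Q)).trace ≤ (1 - ε) * P := by
    intro t Q P hQ
    rw [hscale, trace_smul, smul_eq_mul]
    exact mul_le_mul_of_nonneg_left hQ (sub_nonneg.2 hε.2)
  have hrate : ∀ a : ℝ, (a - ε).toNNReal = 0 ∨ ((a - ε).toNNReal : ℝ) < a := by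
    intro a
    rcases le_total (a - ε) 0 with h | h
    · exact Or.inl (Real.toNNReal_of_nonpos h)
    · right
      rw [Real.coe_toNNReal _ h]
      linarith [hε.1]
  exact achievable_of_lt_gaussRate ch (hpsd hQ₁.1) (hpsd hQ₂.1) hP₁ hP₂ hε.1 hε.2 (htr hQ₁.2)
    (htr hQ₂.2) (hrate _) (hrate _)

end Achievability

/-! ### The sum capacity -/

lemma isUnit_of_rank_eq {t : ℕ} {Q : Matrix (Fin t) (Fin t) ℝ} (h : Q.rank = t) : IsUnit Q := by
  rw [← mulVec_surjective_iff_isUnit]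
  refine (LinearMap.range_eq_top (f := Q.mulVecLin)).1 (Submodule.eq_top_of_finrank_eq ?_)
  rw [← Matrix.rank, h]
  simp

lemma eq_of_sub_mul_eq_zero {s t : ℕ} {Q : Matrix (Fin t) (Fin t) ℝ} (hQ : IsUnit Q)
    {B C : Matrix (Fin s) (Fin t) ℝ} (h : (B - C) * Q = 0) : B = C := by
  have h1 := congrArg (· * Q⁻¹) h
  simp only [Matrix.zero_mul] at h1
  rw [Matrix.mul_assoc, mul_nonsing_inv _ ((isUnit_iff_isUnit_det Q).1 hQ), Matrix.mul_one] at h1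
  exact sub_eq_zero.1 h1

lemma sumCapacity_le_of_forall_achievable {t₁ t₂ r₁ r₂ : ℕ} (ch : InterferenceChannel t₁ t₂ r₁ r₂)
    {B : ℝ} (h : ∀ R₁ R₂, ch.Achievable R₁ R₂ → (R₁ : ℝ) + R₂ ≤ B) :
    ch.sumCapacity ≤ ENNReal.ofReal B := by
  have hcl : IsClosed {R : ℝ≥0 × ℝ≥0 | (R.1 : ℝ) + R.2 ≤ B} :=
    isClosed_le (by fun_prop) continuous_const
  refine iSup₂_le fun R hR => ?_
  have hR' : (R.1 : ℝ) + R.2 ≤ B := closure_minimal (fun R hR => h _ _ hR) hcl hR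
  rw [← ENNReal.coe_add, ← ENNReal.ofReal_coe_nnreal]
  exact ENNReal.ofReal_le_ofReal (by simpa using hR')

end MIMO

end

theorem theorem1 {t₁ t₂ r₁ r₂ : ℕ} (ch : MIMO.InterferenceChannel t₁ t₂ r₁ r₂)
    (Q₁ : Matrix (Fin t₁) (Fin t₁) ℝ) (Q₂ : Matrix (Fin t₂) (Fin t₂) ℝ)
    -- `(Q₁, Q₂)` is a feasible, full-rank, local maximizer of the TIN sum rate
    (hQ₁ : Q₁ ∈ MIMO.powerSet t₁ ch.P₁) (hQ₂ : Q₂ ∈ MIMO.powerSet t₂ ch.P₂)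
    (hrank₁ : Q₁.rank = t₁) (hrank₂ : Q₂.rank = t₂)
    (hlocal : IsLocalMaxOn
      (fun Q : Matrix (Fin t₁) (Fin t₁) ℝ × Matrix (Fin t₂) (Fin t₂) ℝ => ch.tinSumRate Q.1 Q.2)
      (MIMO.powerSet t₁ ch.P₁ ×ˢ MIMO.powerSet t₂ ch.P₂) (Q₁, Q₂))
    -- genie parameters
    (A₁ : Matrix (Fin r₁) (Fin r₂) ℝ) (A₂ : Matrix (Fin r₂) (Fin r₁) ℝ)
    (S₁ : Matrix (Fin r₂) (Fin r₂) ℝ) (S₂ : Matrix (Fin r₁) (Fin r₁) ℝ)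
    (hS₁ : S₁.PosDef) (hS₂ : S₂.PosDef)
    -- usefulness
    (huseful₁ : (1 - A₂ * S₂⁻¹ * A₂.transpose - S₁).PosSemidef)
    (huseful₂ : (1 - A₁ * S₁⁻¹ * A₁.transpose - S₂).PosSemidef)
    -- smartness at `(Q₁, Q₂)`
    (hsmart₁ : (A₁.transpose * (ch.H₁₂ * Q₂ * ch.H₁₂.transpose + 1)⁻¹ * ch.H₁₁ - ch.H₂₁) * Q₁ = 0)
    (hsmart₂ : (A₂.transpose * (ch.H₂₁ * Q₁ * ch.H₂₁.transpose + 1)⁻¹ * ch.H₂₂ - ch.H₁₂) * Q₂ = 0) :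
    -- the sum capacity is the TIN sum rate, and the TIN rate pair lies in the capacity region
    ch.sumCapacity = ch.tinSumRate Q₁ Q₂ ∧
    ∃ R : ℝ≥0 × ℝ≥0, R ∈ ch.capacityRegion ∧
      (R.1 : ℝ≥0∞) = MIMO.tinRate ch.H₁₁ ch.H₁₂ Q₁ Q₂ ∧
      (R.2 : ℝ≥0∞) = MIMO.tinRate ch.H₂₂ ch.H₂₁ Q₂ Q₁ := by
  have hB := fun C₁ hC₁ C₂ hC₂ => MIMO.tangentRate_le_of_isLocalMaxOn (C₁ := C₁) (C₂ := C₂)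
    ch hQ₁ hQ₂ hlocal hC₁ hC₂
  obtain ⟨hnn₁, hr₁⟩ := MIMO.tinRate_eq ch.H₁₁ ch.H₁₂ hQ₁.1 hQ₂.1
  obtain ⟨hnn₂, hr₂⟩ := MIMO.tinRate_eq ch.H₂₂ ch.H₂₁ hQ₂.1 hQ₁.1
  -- full rank cancels the factor `Qᵢ`; codewords of any covariance need the resulting identity
  have hsm₁ := MIMO.eq_of_sub_mul_eq_zero (MIMO.isUnit_of_rank_eq hrank₁) hsmart₁
  have hsm₂ := MIMO.eq_of_sub_mul_eq_zero (MIMO.isUnit_of_rank_eq hrank₂) hsmart₂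
  have hmem := MIMO.gaussRate_mem_capacityRegion ch hQ₁ hQ₂
  refine ⟨le_antisymm ?_ ?_, _, hmem, hr₁.symm, hr₂.symm⟩
  · rw [MIMO.InterferenceChannel.tinSumRate, hr₁, hr₂, ← ENNReal.ofReal_add hnn₁ hnn₂]
    exact MIMO.sumCapacity_le_of_forall_achievable ch fun R₁ R₂ hR =>
      MIMO.add_le_of_achievable ch hQ₁.1 hQ₂.1 hS₁ hS₂ huseful₁ huseful₂ hsm₁ hsm₂ hB hR
  · rw [MIMO.InterferenceChannel.tinSumRate, hr₁, hr₂]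
    exact le_iSup₂_of_le _ hmem le_rfl
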